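/- **Setting.** Let $\Delta=\{\xi\in\mathbb R^n : l_k(\xi)=\langle\nu_k,\xi\rangle+c_k>0,\ k=1,\dots,d\}$ be a Delzant polytope with respect to the lattice $\mathbb Z^n$ (bounded, with nonempty interior; the $\nu_k\in\mathbb Z^n$ are the inward normals of its $d$ facets, and at each vertex the normals of the facets through it form a $\mathbb Z$-basis of $\mathbb Z^n$). Let $M$ be the associated toric variety, with torus coordinates $z^i=e^{(x^i+\sqrt{-1}\,y^i)/2}$ on its open orbit. Let $\omega_g$ be the Guillemin metric, whose potential $g(x)$ in the log-affine coordinates $x\in\mathbb R^n$ is the Legendre transform of $\sum_k l_k\log l_k$. Let $\mathbb D>0$ be a smooth function on $\overline\Delta$. Let $\phi$ be a smooth $T^n$-invariant function on $M$ with $\omega_f>0$ on $M$, where $f=g+\phi$. For $h\in\{f,g\}$ write, in the coordinates $x$, $h_{ij}=\frac{\partial^2h}{\partial x^i\partial x^j}$, $(h^{ij})=(h_{ij})^{-1}$, $\mathbb D_h=\mathbb D\circ\nabla h$, $\mathbb F_h=\mathbb D_h\det(h_{ij})$, and $$\mathcal S_{\mathbb D}(f)=-\sum_{i,j}f^{ij}\frac{\partial^2\log\mathbb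 F_f}{\partial x^i\partial x^j}-\sum_{i,j}f^{ij}\frac{\partial\log\mathbb F_f}{\partial x^i}\frac{\partial\log\mathbb D_f}{\partial x^j}.$$ Put $$R_g=\max_M\Big\{\Big|\sum_{i,j}g^{ij}(\log\mathbb F_g)_{ij}\Big|+|\nabla_x\log\mathbb F_g|^2\Big\},\qquad \mathcal D=\max_{\overline\Delta}|\nabla_\xi\log\mathbb D|,\qquad \mathcal R=\max\{R_g,\ \mathcal D^2,\ (\operatorname{diam}\Delta)^2\},$$ with Euclidean norms and diameter. Let $H=\det(g_{i\bar j})/\det(f_{i\bar j})$, computed in local holomorphic coordinates; it is a global function on $M$. **Theorem.** Everywhere on $M$, $$H\le C\exp\Big\{(2\mathcal R+1)\big(\max_M\phi-\min_M\phi\big)\Big\},$$ where $C$ is a constant depending only on $n$, $\max|\mathcal S_{\mathbb D}(f)|$ and $\mathcal R$ (in particular, not otherwise on $\Delta$, $\mathbb D$ or $\phi$). -/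

import Mathlib

open Real Set Topology
open scoped ContDiff ComplexOrder

noncomputable section

/-- `𝔱` and `𝔱*`, both identified with Euclidean `ℝⁿ`; the lattice is `ℤⁿ`. -/
abbrev EV (n : ℕ) := EuclideanSpace ℝ (Fin n)

/-- The affine function `ξ ↦ ⟨ν, ξ⟩ + c`. -/
def affineFn {n : ℕ} (ν : Fin n → ℤ) (c : ℝ) (ξ : EV n) : ℝ :=
  (∑ i, (ν i : ℝ) * ξ i) + c

/-- A Delzant polytope `{ξ | ⟨ν_k, ξ⟩ + c_k ≥ 0, k = 1, …, d}` in `ℝⁿ`: bounded, with nonempty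
interior, described by its facets without redundancy, and such that at every vertex the inward
normals of the facets through that vertex form a `ℤ`-basis of `ℤⁿ` (in particular all the
normals are primitive). -/
structure DelzantPolytope (n : ℕ) where
  /-- number of facets -/
  d : ℕ
  /-- primitive inward normals of the facets -/
  normal : Fin d → Fin n → ℤ
  /-- constants of the facets -/
  c : Fin d → ℝ
  bounded : Bornology.IsBounded {ξ : EV n | ∀ k, 0 ≤ affineFn (normal k) (c k) ξ}
  interior_nonempty : ∃ ξ : EV n, ∀ k, 0 < affineFn (normal k) (c k) ξ
  facet : ∀ k, ∃ ξ : EV n, affineFn (normal k) (c k) ξ = 0 ∧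
    ∀ j, j ≠ k → 0 < affineFn (normal j) (c j) ξ
  delzant : ∀ p ∈ extremePoints ℝ {ξ : EV n | ∀ k, 0 ≤ affineFn (normal k) (c k) ξ},
    LinearIndependent ℤ (fun k : {k : Fin d // affineFn (normal k) (c k) p = 0} => normal k) ∧
    Submodule.span ℤ
      (Set.range fun k : {k : Fin d // affineFn (normal k) (c k) p = 0} => normal k) = ⊤

namespace DelzantPolytope

variable {n : ℕ} (Δ : DelzantPolytope n)

/-- The defining function `l_k(ξ) = ⟨ν_k, ξ⟩ + c_k` of the `k`-th facet. -/
def l (k : Fin Δ.d) (ξ : EV n) : ℝ := affineFn (Δ.normal k) (Δ.c k) ξ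

/-- The closed polytope. -/
def body : Set (EV n) := {ξ | ∀ k, 0 ≤ Δ.l k ξ}

/-! ### The toric variety, as the quotient of an open set of `ℂᵈ` by a complex torus -/

/-- The open set of those `Z ∈ ℂᵈ` for which the facets `{l_k = 0}` with `Z_k = 0` have a common
point in the polytope. -/
def coxSet : Set (Fin Δ.d → ℂ) :=
  {Z | ∃ ξ ∈ Δ.body, ∀ k, Z k = 0 → Δ.l k ξ = 0}

/-- The orbit relation of the group `{t ∈ (ℂ*)ᵈ | ∏ₖ t_k ^ ν_k = 1}` (the kernel of
`(ℂ*)ᵈ → (ℂ*)ⁿ`) acting on `coxSet`. -/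
def toricSetoid : Setoid Δ.coxSet where
  r Z W := ∃ t : Fin Δ.d → ℂˣ, (∀ i, ∏ k, t k ^ Δ.normal k i = 1) ∧
    ∀ k, W.1 k = t k * Z.1 k
  iseqv :=
    { refl := fun Z => ⟨1, by simp, by simp⟩
      symm := by
        rintro Z W ⟨t, h1, h2⟩
        refine ⟨t⁻¹, fun i => ?_, fun k => ?_⟩
        · simp [h1 i]
        · simp [h2 k]
      trans := by
        rintro Z W V ⟨t, h1, h2⟩ ⟨s, h3, h4⟩
        refine ⟨s * t, fun i => ?_, fun k => ?_⟩
        · simp [mul_zpow, Finset.prod_mul_distrib, h1 i, h3 i]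
        · simp [h4 k, h2 k, mul_assoc] }

/-- The toric variety `M` of the polytope. -/
def ToricVariety : Type := Quotient Δ.toricSetoid

/-- The point of `M` with homogeneous coordinates `Z`. -/
def toM (Z : Fin Δ.d → ℂ) (hZ : Z ∈ Δ.coxSet) : Δ.ToricVariety :=
  Quotient.mk Δ.toricSetoid ⟨Z, hZ⟩

theorem circle_mul_mem (s : Fin Δ.d → Circle) {Z : Fin Δ.d → ℂ} (hZ : Z ∈ Δ.coxSet) :
    (fun k => (s k : ℂ) * Z k) ∈ Δ.coxSet := by
  obtain ⟨ξ, h1, h2⟩ := hZ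
  refine ⟨ξ, h1, fun k hk => h2 k ?_⟩
  simpa using hk

/-- `b` lists (in some order) the `n` facets through a vertex. -/
structure IsFrame (b : Fin n → Fin Δ.d) : Prop where
  inj : Function.Injective b
  common : ∃ p ∈ Δ.body, ∀ i, Δ.l (b i) p = 0

/-- Homogeneous coordinates of the point with coordinates `z ∈ ℂⁿ` in the affine chart of `M`
at the vertex with frame `b`: `Z_{b i} = z_i`, and all the other `Z_k` are `1`. -/
def lift (b : Fin n → Fin Δ.d) (z : Fin n → ℂ) : Fin Δ.d → ℂ :=
  Function.extend b z (fun _ => 1)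

theorem lift_mem {b : Fin n → Fin Δ.d} (hb : Δ.IsFrame b) (z : Fin n → ℂ) :
    Δ.lift b z ∈ Δ.coxSet := by
  obtain ⟨p, hp, h⟩ := hb.common
  refine ⟨p, hp, fun k hk => ?_⟩
  by_cases hex : ∃ i, b i = k
  · obtain ⟨i, rfl⟩ := hex
    exact h i
  · rw [lift, Function.extend_apply' _ _ _ hex] at hk
    exact absurd hk one_ne_zero

/-- The holomorphic chart `ℂⁿ → M` at a vertex (these charts, one for each vertex, cover `M`). -/
def chart {b : Fin n → Fin Δ.d} (hb : Δ.IsFrame b) (z : Fin n → ℂ) : Δ.ToricVariety :=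
  Δ.toM (Δ.lift b z) (Δ.lift_mem hb z)

/-- Invariance under the compact torus `Tⁿ` (which `(S¹)ᵈ` surjects onto). -/
def IsInvariant (φ : Δ.ToricVariety → ℝ) : Prop :=
  ∀ (s : Fin Δ.d → Circle) (Z : Fin Δ.d → ℂ) (hZ : Z ∈ Δ.coxSet),
    φ (Δ.toM (fun k => (s k : ℂ) * Z k) (Δ.circle_mul_mem s hZ)) = φ (Δ.toM Z hZ)

/-- Smooth functions on `M`: smooth in every chart. -/
def IsSmooth (φ : Δ.ToricVariety → ℝ) : Prop :=
  ∀ (b : Fin n → Fin Δ.d) (hb : Δ.IsFrame b), ContDiff ℝ ∞ fun z => φ (Δ.chart hb z)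

/-! ### Log-affine coordinates on the open orbit -/

/-- The normals span `ℝⁿ`. -/
theorem exists_sum_normal (x : EV n) :
    ∃ y : Fin Δ.d → ℝ, ∀ i, ∑ k, y k * (Δ.normal k i : ℝ) = x i := by
  let v : Fin Δ.d → EV n := fun k => WithLp.toLp 2 fun i => (Δ.normal k i : ℝ)
  have hspan : Submodule.span ℝ (Set.range v) = ⊤ := by
    rw [← Submodule.orthogonal_eq_bot_iff, Submodule.eq_bot_iff]
    intro w hw
    by_contra hne
    have hv : ∀ k, ∑ i, (Δ.normal k i : ℝ) * w i = 0 := by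
      intro k
      have h := (Submodule.mem_orthogonal _ w).1 hw (v k) (Submodule.subset_span ⟨k, rfl⟩)
      simpa [v, PiLp.inner_apply, mul_comm] using h
    obtain ⟨ξ, hξ⟩ := Δ.interior_nonempty
    obtain ⟨C, hC⟩ := Δ.bounded.exists_norm_le
    have hmem : ∀ s : ℝ, ‖ξ + s • w‖ ≤ C := by
      intro s
      apply hC
      intro k
      have : affineFn (Δ.normal k) (Δ.c k) (ξ + s • w) = affineFn (Δ.normal k) (Δ.c k) ξ := by
        have e : ∑ i, (Δ.normal k i : ℝ) * (s * w i) = s * ∑ i, (Δ.normal k i : ℝ) * w i := by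
          rw [Finset.mul_sum]
          exact Finset.sum_congr rfl fun i _ => by ring
        simp [affineFn, mul_add, Finset.sum_add_distrib, e, hv k]
      rw [this]
      exact (hξ k).le
    have hw0 : 0 < ‖w‖ := norm_pos_iff.2 hne
    have h1 := hmem ((C + ‖ξ‖ + 1) / ‖w‖)
    have hC0 : 0 ≤ C := (norm_nonneg _).trans h1
    have h2 : ‖((C + ‖ξ‖ + 1) / ‖w‖) • w‖ = C + ‖ξ‖ + 1 := by
      rw [norm_smul, Real.norm_of_nonneg (by positivity)]
      field_simp
    have h3 := norm_sub_le (ξ + ((C + ‖ξ‖ + 1) / ‖w‖) • w) ξ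
    rw [add_sub_cancel_left, h2] at h3
    linarith
  have hx : x ∈ Submodule.span ℝ (Set.range v) := hspan ▸ Submodule.mem_top
  obtain ⟨y, hy⟩ := (Submodule.mem_span_range_iff_exists_fun ℝ).1 hx
  refine ⟨y, fun i => ?_⟩
  rw [← hy]
  simp [v]

/-- Homogeneous coordinates `Z_k = exp (y_k / 2)`, with `∑ₖ y_k ν_k = x`, of the point of the open
orbit whose torus coordinates `∏ₖ Z_k ^ ν_{k,i}` are `exp (x_i / 2)`. -/
def expLift (x : EV n) : Fin Δ.d → ℂ :=
  fun k => ((Real.exp ((Δ.exists_sum_normal x).choose k / 2) : ℝ) : ℂ)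

theorem expLift_mem (x : EV n) : Δ.expLift x ∈ Δ.coxSet := by
  obtain ⟨ξ, hξ⟩ := Δ.interior_nonempty
  refine ⟨ξ, fun k => (hξ k).le, fun k hk => ?_⟩
  rw [expLift, Complex.ofReal_eq_zero] at hk
  exact absurd hk (Real.exp_pos _).ne'

/-- The point of the open orbit with log-affine coordinates `x` (and angular coordinate `0`):
its torus coordinates are `z^i = exp (x^i / 2)`. -/
def expPoint (x : EV n) : Δ.ToricVariety := Δ.toM (Δ.expLift x) (Δ.expLift_mem x)

/-! ### The Guillemin metric -/

/-- Guillemin's symplectic potential `∑ₖ l_k log l_k`. -/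
def guilleminU (ξ : EV n) : ℝ := ∑ k, Δ.l k ξ * Real.log (Δ.l k ξ)

/-- The potential `g` of the Guillemin metric in the log-affine coordinates: the Legendre
transform of Guillemin's symplectic potential. -/
def g (x : EV n) : ℝ := ⨆ ξ : Δ.body, (inner ℝ x ξ.1 - Δ.guilleminU ξ.1)

/-- The potential of the Guillemin metric in homogeneous coordinates. Where no `Z_k` vanishes it
is `g(x) + ∑ₖ c_k log |Z_k|²`, with `x = ∑ₖ ν_k log |Z_k|²`, because
`∑ₖ l_k(ξ) log |Z_k|² = ⟨x, ξ⟩ + ∑ₖ c_k log |Z_k|²`; where some `Z_k` vanish, the supremum runs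
over the corresponding face, which is the continuous extension. -/
def gHom (Z : Fin Δ.d → ℂ) : ℝ :=
  ⨆ ξ : {ξ : EV n // ξ ∈ Δ.body ∧ ∀ k, Z k = 0 → Δ.l k ξ = 0},
    ((∑ k, Δ.l k ξ.1 * Real.log (‖Z k‖ ^ 2)) - Δ.guilleminU ξ.1)

/-- The local potential of the Guillemin metric in the chart at the vertex `p` with frame `b`; on
the open orbit it is `g(x) - ⟨p, x⟩`, and `⟨p, x⟩` is pluriharmonic. -/
def gLocal (b : Fin n → Fin Δ.d) (z : Fin n → ℂ) : ℝ := Δ.gHom (Δ.lift b z)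

end DelzantPolytope

/-- The complex Hessian `(∂²h / ∂z^i ∂z̄^j)` of a real function on `ℂⁿ`. -/
def complexHessian {n : ℕ} (h : (Fin n → ℂ) → ℝ) (z : Fin n → ℂ) : Matrix (Fin n) (Fin n) ℂ :=
  Matrix.of fun i j =>
    let a : Fin n → (Fin n → ℂ) := fun i => Pi.single i 1
    let b : Fin n → (Fin n → ℂ) := fun i => Pi.single i Complex.I
    let D2 : (Fin n → ℂ) → (Fin n → ℂ) → ℝ := fun v w => fderiv ℝ (fderiv ℝ h) z v w
    (1 / 4 : ℂ) * (((D2 (a i) (a j) + D2 (b i) (b j) : ℝ) : ℂ)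
      + Complex.I * ((D2 (a i) (b j) - D2 (b i) (a j) : ℝ) : ℂ))

/-- `∂F/∂x^i`. -/
def pd {n : ℕ} (i : Fin n) (F : EV n → ℝ) (x : EV n) : ℝ :=
  fderiv ℝ F x (EuclideanSpace.single i 1)

/-- The real Hessian `(F_{ij})`. -/
def hess {n : ℕ} (F : EV n → ℝ) (x : EV n) : Matrix (Fin n) (Fin n) ℝ :=
  Matrix.of fun i j => pd i (pd j F) x

/-- `log 𝔻_f`, where `𝔻_f = 𝔻 ∘ ∇f`. -/
def logD {n : ℕ} (D : EV n → ℝ) (f : EV n → ℝ) (x : EV n) : ℝ := Real.log (D (gradient f x))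

/-- `log 𝔽_f`, where `𝔽_f = 𝔻_f det (f_{ij})`. -/
def logF {n : ℕ} (D : EV n → ℝ) (f : EV n → ℝ) (x : EV n) : ℝ :=
  Real.log (D (gradient f x) * (hess f x).det)

/-- The operator
`𝒮_𝔻(f) = - ∑ f^{ij} (log 𝔽_f)_{ij} - ∑ f^{ij} (log 𝔽_f)_i (log 𝔻_f)_j`. -/
def SD {n : ℕ} (D : EV n → ℝ) (f : EV n → ℝ) (x : EV n) : ℝ :=
  -(∑ i, ∑ j, (hess f x)⁻¹ i j * pd i (pd j (logF D f)) x)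
    - ∑ i, ∑ j, (hess f x)⁻¹ i j * pd i (logF D f) x * pd j (logD D f) x

namespace DelzantPolytope

variable {n : ℕ} (Δ : DelzantPolytope n)

/-- The potential `f = g + φ` in the log-affine coordinates. -/
def f (φ : Δ.ToricVariety → ℝ) (x : EV n) : ℝ := Δ.g x + φ (Δ.expPoint x)

/-- The local potential `f = g + φ` in the chart at a vertex. -/
def fLocal (φ : Δ.ToricVariety → ℝ) {b : Fin n → Fin Δ.d} (hb : Δ.IsFrame b)
    (z : Fin n → ℂ) : ℝ := Δ.gLocal b z + φ (Δ.chart hb z)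

/-- `g + φ` belongs to `C^∞(M, ω_g)`: `φ` is a smooth `Tⁿ`-invariant function on `M` with
`ω_{g + φ} > 0` on all of `M`. -/
structure IsKahlerPotential (φ : Δ.ToricVariety → ℝ) : Prop where
  smooth : Δ.IsSmooth φ
  invariant : Δ.IsInvariant φ
  pos : ∀ (b : Fin n → Fin Δ.d) (hb : Δ.IsFrame b) (z : Fin n → ℂ),
    (complexHessian (Δ.fLocal φ hb) z).PosDef

/-- `H = det (g_{i j̄}) / det (f_{i j̄})`, computed in the chart at a vertex. -/
def H (φ : Δ.ToricVariety → ℝ) {b : Fin n → Fin Δ.d} (hb : Δ.IsFrame b) (z : Fin n → ℂ) : ℝ :=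
  (complexHessian (Δ.gLocal b) z).det.re / (complexHessian (Δ.fLocal φ hb) z).det.re

/-- The function `|∑ g^{ij} (log 𝔽_g)_{ij}| + |∇_x log 𝔽_g|²` on the open orbit. -/
def RgFun (D : EV n → ℝ) (x : EV n) : ℝ :=
  |∑ i, ∑ j, (hess Δ.g x)⁻¹ i j * pd i (pd j (logF D Δ.g)) x|
    + ∑ i, (pd i (logF D Δ.g) x) ^ 2

/-- `𝓡 = max {R_g, 𝒟², diam(Δ)²}`. The maximum `R_g` over `M` is the least upper bound over the
open orbit, which is dense in `M`. -/
def IsCurlyR (D : EV n → ℝ) (R : ℝ) : Prop :=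
  ∃ Rg Dm : ℝ, IsLUB (Set.range (Δ.RgFun D)) Rg ∧
    IsGreatest ((fun ξ => ‖gradientWithin (fun η => Real.log (D η)) Δ.body ξ‖) '' Δ.body) Dm ∧
    R = max Rg (max (Dm ^ 2) (Metric.diam Δ.body ^ 2))

end DelzantPolytope

end

/-! On the open orbit H is the ratio det(g_ij)/det(f_ij) of real Hessians in x, and both local
determinants are continuous in the vertex charts, so by density it suffices to bound log H at each
x. This is done by a maximum principle in which log det(g_ij) is replaced by a function whose
Hessian is a multiple of that of g.

For a vertex p with primitive edge vectors e_i put v = (5/4)R p + ∑ e_i. Up to constants depending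
on n and R, the function ⟨v,x⟩ - (5/4)R g(x) is at most log det(g_ij) everywhere
(`log_det_hess_g_ge`), and at least log det(g_ij) where ∇g(x) is near p
(`exists_log_det_hess_g_le`). Indeed, at ξ = ∇g(x) it equals ∑ B_k (log l_k(ξ) + 1) - (5/4)R ∑
l_k(ξ) with B_k = (5/4)R l_k(p) + ⟨ν_k, ∑ e_i⟩, while log det(g_ij) is, up to a bounded error, the
sum of log l_k(ξ) over the facets through a vertex close to ξ. So what is needed is B_k ≥ 1, with
equality for the facets through p: (5/4)R times the polarization plus the canonical class is nef.

Nefness comes from R_g. Letting ξ tend to p along p + s ∑ e_i, the quantity defining R_g gives, with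
the integers m_i = ⟨ν_k, e_i⟩ (`Frame.vertex_bound`), ∑_k (∑ m_i² + (∑ m_i)²)/l_k(p) ≤ (5/4)R,
summed over the facets not through p. Since ∑ m_i² ≥ 1 and t² + t ≥ 0 for integers t, this yields
B_k ≥ 1. It also bounds edges, normals, facet functions and the number of facets in terms of n and
R, which makes every constant uniform.

Now let Ψ = ⟨v,x⟩ + (3/4 R + 1) g - (2R + 1) f - log F_f. Because 5/4 R + 3/4 R + 1 = 2R + 1 and
both ∇g and ∇f lie in Δ, the critical point equation writes ∇ log F_f as ∑ e_i plus multiples of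
differences of points of Δ, hence bounds it. The second order condition and the definition of S_D
then bound tr(f⁻¹g) at the maximum, and the arithmetic-geometric inequality bounds log H there
(`trace_le_of_forall_le`). Comparing Ψ at x with its maximum, for the vertex p near ∇g(x), gives the
estimate (`log_det_div_le`). A term ε(⟨q,x⟩ - f) with q interior makes the maximum exist; finally ε
tends to 0. -/

noncomputable section

/-! ### Faces, vertices and lattice frames of a Delzant polytope. -/

namespace DelzantPolytope

variable {n : ℕ} (Δ : DelzantPolytope n)

/-- The normal of the `k`-th facet as a Euclidean vector. -/
def nu (k : Fin Δ.d) : EV n := WithLp.toLp 2 fun i => (Δ.normal k i : ℝ)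

theorem nu_apply (k : Fin Δ.d) (i : Fin n) : Δ.nu k i = (Δ.normal k i : ℝ) := rfl

theorem inner_eq_sum {n : ℕ} (v w : EV n) : inner ℝ v w = ∑ i, v i * w i := by
  simp [PiLp.inner_apply, mul_comm]

theorem l_eq_inner (k : Fin Δ.d) (ξ : EV n) : Δ.l k ξ = inner ℝ (Δ.nu k) ξ + Δ.c k := by
  simp [l, affineFn, inner_eq_sum, nu_apply]

theorem l_add (k : Fin Δ.d) (ξ v : EV n) : Δ.l k (ξ + v) = Δ.l k ξ + inner ℝ (Δ.nu k) v := by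
  rw [l_eq_inner, l_eq_inner, inner_add_right]; ring

theorem l_sub_l (k : Fin Δ.d) (ξ η : EV n) :
    Δ.l k ξ - Δ.l k η = inner ℝ (Δ.nu k) (ξ - η) := by
  rw [l_eq_inner, l_eq_inner, inner_sub_right]; ring

theorem contDiff_l (k : Fin Δ.d) : ContDiff ℝ ∞ (Δ.l k) := by
  have : Δ.l k = fun ξ => inner ℝ (Δ.nu k) ξ + Δ.c k := funext (Δ.l_eq_inner k)
  rw [this]
  exact (contDiff_const.inner ℝ contDiff_id).add contDiff_const

theorem continuous_l (k : Fin Δ.d) : Continuous (Δ.l k) := (Δ.contDiff_l k).continuous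

theorem l_convexComb (k : Fin Δ.d) (ξ η : EV n) (s t : ℝ) (h : s + t = 1) :
    Δ.l k (s • ξ + t • η) = s * Δ.l k ξ + t * Δ.l k η := by
  simp only [l_eq_inner, inner_add_right, inner_smul_right]
  linear_combination -(Δ.c k) * h

theorem isClosed_body : IsClosed Δ.body := by
  simp only [body, ofPred_forall]
  exact isClosed_iInter fun k => isClosed_le continuous_const (Δ.continuous_l k)

theorem isBounded_body : Bornology.IsBounded Δ.body := Δ.bounded

theorem isCompact_body : IsCompact Δ.body :=
  Metric.isCompact_of_isClosed_isBounded Δ.isClosed_body Δ.isBounded_body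

theorem convex_body : Convex ℝ Δ.body := by
  intro ξ hξ η hη s t hs ht hst k
  rw [l_convexComb _ _ _ _ _ _ hst]
  have := hξ k
  have := hη k
  positivity

theorem body_nonempty : Δ.body.Nonempty := by
  obtain ⟨ξ, h⟩ := Δ.interior_nonempty
  exact ⟨ξ, fun k => (h k).le⟩

/-- The open polytope. -/
def openBody : Set (EV n) := {ξ | ∀ k, 0 < Δ.l k ξ}

theorem isOpen_openBody : IsOpen Δ.openBody := by
  simp only [openBody, ofPred_forall]
  exact isOpen_iInter_of_finite fun k => isOpen_lt continuous_const (Δ.continuous_l k)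

theorem openBody_subset : Δ.openBody ⊆ Δ.body := fun _ h k => (h k).le

theorem body_mem_nhds {ξ : EV n} (h : ξ ∈ Δ.openBody) : Δ.body ∈ 𝓝 ξ :=
  Filter.mem_of_superset (Δ.isOpen_openBody.mem_nhds h) Δ.openBody_subset

theorem nu_ne_zero (k : Fin Δ.d) : Δ.nu k ≠ 0 := by
  intro h
  obtain ⟨ξ, h0, -⟩ := Δ.facet k
  obtain ⟨η, h1⟩ := Δ.interior_nonempty
  have h2 := Δ.l_sub_l k η ξ
  rw [h, inner_zero_left] at h2
  have h3 : 0 < Δ.l k η := h1 k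
  have h4 : Δ.l k ξ = 0 := h0
  linarith

/-- A vertex `p`, an enumeration `b` of the facets through it, and the basis `e` of the lattice
dual to the basis of their normals (the primitive edge vectors at `p`). -/
structure Frame (b : Fin n → Fin Δ.d) (p : EV n) (e : Fin n → EV n) : Prop where
  inj : Function.Injective b
  mem : p ∈ Δ.body
  zero : ∀ i, Δ.l (b i) p = 0
  pos : ∀ k, k ∉ Set.range b → 0 < Δ.l k p
  dual : ∀ i j, inner ℝ (Δ.nu (b i)) (e j) = if i = j then (1 : ℝ) else 0
  int : ∀ j a, ∃ m : ℤ, e j a = m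

/-- The normals at a vertex form a ℤ-basis, so their matrix `N` has an integral inverse `A`, whose
columns are the edge vectors. The vertex has exactly `n` facets, so an injective list of `n` of them
is complete and all others are positive at `p`. -/
theorem frame_of_mem_extremePoints {p : EV n} (hp : p ∈ extremePoints ℝ Δ.body)
    (b : Fin n → Fin Δ.d) (hb : Function.Injective b) (h0 : ∀ i, Δ.l (b i) p = 0) :
    ∃ e, Δ.Frame b p e := by
  obtain ⟨li, sp⟩ := Δ.delzant p hp
  let B := Module.Basis.mk li sp.ge
  have hcard : Fintype.card {k : Fin Δ.d // affineFn (Δ.normal k) (Δ.c k) p = 0} = n := by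
    rw [← Module.finrank_eq_card_basis B, Module.finrank_fin_fun]
  let b' : Fin n → {k : Fin Δ.d // affineFn (Δ.normal k) (Δ.c k) p = 0} := fun i => ⟨b i, h0 i⟩
  have hb' : Function.Bijective b' := by
    rw [Fintype.bijective_iff_injective_and_card]
    refine ⟨fun i j hij => hb (congrArg Subtype.val hij), by simp [hcard]⟩
  let B' := B.reindex (Equiv.ofBijective b' hb').symm
  have hB' : ∀ i, B' i = Δ.normal (b i) := by
    intro i
    simp [B', B, b']
  let N : Matrix (Fin n) (Fin n) ℤ := Matrix.of fun i a => Δ.normal (b i) a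
  let A : Matrix (Fin n) (Fin n) ℤ := Matrix.of fun a i => B'.repr (Pi.single a 1) i
  have hAN : A * N = 1 := by
    ext a a'
    have h := congrFun (B'.sum_repr (Pi.single a 1)) a'
    simp only [Finset.sum_apply, Pi.smul_apply, smul_eq_mul, hB'] at h
    rw [Matrix.mul_apply, Matrix.one_apply]
    simp only [A, N, Matrix.of_apply]
    rw [h, Pi.single_apply]
    simp [eq_comm]
  have hNA : N * A = 1 := mul_eq_one_comm.1 hAN
  refine ⟨fun j => WithLp.toLp 2 fun a => (A a j : ℝ), hb, hp.1, h0, fun k hk => ?_,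
    fun i j => ?_, fun j a => ⟨A a j, rfl⟩⟩
  · refine lt_of_le_of_ne (hp.1 k) fun h => hk ?_
    obtain ⟨i, hi⟩ := hb'.2 ⟨k, h.symm⟩
    exact ⟨i, congrArg Subtype.val hi⟩
  · have h := congrFun (congrFun hNA i) j
    rw [Matrix.mul_apply, Matrix.one_apply] at h
    rw [inner_eq_sum]
    simp only [nu_apply]
    have h2 : ((∑ a, N i a * A a j : ℤ) : ℝ) = ((if i = j then 1 else 0 : ℤ) : ℝ) := by rw [h]
    push_cast at h2
    simpa [N] using h2

theorem exists_frame_of_mem_extremePoints {p : EV n} (hp : p ∈ extremePoints ℝ Δ.body) :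
    ∃ b e, Δ.Frame b p e := by
  obtain ⟨li, sp⟩ := Δ.delzant p hp
  let B := Module.Basis.mk li sp.ge
  have hcard : Fintype.card {k : Fin Δ.d // affineFn (Δ.normal k) (Δ.c k) p = 0} = n := by
    rw [← Module.finrank_eq_card_basis B, Module.finrank_fin_fun]
  let eqv := (Fintype.equivFinOfCardEq hcard).symm
  obtain ⟨e, he⟩ := Δ.frame_of_mem_extremePoints hp (fun i => (eqv i).1)
    (Subtype.val_injective.comp eqv.injective) (fun i => (eqv i).2)
  exact ⟨_, e, he⟩

/-- The facets through `p` cut out a compact extreme subset, and by Krein–Milman it has an extreme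
point, which is also extreme in the polytope. -/
theorem exists_extremePoint_face {p : EV n} (hp : p ∈ Δ.body) :
    ∃ q ∈ extremePoints ℝ Δ.body, ∀ k, Δ.l k p = 0 → Δ.l k q = 0 := by
  let F : Set (EV n) := {ξ | ξ ∈ Δ.body ∧ ∀ k, Δ.l k p = 0 → Δ.l k ξ = 0}
  have hFc : IsClosed F := by
    have : F = Δ.body ∩ ⋂ k, ⋂ (_ : Δ.l k p = 0), {ξ | Δ.l k ξ = 0} := by
      ext ξ; simp [F]
    rw [this]
    exact Δ.isClosed_body.inter (isClosed_iInter fun k => isClosed_iInter fun _ =>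
      isClosed_eq (Δ.continuous_l k) continuous_const)
  have hF : IsCompact F := Δ.isCompact_body.of_isClosed_subset hFc fun ξ h => h.1
  obtain ⟨q, hq⟩ := hF.extremePoints_nonempty ⟨p, hp, fun k h => h⟩
  have hext : IsExtreme ℝ Δ.body F := by
    refine ⟨fun ξ h => h.1, ?_⟩
    rintro ξ hξ η hη ζ ⟨hζ, hz⟩ ⟨s, t, hs, ht, hst, rfl⟩
    refine ⟨hξ, fun k hk => ?_⟩
    have h1 := hz k hk
    rw [l_convexComb _ _ _ _ _ _ hst] at h1
    have h2 := hξ k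
    have h3 := hη k
    have h4 : s * Δ.l k ξ = 0 := by nlinarith [mul_nonneg hs.le h2, mul_nonneg ht.le h3]
    rcases mul_eq_zero.1 h4 with h | h
    · exact absurd h hs.ne'
    · exact h
  exact ⟨q, hext.extremePoints_subset_extremePoints hq, hq.1.2⟩

namespace Frame

variable {Δ} {b : Fin n → Fin Δ.d} {p : EV n} {e : Fin n → EV n} (F : Δ.Frame b p e)
include F

/-- The matrix of edge vectors. -/
theorem mul_eq_one : (Matrix.of fun i a => Δ.nu (b i) a) * (Matrix.of fun a j => e j a) = 1 := by
  ext i j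
  rw [Matrix.mul_apply, Matrix.one_apply, ← F.dual i j, inner_eq_sum]
  rfl

theorem mul_eq_one' : (Matrix.of fun a j => e j a) * (Matrix.of fun i a => Δ.nu (b i) a) = 1 :=
  mul_eq_one_comm.1 F.mul_eq_one

theorem sum_e_mul_nu (a a' : Fin n) :
    ∑ j, e j a * Δ.nu (b j) a' = if a = a' then (1 : ℝ) else 0 := by
  have := congrFun (congrFun F.mul_eq_one' a) a'
  rwa [Matrix.mul_apply, Matrix.one_apply] at this

theorem sum_inner_smul_e (v : EV n) : ∑ i, inner ℝ (Δ.nu (b i)) v • e i = v := by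
  ext a
  simp only [WithLp.ofLp_sum, Finset.sum_apply, PiLp.smul_apply, smul_eq_mul, inner_eq_sum,
    Finset.sum_mul]
  rw [Finset.sum_comm]
  have : ∀ a', ∑ i, Δ.nu (b i) a' * v a' * e i a = v a' * if a = a' then 1 else 0 := by
    intro a'
    rw [← F.sum_e_mul_nu, Finset.mul_sum]
    exact Finset.sum_congr rfl fun i _ => by ring
  simp [this]

theorem sum_inner_smul_nu (x : EV n) : ∑ i, inner ℝ (e i) x • Δ.nu (b i) = x := by
  ext a
  simp only [WithLp.ofLp_sum, Finset.sum_apply, PiLp.smul_apply, smul_eq_mul, inner_eq_sum,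
    Finset.sum_mul]
  rw [Finset.sum_comm]
  have : ∀ a', ∑ i, e i a' * x a' * Δ.nu (b i) a = x a' * if a' = a then 1 else 0 := by
    intro a'
    rw [← F.sum_e_mul_nu, Finset.mul_sum]
    exact Finset.sum_congr rfl fun i _ => by ring
  simp [this]

theorem inner_e_int (k : Fin Δ.d) (j : Fin n) : ∃ m : ℤ, inner ℝ (Δ.nu k) (e j) = m := by
  choose m hm using F.int j
  refine ⟨∑ a, Δ.normal k a * m a, ?_⟩
  rw [inner_eq_sum]
  push_cast
  exact Finset.sum_congr rfl fun a _ => by rw [hm, nu_apply]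

theorem l_add_sum (i : Fin n) (y : Fin n → ℝ) : Δ.l (b i) (p + ∑ j, y j • e j) = y i := by
  rw [l_add, F.zero, inner_sum]
  simp [inner_smul_right, F.dual]

theorem eq_add_sum (ξ : EV n) : ξ = p + ∑ i, Δ.l (b i) ξ • e i := by
  have h := F.sum_inner_smul_e (ξ - p)
  have : ∀ i, inner ℝ (Δ.nu (b i)) (ξ - p) = Δ.l (b i) ξ := by
    intro i
    rw [← l_sub_l, F.zero, sub_zero]
  simp only [this] at h
  rw [h]; abel

theorem l_expand (k : Fin Δ.d) (ξ : EV n) :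
    Δ.l k ξ = Δ.l k p + ∑ i, inner ℝ (Δ.nu k) (e i) * Δ.l (b i) ξ := by
  conv_lhs => rw [F.eq_add_sum ξ]
  rw [l_add, inner_sum]
  simp [inner_smul_right, mul_comm]

/-- The normal matrix and its inverse are both integral, so the determinant is a unit of ℤ. -/
theorem det_mul_self : (Matrix.of fun i a => Δ.nu (b i) a).det ^ 2 = 1 := by
  choose m hm using F.int
  have h1 := congrArg Matrix.det F.mul_eq_one
  rw [Matrix.det_mul, Matrix.det_one] at h1
  have h2 : (Matrix.of fun i a => Δ.nu (b i) a)
      = (Matrix.of fun i a => Δ.normal (b i) a).map (Int.castRingHom ℝ) := rfl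
  have h3 : (Matrix.of fun a j => e j a) = (Matrix.of fun a j => m j a).map (Int.castRingHom ℝ) := by
    ext a j; simp [hm]
  rw [h2, h3, ← RingHom.mapMatrix_apply, ← RingHom.mapMatrix_apply, ← RingHom.map_det,
    ← RingHom.map_det, ← map_mul] at h1
  rw [h2, ← RingHom.mapMatrix_apply, ← RingHom.map_det, ← map_pow]
  have h4 : (Matrix.of fun i a => Δ.normal (b i) a).det * (Matrix.of fun a j => m j a).det = 1 := by
    rw [eq_intCast] at h1
    exact_mod_cast h1
  rcases Int.isUnit_iff.1 (IsUnit.of_mul_eq_one _ h4) with h | h <;> simp [h]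

end Frame

/-- The common point in `IsFrame` need not be assumed extreme: the face through it contains a
vertex, at which the `n` listed facets still meet. -/
theorem IsFrame.exists_frame {b : Fin n → Fin Δ.d} (hb : Δ.IsFrame b) : ∃ p e, Δ.Frame b p e := by
  obtain ⟨p, hp, h0⟩ := hb.common
  obtain ⟨q, hq, hpq⟩ := Δ.exists_extremePoint_face hp
  obtain ⟨e, F⟩ := Δ.frame_of_mem_extremePoints hq b hb.inj fun i => hpq _ (h0 i)
  exact ⟨q, e, F⟩

theorem Frame.isFrame {Δ : DelzantPolytope n} {b p e} (F : Δ.Frame b p e) : Δ.IsFrame b :=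
  ⟨F.inj, p, F.mem, F.zero⟩

theorem Frame.ext_point {Δ : DelzantPolytope n} {b p e q e'} (F : Δ.Frame b p e)
    (G : Δ.Frame b q e') : p = q := by
  rw [F.eq_add_sum q]
  simp [G.zero]

theorem finite_extremePoints : (extremePoints ℝ Δ.body).Finite := by
  choose b e F using fun p (hp : p ∈ extremePoints ℝ Δ.body) =>
    Δ.exists_frame_of_mem_extremePoints hp
  have : Finite (extremePoints ℝ Δ.body) := by
    refine Finite.of_injective (fun p => b p.1 p.2) ?_
    intro p q h
    have h1 := F p.1 p.2
    have h2 := F q.1 q.2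
    simp only at h
    rw [← h] at h2
    exact Subtype.ext (h1.ext_point h2)
  exact Set.toFinite _

/-- Every point of the polytope is close to a vertex in the sense that no other facet is close. -/
theorem exists_frame_l_ge {ξ : EV n} (hξ : ξ ∈ Δ.body) :
    ∃ b p e, Δ.Frame b p e ∧ ∀ k, Δ.l k p ≤ (n + 1) * Δ.l k ξ := by
  have h1 : ξ ∈ convexHull ℝ (extremePoints ℝ Δ.body) := by
    have := closure_convexHull_extremePoints Δ.isCompact_body Δ.convex_body
    rw [(Δ.finite_extremePoints.isCompact_convexHull ℝ).isClosed.closure_eq] at this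
    rwa [this]
  obtain ⟨ι, hι, z, w, hz, hai, hw, hw1, hs⟩ := eq_pos_convex_span_of_mem_convexHull h1
  have hcard : Fintype.card ι ≤ n + 1 := by
    have := hai.card_le_finrank_succ
    refine this.trans (Nat.succ_le_succ ((Submodule.finrank_le _).trans ?_))
    simp
  have hne : Nonempty ι := by
    by_contra h
    rw [not_nonempty_iff] at h
    simp at hw1
  -- By Carathéodory at most n + 1 vertices occur, so some weight is at least 1/(n+1). Since `l k`
  -- is affine and nonnegative, that single vertex already accounts for `l k (z i) / (n+1)` of `l k
  -- ξ`.
  obtain ⟨i, hi⟩ : ∃ i, 1 ≤ (n + 1) * w i := by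
    by_contra! h
    have h2 : ∑ i, (n + 1) * w i < ∑ i : ι, (1 : ℝ) :=
      Finset.sum_lt_sum_of_nonempty Finset.univ_nonempty fun i _ => h i
    rw [← Finset.mul_sum, hw1] at h2
    simp at h2
    have : (Fintype.card ι : ℝ) ≤ n + 1 := by exact_mod_cast hcard
    linarith
  have hzi : z i ∈ extremePoints ℝ Δ.body := hz ⟨i, rfl⟩
  obtain ⟨b, e, F⟩ := Δ.exists_frame_of_mem_extremePoints hzi
  refine ⟨b, z i, e, F, fun k => ?_⟩
  have hl : Δ.l k ξ = ∑ j, w j * Δ.l k (z j) := by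
    rw [← hs, l_eq_inner, inner_sum]
    simp only [l_eq_inner, inner_smul_right, mul_add, Finset.sum_add_distrib]
    rw [← Finset.sum_mul, hw1, one_mul]
  have h3 : w i * Δ.l k (z i) ≤ Δ.l k ξ := by
    rw [hl]
    exact Finset.single_le_sum (f := fun j => w j * Δ.l k (z j))
      (fun j _ => mul_nonneg (hw j).le ((hz ⟨j, rfl⟩ : z j ∈ extremePoints ℝ Δ.body).1 k))
      (Finset.mem_univ i)
  have h4 : 0 ≤ Δ.l k (z i) := hzi.1 k
  have h5 : (0 : ℝ) ≤ n + 1 := by positivity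
  nlinarith [mul_le_mul_of_nonneg_left h3 h5, mul_le_mul_of_nonneg_right hi h4]

/-- Every facet contains a vertex. -/
theorem exists_frame_facet (k : Fin Δ.d) : ∃ b p e, Δ.Frame b p e ∧ ∃ i, b i = k := by
  obtain ⟨ξ, h0, h1⟩ := Δ.facet k
  have hξ : ξ ∈ Δ.body := by
    intro j
    by_cases h : j = k
    · subst h; exact h0.ge
    · exact (h1 j h).le
  obtain ⟨q, hq, h2⟩ := Δ.exists_extremePoint_face hξ
  obtain ⟨b, e, F⟩ := Δ.exists_frame_of_mem_extremePoints hq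
  refine ⟨b, q, e, F, ?_⟩
  by_contra h
  exact (F.pos k h).ne' (h2 k h0)

/-- A vertex at which a given linear function is maximal. -/
theorem exists_frame_inner_nonpos (x : EV n) :
    ∃ b p e, Δ.Frame b p e ∧ ∀ i, inner ℝ (e i) x ≤ 0 := by
  let G : Set (EV n) := {ξ | ξ ∈ Δ.body ∧ ∀ η ∈ Δ.body, inner ℝ x η ≤ inner ℝ x ξ}
  obtain ⟨ξ, hξ, hmax⟩ := Δ.isCompact_body.exists_isMaxOn Δ.body_nonempty
    (f := fun ξ => inner ℝ x ξ) (by fun_prop)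
  obtain ⟨q, hq, h2⟩ := Δ.exists_extremePoint_face hξ
  obtain ⟨b, e, F⟩ := Δ.exists_frame_of_mem_extremePoints hq
  -- the maximum is also attained at `q`
  have hq2 : inner ℝ x q = (inner ℝ x ξ : ℝ) := by
    refine le_antisymm (hmax hq.1) ?_
    -- Every facet through ξ passes through q, so the segment from q to ξ extends a little beyond ξ
    -- inside the polytope; a linear function maximal at ξ cannot increase along it.
    have hev : ∀ᶠ s : ℝ in 𝓝 0, ξ + s • (ξ - q) ∈ Δ.body := by
      have : ∀ k, ∀ᶠ s : ℝ in 𝓝 0, 0 ≤ Δ.l k (ξ + s • (ξ - q)) := by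
        intro k
        by_cases hk : Δ.l k ξ = 0
        · refine Filter.Eventually.of_forall fun s => ?_
          rw [l_add, inner_smul_right, ← l_sub_l, hk, h2 k hk]; simp
        · have hc : Continuous fun s : ℝ => Δ.l k (ξ + s • (ξ - q)) :=
            (Δ.continuous_l k).comp (by fun_prop)
          have : ∀ᶠ s : ℝ in 𝓝 0, 0 < Δ.l k (ξ + s • (ξ - q)) := by
            refine hc.continuousAt.eventually (lt_mem_nhds ?_)
            simpa using lt_of_le_of_ne (hξ k) (Ne.symm hk)
          exact this.mono fun _ h => h.le
      exact (Filter.eventually_all.2 this)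
    obtain ⟨s, hs, hs0⟩ := ((hev.filter_mono nhdsWithin_le_nhds).and
      (self_mem_nhdsWithin (s := Ioi (0 : ℝ)))).exists
    have h3 : (inner ℝ x (ξ + s • (ξ - q)) : ℝ) ≤ inner ℝ x ξ := hmax hs
    rw [inner_add_right, inner_smul_right, inner_sub_right] at h3
    have hs0' : 0 < s := hs0
    nlinarith
  refine ⟨b, q, e, F, fun i => ?_⟩
  have hev : ∀ᶠ s : ℝ in 𝓝[>] 0, q + s • e i ∈ Δ.body := by
    have : ∀ k, ∀ᶠ s : ℝ in 𝓝[>] 0, 0 ≤ Δ.l k (q + s • e i) := by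
      intro k
      by_cases hk : k ∈ Set.range b
      · obtain ⟨j, rfl⟩ := hk
        filter_upwards [self_mem_nhdsWithin] with s hs
        rw [l_add, F.zero, inner_smul_right, F.dual]
        have hs' : (0 : ℝ) < s := hs
        split_ifs <;> simp [hs'.le]
      · have hc : Continuous fun s : ℝ => Δ.l k (q + s • e i) :=
          (Δ.continuous_l k).comp (by fun_prop)
        have : ∀ᶠ s : ℝ in 𝓝 0, 0 < Δ.l k (q + s • e i) := by
          refine hc.continuousAt.eventually (lt_mem_nhds ?_)
          simpa using F.pos k hk
        exact (this.filter_mono nhdsWithin_le_nhds).mono fun _ h => h.le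
    exact (Filter.eventually_all.2 this)
  obtain ⟨s, hs, hs0⟩ := (hev.and (self_mem_nhdsWithin (s := Ioi (0 : ℝ)))).exists
  have h3 : (inner ℝ x (q + s • e i) : ℝ) ≤ inner ℝ x ξ := hmax hs
  rw [inner_add_right, inner_smul_right, hq2] at h3
  have hs0' : 0 < s := hs0
  rw [real_inner_comm]
  nlinarith

theorem exists_frame : ∃ b p e, Δ.Frame b p e := by
  obtain ⟨b, p, e, F, -⟩ := Δ.exists_frame_inner_nonpos 0
  exact ⟨b, p, e, F⟩

end DelzantPolytope

/-! ### Smooth extension of the Guillemin potential across the toric divisors. -/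

theorem exists_contDiffAt_local_inverse {E : Type*} [NormedAddCommGroup E] [NormedSpace ℝ E]
    [FiniteDimensional ℝ E] {f : E → E} {a : E} (hf : ContDiffAt ℝ ∞ f a)
    (hinj : ∀ v, fderiv ℝ f a v = 0 → v = 0) :
    ∃ τ : E → E, ContDiffAt ℝ ∞ τ (f a) ∧ τ (f a) = a ∧ ∀ᶠ w in 𝓝 (f a), f (τ w) = w := by
  have := FiniteDimensional.complete ℝ E
  let L : E ≃L[ℝ] E := (LinearEquiv.ofInjectiveEndo (fderiv ℝ f a : E →ₗ[ℝ] E)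
    ((injective_iff_map_eq_zero _).2 hinj)).toContinuousLinearEquiv
  have hL : HasFDerivAt f (L : E →L[ℝ] E) a := by
    have h : (L : E →L[ℝ] E) = fderiv ℝ f a := by
      ext v; simp [L]
    rw [h]
    exact (hf.differentiableAt (by simp)).hasFDerivAt
  refine ⟨hf.localInverse hL (by simp), hf.to_localInverse hL (by simp),
    hf.localInverse_apply_image hL (by simp), ?_⟩
  exact (hf.hasStrictFDerivAt' hL (by simp)).eventually_right_inverse

/-- The function t log t lies above its tangent at s. Applied facet by facet, this identifies the
maximizers in the Legendre transforms. -/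
theorem mul_log_add_le {s t : ℝ} (hs : 0 < s) (ht : 0 ≤ t) :
    t * log s + t - s ≤ t * log t := by
  rcases ht.eq_or_lt with h | h
  · subst h; simp [hs.le]
  · have h1 := Real.log_le_sub_one_of_pos (div_pos hs h)
    rw [Real.log_div hs.ne' h.ne'] at h1
    have h2 := mul_le_mul_of_nonneg_left h1 h.le
    have h3 : t * (s / t - 1) = s - t := by field_simp
    linarith

namespace DelzantPolytope

variable {n : ℕ} (Δ : DelzantPolytope n)

/-- The facets which are not listed in `b`. -/
def out (b : Fin n → Fin Δ.d) : Finset (Fin Δ.d) := {k | ∀ i, b i ≠ k}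

theorem mem_out {b : Fin n → Fin Δ.d} {k : Fin Δ.d} : k ∈ Δ.out b ↔ k ∉ Set.range b := by
  simp [out]

theorem sum_eq_sum_add_sum_out {M : Type*} [AddCommMonoid M] {b : Fin n → Fin Δ.d}
    (hb : Function.Injective b) (G : Fin Δ.d → M) :
    ∑ k, G k = ∑ i, G (b i) + ∑ k ∈ Δ.out b, G k := by
  rw [← Finset.sum_filter_add_sum_filter_not Finset.univ (fun k => ∃ i, b i = k)]
  congr 1
  · rw [← Finset.sum_image (f := G) (g := b) (s := Finset.univ) (fun i _ j _ h => hb h)]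
    refine Finset.sum_congr ?_ fun _ _ => rfl
    ext k; simp
  · refine Finset.sum_congr ?_ fun _ _ => rfl
    ext k; simp [out]

theorem continuous_guilleminU : Continuous Δ.guilleminU := by
  unfold guilleminU
  exact continuous_finsetSum _ fun k _ => Real.continuous_mul_log.comp (Δ.continuous_l k)

/-- At a maximizer of `c - U` over a convex set, a facet function which is not identically zero on
that set is positive. -/
theorem l_pos_of_isMaxOn {K : Set (EV n)} (hK : Convex ℝ K) (hKb : K ⊆ Δ.body) (x : EV n)
    {η ξ : EV n} (hη : η ∈ K) (hξ : ξ ∈ K)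
    (hmax : ∀ ζ ∈ K, inner ℝ x ζ - Δ.guilleminU ζ ≤ inner ℝ x η - Δ.guilleminU η)
    (k : Fin Δ.d) (hk : 0 < Δ.l k ξ) : 0 < Δ.l k η := by
  refine lt_of_le_of_ne (hKb hη k) fun h0 => ?_
  set a := Δ.l k ξ with ha
  set F : EV n → ℝ := fun ζ => inner ℝ x ζ - Δ.guilleminU ζ with hF
  -- Moving from η towards ξ, the convex terms cost at most linearly in ε, but the term of facet `k`
  -- contributes `ε a log ε`; the infinite slope of t log t at 0 contradicts maximality.
  have key : ∀ ε : ℝ, 0 < ε → ε ≤ 1 → F ξ - F η ≤ a * log ε := by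
    intro ε h1 h2
    have hmem : (1 - ε) • η + ε • ξ ∈ K := hK hη hξ (by linarith) h1.le (by ring)
    have hU : Δ.guilleminU ((1 - ε) • η + ε • ξ)
        ≤ (1 - ε) * Δ.guilleminU η + ε * Δ.guilleminU ξ + ε * a * log ε := by
      simp only [guilleminU]
      rw [Finset.mul_sum, Finset.mul_sum, ← Finset.sum_add_distrib]
      rw [← Finset.sum_erase_add _ _ (Finset.mem_univ k),
        ← Finset.sum_erase_add Finset.univ (fun j => (1 - ε) * _ + ε * _) (Finset.mem_univ k),
        add_assoc]
      refine add_le_add (Finset.sum_le_sum fun j _ => ?_) (le_of_eq ?_)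
      · rw [Δ.l_convexComb _ _ _ _ _ (by ring)]
        have := Real.convexOn_mul_log.2 (hKb hη j) (hKb hξ j) (by linarith : 0 ≤ 1 - ε) h1.le
          (by ring)
        simpa using this
      · rw [Δ.l_convexComb _ _ _ _ _ (by ring), ← h0, ← ha, mul_zero, zero_add,
          Real.log_mul h1.ne' hk.ne']
        ring
    have h3 := hmax _ hmem
    rw [inner_add_right, inner_smul_right, inner_smul_right] at h3
    have h4 : ε * (F ξ - F η) ≤ ε * (a * log ε) := by
      simp only [hF]
      nlinarith
    exact le_of_mul_le_mul_left h4 h1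
  have hle : F ξ ≤ F η := hmax ξ hξ
  -- This ε makes `a * log ε` equal to `F ξ - F η - 1`.
  have h := key (Real.exp ((F ξ - F η - 1) / a)) (Real.exp_pos _) (by
    rw [Real.exp_le_one_iff]
    exact div_nonpos_of_nonpos_of_nonneg (by linarith) hk.le)
  rw [Real.log_exp, mul_div_cancel₀ _ hk.ne'] at h
  linarith

/-- The point with affine coordinates `y` in the frame `e` at `p`. -/
def pt (p : EV n) (e : Fin n → EV n) (y : Fin n → ℝ) : EV n := p + ∑ i, y i • e i

/-- `∂h / ∂y_i` for `h = ∑ l_k log l_k`, the sum over the facets not in the frame. -/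
def hGrad (b : Fin n → Fin Δ.d) (p : EV n) (e : Fin n → EV n) (i : Fin n) (y : Fin n → ℝ) : ℝ :=
  ∑ k ∈ Δ.out b, inner ℝ (Δ.nu k) (e i) * (log (Δ.l k (pt p e y)) + 1)

/-- The map from the affine coordinates to the squared absolute values of the holomorphic
coordinates. -/
def chartMap (b : Fin n → Fin Δ.d) (p : EV n) (e : Fin n → EV n) (y : Fin n → ℝ) : Fin n → ℝ :=
  fun i => y i * exp (1 + Δ.hGrad b p e i y)

/-- The local potential in terms of the affine coordinates. -/
def potential (b : Fin n → Fin Δ.d) (p : EV n) (e : Fin n → EV n) (y : Fin n → ℝ) : ℝ :=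
  ∑ i, y i + ∑ k ∈ Δ.out b,
    (Δ.l k (pt p e y) - Δ.l k p * (log (Δ.l k (pt p e y)) + 1))

theorem continuous_pt (p : EV n) (e : Fin n → EV n) : Continuous (pt p e) := by
  unfold pt; fun_prop

theorem contDiff_pt (p : EV n) (e : Fin n → EV n) : ContDiff ℝ ∞ (pt p e) := by
  unfold pt; fun_prop

variable {b : Fin n → Fin Δ.d} {p : EV n} {e : Fin n → EV n}

theorem contDiffAt_log_l_pt {k : Fin Δ.d} {y : Fin n → ℝ} (h : 0 < Δ.l k (pt p e y)) :
    ContDiffAt ℝ ∞ (fun y => log (Δ.l k (pt p e y))) y :=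
  (((Δ.contDiff_l k).comp (contDiff_pt p e)).contDiffAt (x := y)).log h.ne'

theorem contDiffAt_chartMap {y : Fin n → ℝ} (h : ∀ k ∈ Δ.out b, 0 < Δ.l k (pt p e y)) :
    ContDiffAt ℝ ∞ (Δ.chartMap b p e) y := by
  rw [contDiffAt_pi]
  intro i
  unfold chartMap hGrad
  refine ContDiffAt.mul (by fun_prop) (ContDiffAt.exp (contDiffAt_const.add ?_))
  exact ContDiffAt.sum fun k hk =>
    contDiffAt_const.mul ((Δ.contDiffAt_log_l_pt (h k hk)).add contDiffAt_const)

theorem contDiffAt_potential {y : Fin n → ℝ} (h : ∀ k ∈ Δ.out b, 0 < Δ.l k (pt p e y)) :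
    ContDiffAt ℝ ∞ (Δ.potential b p e) y := by
  unfold potential
  refine ContDiffAt.add (by fun_prop) (ContDiffAt.sum fun k hk => ?_)
  exact (((Δ.contDiff_l k).comp (contDiff_pt p e)).contDiffAt).sub
    (contDiffAt_const.mul ((Δ.contDiffAt_log_l_pt (h k hk)).add contDiffAt_const))

theorem l_pt (k : Fin Δ.d) (y : Fin n → ℝ) :
    Δ.l k (pt p e y) = Δ.l k p + ∑ i, inner ℝ (Δ.nu k) (e i) * y i := by
  rw [pt, l_add, inner_sum]
  simp [inner_smul_right, mul_comm]

/-- A kernel vector satisfies v_i = -y_i λ_i, where λ is the Hessian of the convex function h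
applied to v. Then ∑ v_i λ_i is nonnegative by convexity and equals -∑ y_i λ_i², so each y_i λ_i
vanishes. Boundary points with some y_i = 0 are allowed. -/
theorem fderiv_chartMap_injective {y : Fin n → ℝ} (h : ∀ k ∈ Δ.out b, 0 < Δ.l k (pt p e y))
    (hy : ∀ i, 0 ≤ y i) (v : Fin n → ℝ) (hv : fderiv ℝ (Δ.chartMap b p e) y v = 0) : v = 0 := by
  have hd : HasFDerivAt (Δ.chartMap b p e) (fderiv ℝ (Δ.chartMap b p e) y) y :=
    ((Δ.contDiffAt_chartMap h).differentiableAt (by simp)).hasFDerivAt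
  let A : Fin Δ.d → ℝ := fun k => ∑ i, inner ℝ (Δ.nu k) (e i) * v i
  let lam : Fin n → ℝ := fun i => ∑ k ∈ Δ.out b, inner ℝ (Δ.nu k) (e i) * (A k / Δ.l k (pt p e y))
  have hl : ∀ k, HasDerivAt (fun s : ℝ => Δ.l k (pt p e (y + s • v))) (A k) 0 := by
    intro k
    have : (fun s : ℝ => Δ.l k (pt p e (y + s • v))) = fun s => Δ.l k (pt p e y) + s * A k := by
      funext s
      simp only [l_pt, A, Pi.add_apply, Pi.smul_apply, smul_eq_mul, mul_add,
        Finset.sum_add_distrib, Finset.mul_sum]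
      rw [add_assoc]
      congr 2
      exact Finset.sum_congr rfl fun i _ => by ring
    rw [this]
    simpa using ((hasDerivAt_id (0 : ℝ)).mul_const (A k)).const_add (Δ.l k (pt p e y))
  have hh : ∀ i, HasDerivAt (fun s : ℝ => Δ.hGrad b p e i (y + s • v)) (lam i) 0 := by
    intro i
    unfold hGrad
    refine HasDerivAt.fun_sum fun k hk => ?_
    have h1 := (hl k).log (by simpa using (h k hk).ne')
    simpa using (h1.add_const 1).const_mul (inner ℝ (Δ.nu k) (e i) : ℝ)
  have hcomp : ∀ i, v i + y i * lam i = 0 := by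
    intro i
    have h1 : HasDerivAt (fun s : ℝ => Δ.chartMap b p e (y + s • v))
        (fderiv ℝ (Δ.chartMap b p e) y v) 0 := by
      have hline : HasDerivAt (fun s : ℝ => y + s • v) v 0 := by
        simpa using ((hasDerivAt_id (0 : ℝ)).smul_const v).const_add y
      have hd' : HasFDerivAt (Δ.chartMap b p e) (fderiv ℝ (Δ.chartMap b p e) y)
        ((fun s : ℝ => y + s • v) 0) := by simpa using hd
      exact hd'.comp_hasDerivAt 0 hline
    rw [hv] at h1
    have h2 := (hasDerivAt_pi.1 h1) i
    have h3 : HasDerivAt (fun s : ℝ => (y + s • v) i) (v i) 0 := by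
      simpa using ((hasDerivAt_id (0 : ℝ)).mul_const (v i)).const_add (y i)
    have h4 := h3.mul (((hh i).const_add 1).exp)
    have h5 := h4.unique h2
    simp only [zero_smul, add_zero, Pi.zero_apply] at h5
    have h6 : exp (1 + Δ.hGrad b p e i y) * (v i + y i * lam i) = 0 := by linarith
    exact (mul_eq_zero.1 h6).resolve_left (Real.exp_pos _).ne'
  have hsum : ∑ i, v i * lam i = ∑ k ∈ Δ.out b, A k ^ 2 / Δ.l k (pt p e y) := by
    simp only [lam, Finset.mul_sum]
    rw [Finset.sum_comm]
    refine Finset.sum_congr rfl fun k _ => ?_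
    rw [sq, mul_div_assoc]
    conv_rhs => rw [show A k = ∑ i, inner ℝ (Δ.nu k) (e i) * v i from rfl, Finset.sum_mul]
    exact Finset.sum_congr rfl fun i _ => by simp only [A]; ring
  have h1 : 0 ≤ ∑ i, v i * lam i := by
    rw [hsum]
    exact Finset.sum_nonneg fun k hk => div_nonneg (sq_nonneg _) (h k hk).le
  have h2 : ∑ i, v i * lam i = - ∑ i, y i * lam i ^ 2 := by
    rw [← Finset.sum_neg_distrib]
    exact Finset.sum_congr rfl fun i _ => by linear_combination lam i * hcomp i
  have h3 : ∀ i ∈ Finset.univ, 0 ≤ y i * lam i ^ 2 := fun i _ => mul_nonneg (hy i) (sq_nonneg _)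
  have h4 : ∑ i, y i * lam i ^ 2 = 0 := le_antisymm (by linarith) (Finset.sum_nonneg h3)
  funext i
  have h5 := (Finset.sum_eq_zero_iff_of_nonneg h3).1 h4 i (Finset.mem_univ i)
  have h6 := hcomp i
  rcases mul_eq_zero.1 h5 with h7 | h7
  · simpa [h7] using h6
  · have : lam i = 0 := by simpa using h7
    simpa [this] using h6

end DelzantPolytope

namespace DelzantPolytope

variable {n : ℕ} (Δ : DelzantPolytope n)

theorem l_lineMap (k : Fin Δ.d) (η v : EV n) (s : ℝ) :
    Δ.l k (η + s • v) = Δ.l k η + s * inner ℝ (Δ.nu k) v := by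
  rw [l_add, inner_smul_right]

namespace Frame

variable {Δ} {b : Fin n → Fin Δ.d} {p : EV n} {e : Fin n → EV n} (F : Δ.Frame b p e)
include F

theorem l_b_pt (i : Fin n) (y : Fin n → ℝ) : Δ.l (b i) (pt p e y) = y i := F.l_add_sum i y

theorem pt_l (ξ : EV n) : pt p e (fun i => Δ.l (b i) ξ) = ξ := (F.eq_add_sum ξ).symm

theorem pos_of_mem_out {k : Fin Δ.d} (hk : k ∈ Δ.out b) : 0 < Δ.l k p :=
  F.pos k (Δ.mem_out.1 hk)

theorem sum_l_mul (a : Fin n → ℝ) (η : EV n) :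
    ∑ i, Δ.l (b i) η * a i
      = inner ℝ (∑ i, a i • Δ.nu (b i)) η - inner ℝ (∑ i, a i • Δ.nu (b i)) p := by
  rw [← inner_sub_right, sum_inner]
  refine Finset.sum_congr rfl fun i _ => ?_
  rw [real_inner_smul_left, ← l_sub_l, F.zero]
  ring

theorem pt_mem_body {y : Fin n → ℝ} (hy : ∀ i, 0 ≤ y i)
    (h : ∀ k ∈ Δ.out b, 0 < Δ.l k (pt p e y)) : pt p e y ∈ Δ.body := by
  intro k
  by_cases hk : k ∈ Set.range b
  · obtain ⟨i, rfl⟩ := hk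
    rw [F.l_b_pt]; exact hy i
  · exact (h k (Δ.mem_out.2 hk)).le

theorem guilleminU_eq (η : EV n) : Δ.guilleminU η
    = ∑ i, Δ.l (b i) η * log (Δ.l (b i) η) + ∑ k ∈ Δ.out b, Δ.l k η * log (Δ.l k η) :=
  Δ.sum_eq_sum_add_sum_out F.inj fun k => Δ.l k η * log (Δ.l k η)

/-- Maximize ⟨x, ·⟩ - U over the face on which the coordinates with w_i = 0 vanish. The maximizer is
in the relative interior of that face by `l_pos_of_isMaxOn`, and its Euler–Lagrange equation in the
direction e_i is log w_i = log y_i + 1 + ∂_i h. -/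
theorem exists_chartMap_eq (w : Fin n → ℝ) (hw : ∀ i, 0 ≤ w i) :
    ∃ y : Fin n → ℝ, (∀ i, 0 ≤ y i) ∧ (∀ k ∈ Δ.out b, 0 < Δ.l k (pt p e y)) ∧
      Δ.chartMap b p e y = w := by
  let K : Set (EV n) := {η | η ∈ Δ.body ∧ ∀ i, w i = 0 → Δ.l (b i) η = 0}
  have hKc : IsClosed K := by
    have : K = Δ.body ∩ ⋂ i, ⋂ (_ : w i = 0), {ξ | Δ.l (b i) ξ = 0} := by
      ext ξ; simp [K]
    rw [this]
    exact Δ.isClosed_body.inter (isClosed_iInter fun k => isClosed_iInter fun _ =>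
      isClosed_eq (Δ.continuous_l _) continuous_const)
  have hK : IsCompact K := Δ.isCompact_body.of_isClosed_subset hKc fun ξ h => h.1
  have hKconv : Convex ℝ K := by
    intro ξ hξ η hη s t hs ht hst
    refine ⟨Δ.convex_body hξ.1 hη.1 hs ht hst, fun i hi => ?_⟩
    rw [l_convexComb _ _ _ _ _ _ hst, hξ.2 i hi, hη.2 i hi]; simp
  -- Where w_i = 0 the value `log 0 = 0` is harmless, because the facet function `l (b i)` vanishes
  -- on `K`.
  let x : EV n := ∑ i, log (w i) • Δ.nu (b i)
  obtain ⟨η, hη, hmax⟩ := hK.exists_isMaxOn ⟨p, F.mem, fun i _ => F.zero i⟩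
    (f := fun ζ => inner ℝ x ζ - Δ.guilleminU ζ)
    ((continuous_const.inner continuous_id).sub Δ.continuous_guilleminU).continuousOn
  -- a reference point in the relative interior
  obtain ⟨ξ, hξ, hξi, hξk⟩ : ∃ ξ ∈ K, (∀ i, w i ≠ 0 → 0 < Δ.l (b i) ξ) ∧
      ∀ k ∈ Δ.out b, 0 < Δ.l k ξ := by
    let u : Fin n → ℝ := fun i => if w i = 0 then 0 else 1
    have hev : ∀ᶠ s : ℝ in 𝓝 0, ∀ k ∈ Δ.out b, 0 < Δ.l k (pt p e (s • u)) := by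
      rw [Filter.eventually_all_finset]
      intro k hk
      have hc : Continuous fun s : ℝ => Δ.l k (pt p e (s • u)) :=
        (Δ.continuous_l k).comp ((continuous_pt p e).comp (by fun_prop))
      refine hc.continuousAt.eventually (lt_mem_nhds ?_)
      simpa [pt] using F.pos_of_mem_out hk
    obtain ⟨s, hs, hs0⟩ := ((hev.filter_mono nhdsWithin_le_nhds).and
      (self_mem_nhdsWithin (s := Ioi (0 : ℝ)))).exists
    have hs0' : 0 < s := hs0
    refine ⟨pt p e (s • u), ⟨F.pt_mem_body (fun i => ?_) hs, fun i hi => ?_⟩, fun i hi => ?_, hs⟩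
    · simp only [Pi.smul_apply, smul_eq_mul, u]; split_ifs <;> simp [hs0'.le]
    · rw [F.l_b_pt]; simp [u, hi]
    · rw [F.l_b_pt]; simp [u, hi, hs0']
  have hηi : ∀ i, w i ≠ 0 → 0 < Δ.l (b i) η := fun i hi =>
    Δ.l_pos_of_isMaxOn hKconv (fun _ h => h.1) x hη hξ (fun ζ hζ => hmax hζ) _ (hξi i hi)
  have hηk : ∀ k ∈ Δ.out b, 0 < Δ.l k η := fun k hk =>
    Δ.l_pos_of_isMaxOn hKconv (fun _ h => h.1) x hη hξ (fun ζ hζ => hmax hζ) _ (hξk k hk)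
  refine ⟨fun i => Δ.l (b i) η, fun i => hη.1 _, by rwa [F.pt_l], ?_⟩
  funext i
  by_cases hi : w i = 0
  · simp [chartMap, hi, hη.2 i hi]
  have hwi : 0 < w i := lt_of_le_of_ne (hw i) (Ne.symm hi)
  -- the derivative in the direction `e i` vanishes
  have hmemK : ∀ᶠ s : ℝ in 𝓝 0, η + s • e i ∈ K := by
    have h1 : ∀ k, ∀ᶠ s : ℝ in 𝓝 0, 0 ≤ Δ.l k (η + s • e i) := by
      intro k
      by_cases hk0 : 0 < Δ.l k η
      · have hc : Continuous fun s : ℝ => Δ.l k (η + s • e i) :=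
          (Δ.continuous_l k).comp (by fun_prop)
        have : ∀ᶠ s : ℝ in 𝓝 0, 0 < Δ.l k (η + s • e i) := by
          refine hc.continuousAt.eventually (lt_mem_nhds ?_)
          simpa using hk0
        exact this.mono fun _ h => h.le
      · by_cases hk : k ∈ Set.range b
        · obtain ⟨j, rfl⟩ := hk
          have hji : j ≠ i := by
            rintro rfl; exact hk0 (hηi _ hi)
          refine Filter.Eventually.of_forall fun s => ?_
          rw [l_lineMap, F.dual, if_neg hji]
          simpa using hη.1 (b j)
        · exact absurd (hηk k (Δ.mem_out.2 hk)) hk0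
    filter_upwards [Filter.eventually_all.2 h1] with s hs
    refine ⟨hs, fun j hj => ?_⟩
    have hji : j ≠ i := by rintro rfl; exact hi hj
    rw [l_lineMap, F.dual, if_neg hji, hη.2 j hj]; simp
  have hloc : IsLocalMax
      (fun s : ℝ => inner ℝ x (η + s • e i) - Δ.guilleminU (η + s • e i)) 0 := by
    filter_upwards [hmemK] with s hs
    simpa using hmax hs
  have hl : ∀ k, HasDerivAt (fun s : ℝ => Δ.l k (η + s • e i)) (inner ℝ (Δ.nu k) (e i)) 0 := by
    intro k
    simp only [l_lineMap]
    simpa using ((hasDerivAt_id (0 : ℝ)).mul_const (inner ℝ (Δ.nu k) (e i) : ℝ)).const_add (Δ.l k η)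
  have hml : ∀ k, 0 < Δ.l k η → HasDerivAt
      (fun s : ℝ => Δ.l k (η + s • e i) * log (Δ.l k (η + s • e i)))
      (inner ℝ (Δ.nu k) (e i) * (log (Δ.l k η) + 1)) 0 := by
    intro k hk
    have h1 := (hl k).mul ((hl k).log (by simpa using hk.ne'))
    have e0 : η + (0 : ℝ) • e i = η := by simp
    refine h1.congr_deriv ?_
    simp only [e0]
    field_simp
  have hU : HasDerivAt (fun s : ℝ => Δ.guilleminU (η + s • e i))
      ((log (Δ.l (b i) η) + 1) + Δ.hGrad b p e i (fun i => Δ.l (b i) η)) 0 := by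
    simp only [F.guilleminU_eq]
    refine HasDerivAt.add ?_ ?_
    · have : ∀ j, HasDerivAt (fun s : ℝ => Δ.l (b j) (η + s • e i) * log (Δ.l (b j) (η + s • e i)))
          (if j = i then (log (Δ.l (b i) η) + 1) else 0) 0 := by
        intro j
        by_cases hji : j = i
        · subst hji
          simpa [F.dual] using hml (b j) (hηi j hi)
        · simp only [l_lineMap, F.dual, if_neg hji, mul_zero]
          exact hasDerivAt_const _ _
      have h2 := HasDerivAt.fun_sum (u := Finset.univ) fun j _ => this j
      simpa using h2
    · unfold hGrad
      rw [F.pt_l]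
      exact HasDerivAt.fun_sum fun k hk => hml k (hηk k hk)
  have hin : HasDerivAt (fun s : ℝ => (inner ℝ x (η + s • e i) : ℝ)) (log (w i)) 0 := by
    have h1 : (inner ℝ x (e i) : ℝ) = log (w i) := by
      simp only [x, sum_inner, real_inner_smul_left, F.dual]
      simp
    simp only [inner_add_right, inner_smul_right, h1]
    simpa using ((hasDerivAt_id (0 : ℝ)).mul_const (log (w i))).const_add (inner ℝ x η : ℝ)
  have h0 := hloc.hasDerivAt_eq_zero (hin.sub hU)
  have h1 : log (w i) = log (Δ.l (b i) η) + (1 + Δ.hGrad b p e i (fun i => Δ.l (b i) η)) := by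
    linarith
  simp only [chartMap]
  conv_rhs => rw [← Real.exp_log hwi, h1, Real.exp_add, Real.exp_log (hηi i hi)]

/-- The point `pt p e y` is the maximizer in the definition of the potential. -/
theorem isGreatest_potential {y w : Fin n → ℝ} (hy : ∀ i, 0 ≤ y i)
    (h : ∀ k ∈ Δ.out b, 0 < Δ.l k (pt p e y)) (hyw : Δ.chartMap b p e y = w) :
    (∀ η ∈ Δ.body, (∀ i, w i = 0 → Δ.l (b i) η = 0) →
      ∑ i, Δ.l (b i) η * log (w i) - Δ.guilleminU η ≤ Δ.potential b p e y) ∧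
    ∑ i, Δ.l (b i) (pt p e y) * log (w i) - Δ.guilleminU (pt p e y) = Δ.potential b p e y := by
  have hyi : ∀ i, w i = y i * exp (1 + Δ.hGrad b p e i y) := fun i => by rw [← hyw]; rfl
  have hw0 : ∀ i, y i = 0 → w i = 0 := fun i hi => by rw [hyi, hi, zero_mul]
  have hw1 : ∀ i, y i ≠ 0 → w i ≠ 0 := fun i hi => by
    rw [hyi]; exact mul_ne_zero hi (Real.exp_pos _).ne'
  have hlog : ∀ i, y i ≠ 0 → log (w i) = log (y i) + (1 + Δ.hGrad b p e i y) := fun i hi => by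
    rw [hyi, Real.log_mul hi (Real.exp_pos _).ne', Real.log_exp]
  have hswap : ∀ η : EV n, ∑ i, Δ.l (b i) η * Δ.hGrad b p e i y
      = ∑ k ∈ Δ.out b, (Δ.l k η - Δ.l k p) * (log (Δ.l k (pt p e y)) + 1) := by
    intro η
    simp only [hGrad, Finset.mul_sum]
    rw [Finset.sum_comm]
    refine Finset.sum_congr rfl fun k _ => ?_
    have := F.l_expand k η
    rw [this, add_sub_cancel_left, Finset.sum_mul]
    exact Finset.sum_congr rfl fun i _ => by ring
  constructor
  · intro η hη hη0
    have h1 : ∑ i, (Δ.l (b i) η * log (w i) - Δ.l (b i) η * log (Δ.l (b i) η))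
        ≤ ∑ i, (y i + Δ.l (b i) η * Δ.hGrad b p e i y) := by
      refine Finset.sum_le_sum fun i _ => ?_
      by_cases hi : y i = 0
      · rw [hη0 i (hw0 i hi), hi]; simp
      · have h2 := mul_log_add_le (lt_of_le_of_ne (hy i) (Ne.symm hi)) (hη (b i))
        rw [hlog i hi]
        linarith
    have h2 : ∑ k ∈ Δ.out b, (- (Δ.l k η * log (Δ.l k η))) ≤ ∑ k ∈ Δ.out b,
        (- (Δ.l k η * (log (Δ.l k (pt p e y)) + 1)) + Δ.l k (pt p e y)) := by
      refine Finset.sum_le_sum fun k hk => ?_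
      have := mul_log_add_le (h k hk) (hη k)
      linarith
    rw [F.guilleminU_eq]
    rw [Finset.sum_add_distrib, hswap, Finset.sum_sub_distrib] at h1
    have h3 : ∑ k ∈ Δ.out b, (Δ.l k η - Δ.l k p) * (log (Δ.l k (pt p e y)) + 1)
        + ∑ k ∈ Δ.out b, (- (Δ.l k η * (log (Δ.l k (pt p e y)) + 1)) + Δ.l k (pt p e y))
        = ∑ k ∈ Δ.out b, (Δ.l k (pt p e y) - Δ.l k p * (log (Δ.l k (pt p e y)) + 1)) := by
      rw [← Finset.sum_add_distrib]
      exact Finset.sum_congr rfl fun k _ => by ring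
    rw [Finset.sum_neg_distrib] at h2
    unfold potential
    linarith
  · have h1 : ∑ i, (Δ.l (b i) (pt p e y) * log (w i)
          - Δ.l (b i) (pt p e y) * log (Δ.l (b i) (pt p e y)))
        = ∑ i, (y i + Δ.l (b i) (pt p e y) * Δ.hGrad b p e i y) := by
      refine Finset.sum_congr rfl fun i _ => ?_
      rw [F.l_b_pt]
      by_cases hi : y i = 0
      · simp [hi]
      · rw [hlog i hi]; ring
    rw [F.guilleminU_eq]
    rw [Finset.sum_add_distrib, hswap, Finset.sum_sub_distrib] at h1
    have h3 : ∑ k ∈ Δ.out b, (Δ.l k (pt p e y) - Δ.l k p) * (log (Δ.l k (pt p e y)) + 1)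
        = ∑ k ∈ Δ.out b, (Δ.l k (pt p e y) - Δ.l k p * (log (Δ.l k (pt p e y)) + 1))
        + ∑ k ∈ Δ.out b, Δ.l k (pt p e y) * log (Δ.l k (pt p e y)) := by
      rw [← Finset.sum_add_distrib]
      exact Finset.sum_congr rfl fun k _ => by ring
    unfold potential
    linarith

theorem lift_b (z : Fin n → ℂ) (i : Fin n) : Δ.lift b z (b i) = z i :=
  F.inj.extend_apply _ _ _

omit F in
theorem lift_out (z : Fin n → ℂ) {k : Fin Δ.d} (hk : k ∈ Δ.out b) : Δ.lift b z k = 1 := by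
  rw [lift, Function.extend_apply' _ _ _ fun ⟨i, hi⟩ => Δ.mem_out.1 hk ⟨i, hi⟩]

theorem gLocal_eq_potential {y : Fin n → ℝ} {z : Fin n → ℂ} (hy : ∀ i, 0 ≤ y i)
    (h : ∀ k ∈ Δ.out b, 0 < Δ.l k (pt p e y))
    (hyw : Δ.chartMap b p e y = fun i => ‖z i‖ ^ 2) :
    Δ.gLocal b z = Δ.potential b p e y := by
  obtain ⟨h1, h2⟩ := F.isGreatest_potential hy h hyw
  have hterm : ∀ ξ : EV n, ∑ k, Δ.l k ξ * log (‖Δ.lift b z k‖ ^ 2)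
      = ∑ i, Δ.l (b i) ξ * log (‖z i‖ ^ 2) := by
    intro ξ
    rw [Δ.sum_eq_sum_add_sum_out F.inj]
    simp only [F.lift_b]
    rw [Finset.sum_eq_zero (s := Δ.out b), add_zero]
    intro k hk
    rw [lift_out z hk]; simp
  have hcond : ∀ ξ : EV n, (∀ k, Δ.lift b z k = 0 → Δ.l k ξ = 0) ↔
      ∀ i, ‖z i‖ ^ 2 = 0 → Δ.l (b i) ξ = 0 := by
    intro ξ
    constructor
    · intro hk i hi
      exact hk (b i) (by rw [F.lift_b]; simpa using hi)
    · intro hi k hk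
      by_cases hkr : k ∈ Δ.out b
      · rw [lift_out z hkr] at hk; exact absurd hk one_ne_zero
      · rw [mem_out, not_not] at hkr
        obtain ⟨i, rfl⟩ := hkr
        rw [F.lift_b] at hk
        exact hi i (by simp [hk])
  unfold gLocal gHom
  refine IsGreatest.csSup_eq ⟨⟨⟨pt p e y, F.pt_mem_body hy h, (hcond _).2 fun i hi => ?_⟩, ?_⟩, ?_⟩
  · rw [F.l_b_pt]
    have := congrFun hyw i
    simp only [chartMap, hi] at this
    exact (mul_eq_zero.1 this).resolve_right (Real.exp_pos _).ne'
  · simp only [hterm]; exact h2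
  · rintro _ ⟨⟨ξ, hξ, hξ0⟩, rfl⟩
    simp only [hterm]
    exact h1 ξ hξ ((hcond ξ).1 hξ0)

/-- The potential written in the affine coordinates y contains no log y_i, so it is smooth up to y_i
= 0. Composing it with a local inverse of `chartMap` and with the squared norms of z gives the local
Kähler potential, also where some z_i vanish. -/
theorem contDiff_gLocal : ContDiff ℝ ∞ (Δ.gLocal b) := by
  rw [contDiff_iff_contDiffAt]
  intro z
  let N : (Fin n → ℂ) → Fin n → ℝ := fun z i => ‖z i‖ ^ 2
  have hN : ContDiff ℝ ∞ N := by
    rw [contDiff_pi]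
    intro i
    exact ((contDiff_apply ℝ ℂ i).norm_sq ℝ)
  obtain ⟨y, hy, h, hyw⟩ := F.exists_chartMap_eq (N z) fun i => sq_nonneg _
  obtain ⟨τ, h1, h2, h3⟩ := exists_contDiffAt_local_inverse (Δ.contDiffAt_chartMap h)
    (Δ.fderiv_chartMap_injective h hy)
  rw [hyw] at h1 h2 h3
  have hτ : ContDiffAt ℝ ∞ (fun z => Δ.potential b p e (τ (N z))) z := by
    have h4 : ContDiffAt ℝ ∞ (Δ.potential b p e) (τ (N z)) := by
      rw [h2]; exact Δ.contDiffAt_potential h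
    exact h4.comp z (h1.comp z hN.contDiffAt)
  refine hτ.congr_of_eventuallyEq ?_
  have hpos : ∀ᶠ w in 𝓝 (N z), ∀ k ∈ Δ.out b, 0 < Δ.l k (pt p e (τ w)) := by
    rw [Filter.eventually_all_finset]
    intro k hk
    have hc : ContinuousAt (fun w => Δ.l k (pt p e (τ w))) (N z) :=
      ((Δ.continuous_l k).comp (continuous_pt p e)).continuousAt.comp h1.continuousAt
    refine hc.eventually (lt_mem_nhds ?_)
    change 0 < Δ.l k (pt p e (τ (N z)))
    rw [h2]; exact h k hk
  filter_upwards [hN.continuous.continuousAt.eventually h3,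
    hN.continuous.continuousAt.eventually hpos] with z' h4 h5
  -- The local inverse is not known in advance to land in the orthant; y_i has the sign of the
  -- squared norm of z_i because `chartMap` multiplies it by an exponential.
  refine F.gLocal_eq_potential (fun i => ?_) h5 h4
  have h6 : τ (N z') i * exp (1 + Δ.hGrad b p e i (τ (N z'))) = ‖z' i‖ ^ 2 := congrFun h4 i
  have h7 : 0 ≤ τ (N z') i * exp (1 + Δ.hGrad b p e i (τ (N z'))) := by
    rw [h6]; positivity
  exact nonneg_of_mul_nonneg_left h7 (Real.exp_pos _)

end Frame

end DelzantPolytope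

/-! ### Partial derivatives, Hessians and composition with gradient maps. -/

section Calculus

variable {n : ℕ}

theorem inner_single_right (v : EV n) (i : Fin n) :
    inner ℝ v (EuclideanSpace.single i (1 : ℝ)) = v i := by
  simp [EuclideanSpace.inner_single_right]

theorem fderiv_eq_sum_pd (F : EV n → ℝ) (x v : EV n) :
    fderiv ℝ F x v = ∑ i, v i * pd i F x := by
  have h : v = ∑ i, v i • EuclideanSpace.single i (1 : ℝ) := by
    ext a
    simp [Pi.single_apply]
  conv_lhs => rw [h]
  simp [pd]

theorem gradient_apply (F : EV n → ℝ) (x : EV n) (i : Fin n) : gradient F x i = pd i F x := by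
  rw [← inner_single_right, gradient, InnerProductSpace.toDual_symm_apply, pd]

theorem fderiv_eq_inner_gradient (F : EV n → ℝ) (x v : EV n) :
    fderiv ℝ F x v = inner ℝ (gradient F x) v := by
  rw [gradient, InnerProductSpace.toDual_symm_apply]

theorem contDiffAt_pd {F : EV n → ℝ} {x : EV n} (h : ContDiffAt ℝ ∞ F x) (i : Fin n) :
    ContDiffAt ℝ ∞ (pd i F) x := by
  unfold pd
  exact (h.fderiv_right (m := ∞) le_rfl).clm_apply contDiffAt_const

theorem contDiff_pd {F : EV n → ℝ} (h : ContDiff ℝ ∞ F) (i : Fin n) : ContDiff ℝ ∞ (pd i F) :=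
  contDiff_iff_contDiffAt.2 fun _ => contDiffAt_pd h.contDiffAt i

theorem contDiff_gradient {F : EV n → ℝ} (h : ContDiff ℝ ∞ F) : ContDiff ℝ ∞ (gradient F) := by
  rw [contDiff_euclidean]
  intro i
  simp only [gradient_apply]
  exact contDiff_pd h i

theorem pd_pd_eq {F : EV n → ℝ} {x : EV n} (h : ContDiffAt ℝ ∞ F x) (i j : Fin n) :
    pd i (pd j F) x = fderiv ℝ (fderiv ℝ F) x (EuclideanSpace.single i 1)
      (EuclideanSpace.single j 1) := by
  have h1 : DifferentiableAt ℝ (fderiv ℝ F) x :=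
    (h.fderiv_right (m := ∞) le_rfl).differentiableAt (by simp)
  have h2 : pd j F = fun y => fderiv ℝ F y (EuclideanSpace.single j 1) := rfl
  rw [h2, pd, fderiv_clm_apply h1 (differentiableAt_const _)]
  simp

theorem pd_comm {F : EV n → ℝ} {x : EV n} (h : ContDiffAt ℝ ∞ F x) (i j : Fin n) :
    pd i (pd j F) x = pd j (pd i F) x := by
  rw [pd_pd_eq h, pd_pd_eq h]
  exact (h.isSymmSndFDerivAt (by simpa using ENat.LEInfty.out)).eq _ _

theorem hess_symm {F : EV n → ℝ} {x : EV n} (h : ContDiffAt ℝ ∞ F x) (i j : Fin n) :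
    hess F x i j = hess F x j i := pd_comm h i j

theorem fderiv_fderiv_eq_sum {F : EV n → ℝ} {x : EV n} (h : ContDiffAt ℝ ∞ F x) (v w : EV n) :
    fderiv ℝ (fderiv ℝ F) x v w = ∑ i, ∑ j, v i * w j * pd i (pd j F) x := by
  have e : ∀ v : EV n, v = ∑ i, v i • EuclideanSpace.single i (1 : ℝ) := by
    intro v; ext a
    simp [Pi.single_apply]
  conv_lhs => rw [e v, e w]
  simp only [map_sum, map_smul, FunLike.coe_sum, Finset.sum_apply,
    FunLike.coe_smul, Pi.smul_apply, smul_eq_mul, pd_pd_eq h, Finset.mul_sum]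
  rw [Finset.sum_comm]
  exact Finset.sum_congr rfl fun i _ => Finset.sum_congr rfl fun j _ => by ring

/-- The chain rule for composition with a gradient map. -/
theorem pd_comp_gradient {G F : EV n → ℝ} {x : EV n} (hF : ContDiff ℝ ∞ F)
    (hG : DifferentiableAt ℝ G (gradient F x)) (i : Fin n) :
    pd i (fun y => G (gradient F y)) x = ∑ a, hess F x i a * pd a G (gradient F x) := by
  have h1 : DifferentiableAt ℝ (gradient F) x := (contDiff_gradient hF).differentiable (by simp) x
  have h2 : fderiv ℝ (fun y => G (gradient F y)) x
      = (fderiv ℝ G (gradient F x)).comp (fderiv ℝ (gradient F) x) := fderiv_comp x hG h1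
  rw [pd, h2, ContinuousLinearMap.comp_apply, fderiv_eq_sum_pd]
  refine Finset.sum_congr rfl fun a _ => ?_
  congr 1
  have h3 : fderiv ℝ (fun y => gradient F y a) x (EuclideanSpace.single i 1)
      = fderiv ℝ (gradient F) x (EuclideanSpace.single i 1) a := by
    have := ((EuclideanSpace.proj a : EV n →L[ℝ] ℝ).hasFDerivAt.comp x
      h1.hasFDerivAt).fderiv
    have h4 : fderiv ℝ (fun y => gradient F y a) x
      = (EuclideanSpace.proj a : EV n →L[ℝ] ℝ).comp (fderiv ℝ (gradient F) x) := this
    rw [h4]; rfl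
  rw [← h3]
  simp only [gradient_apply]
  rfl

end Calculus

/-! ### Legendre duality between g and Guillemin's symplectic potential. -/

namespace DelzantPolytope

variable {n : ℕ} (Δ : DelzantPolytope n)

/-- The gradient of Guillemin's symplectic potential. -/
def gradU (ξ : EV n) : EV n := ∑ k, (log (Δ.l k ξ) + 1) • Δ.nu k

/-- The Hessian of Guillemin's symplectic potential. -/
def hessU (ξ : EV n) : Matrix (Fin n) (Fin n) ℝ :=
  Matrix.of fun i j => ∑ k, Δ.nu k i * Δ.nu k j / Δ.l k ξ

theorem inner_sub_guilleminU_le {ξ η : EV n} (hξ : ξ ∈ Δ.openBody) (hη : η ∈ Δ.body) :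
    inner ℝ (Δ.gradU ξ) η - Δ.guilleminU η ≤ inner ℝ (Δ.gradU ξ) ξ - Δ.guilleminU ξ := by
  have h : ∑ k, (Δ.l k η * log (Δ.l k ξ) + Δ.l k η - Δ.l k ξ) ≤ Δ.guilleminU η :=
    Finset.sum_le_sum fun k _ => mul_log_add_le (hξ k) (hη k)
  have h2 : inner ℝ (Δ.gradU ξ) η - inner ℝ (Δ.gradU ξ) ξ
      = ∑ k, (Δ.l k η * log (Δ.l k ξ) + Δ.l k η - Δ.l k ξ) - Δ.guilleminU ξ := by
    rw [← inner_sub_right, gradU, sum_inner, guilleminU, ← Finset.sum_sub_distrib]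
    refine Finset.sum_congr rfl fun k _ => ?_
    rw [real_inner_smul_left, ← l_sub_l]; ring
  linarith

/-- Surjectivity of ∇U is the solvability of the chart equation at the positive values w_i =
exp⟨e_i, x⟩. -/
theorem exists_gradU_eq (x : EV n) : ∃ ξ ∈ Δ.openBody, Δ.gradU ξ = x := by
  obtain ⟨b, p, e, F⟩ := Δ.exists_frame
  obtain ⟨y, hy, h, hyw⟩ := F.exists_chartMap_eq (fun i => exp (inner ℝ (e i) x))
    fun i => (exp_pos _).le
  have hyi : ∀ i, y i * exp (1 + Δ.hGrad b p e i y) = exp (inner ℝ (e i) x) := congrFun hyw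
  have hy0 : ∀ i, 0 < y i := fun i =>
    pos_of_mul_pos_left (by rw [hyi]; exact exp_pos _) (exp_pos _).le
  refine ⟨pt p e y, fun k => ?_, ?_⟩
  · by_cases hk : k ∈ Set.range b
    · obtain ⟨i, rfl⟩ := hk
      rw [F.l_b_pt]; exact hy0 i
    · exact h k (Δ.mem_out.2 hk)
  · rw [gradU, Δ.sum_eq_sum_add_sum_out F.inj]
    have h1 : ∑ k ∈ Δ.out b, (log (Δ.l k (pt p e y)) + 1) • Δ.nu k
        = ∑ i, Δ.hGrad b p e i y • Δ.nu (b i) := by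
      simp only [hGrad, Finset.sum_smul]
      rw [Finset.sum_comm]
      refine Finset.sum_congr rfl fun k _ => ?_
      conv_lhs => rw [← F.sum_inner_smul_nu (Δ.nu k), Finset.smul_sum]
      refine Finset.sum_congr rfl fun i _ => ?_
      rw [smul_smul, real_inner_comm, mul_comm]
    rw [h1, ← Finset.sum_add_distrib]
    conv_rhs => rw [← F.sum_inner_smul_nu x]
    refine Finset.sum_congr rfl fun i _ => ?_
    rw [← add_smul, F.l_b_pt]
    congr 1
    rw [← Real.log_exp (inner ℝ (e i) x), ← hyi, Real.log_mul (hy0 i).ne' (exp_pos _).ne',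
      Real.log_exp]
    ring

theorem g_gradU {ξ : EV n} (hξ : ξ ∈ Δ.openBody) :
    Δ.g (Δ.gradU ξ) = inner ℝ (Δ.gradU ξ) ξ - Δ.guilleminU ξ := by
  refine IsGreatest.csSup_eq ⟨⟨⟨ξ, Δ.openBody_subset hξ⟩, rfl⟩, ?_⟩
  rintro _ ⟨η, rfl⟩
  exact Δ.inner_sub_guilleminU_le hξ η.2

theorem inner_sub_guilleminU_le_g (x : EV n) {η : EV n} (hη : η ∈ Δ.body) :
    inner ℝ x η - Δ.guilleminU η ≤ Δ.g x := by
  obtain ⟨ξ, hξ, rfl⟩ := Δ.exists_gradU_eq x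
  rw [Δ.g_gradU hξ]
  exact Δ.inner_sub_guilleminU_le hξ hη

theorem Frame.gLocal_eq {Δ : DelzantPolytope n} {b p e} (F : Δ.Frame b p e) {z : Fin n → ℂ}
    (hz : ∀ i, z i ≠ 0) :
    Δ.gLocal b z = Δ.g (∑ i, log (‖z i‖ ^ 2) • Δ.nu (b i))
      - inner ℝ (∑ i, log (‖z i‖ ^ 2) • Δ.nu (b i)) p := by
  set x := ∑ i, log (‖z i‖ ^ 2) • Δ.nu (b i) with hx
  have hw : ∀ i, ‖z i‖ ^ 2 ≠ 0 := fun i => by simpa using hz i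
  obtain ⟨y, hy, h, hyw⟩ := F.exists_chartMap_eq (fun i => ‖z i‖ ^ 2) fun i => sq_nonneg _
  obtain ⟨h1, h2⟩ := F.isGreatest_potential hy h hyw
  rw [F.gLocal_eq_potential hy h hyw]
  simp only [F.sum_l_mul, ← hx] at h1 h2
  have : Δ.g x = Δ.potential b p e y + inner ℝ x p := by
    refine IsGreatest.csSup_eq ⟨⟨⟨pt p e y, F.pt_mem_body hy h⟩, ?_⟩, ?_⟩
    · simp only
      linarith
    · rintro _ ⟨η, rfl⟩
      have := h1 η.1 η.2 fun i hi => absurd hi (hw i)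
      simp only
      linarith
  rw [this]; ring

/-- The point in the chart at a vertex with log-affine coordinates `x`. -/
def chartPt (e : Fin n → EV n) (x : EV n) : Fin n → ℂ :=
  fun i => ((exp (inner ℝ (e i) x / 2) : ℝ) : ℂ)

omit Δ in
theorem contDiff_chartPt (e : Fin n → EV n) : ContDiff ℝ ∞ (chartPt e) := by
  rw [contDiff_pi]
  intro i
  unfold chartPt
  refine Complex.ofRealCLM.contDiff.comp (ContDiff.exp ?_)
  exact (contDiff_const.inner ℝ contDiff_id).div_const 2

omit Δ in
theorem chartPt_ne_zero (e : Fin n → EV n) (x : EV n) (i : Fin n) : chartPt e x i ≠ 0 := by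
  simp [chartPt]

omit Δ in
theorem log_norm_chartPt (e : Fin n → EV n) (x : EV n) (i : Fin n) :
    log (‖chartPt e x i‖ ^ 2) = inner ℝ (e i) x := by
  rw [chartPt, Complex.norm_real, Real.norm_of_nonneg (exp_pos _).le, Real.log_pow, Real.log_exp]
  push_cast; ring

theorem Frame.sum_log_norm_chartPt {Δ : DelzantPolytope n} {b p e} (F : Δ.Frame b p e)
    (x : EV n) : ∑ i, log (‖chartPt e x i‖ ^ 2) • Δ.nu (b i) = x := by
  simp only [log_norm_chartPt]
  exact F.sum_inner_smul_nu x

theorem Frame.g_eq_gLocal {Δ : DelzantPolytope n} {b p e} (F : Δ.Frame b p e) (x : EV n) :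
    Δ.g x = Δ.gLocal b (chartPt e x) + inner ℝ x p := by
  rw [F.gLocal_eq (chartPt_ne_zero e x), F.sum_log_norm_chartPt]; ring

theorem contDiff_g : ContDiff ℝ ∞ Δ.g := by
  obtain ⟨b, p, e, F⟩ := Δ.exists_frame
  have : Δ.g = fun x => Δ.gLocal b (chartPt e x) + inner ℝ x p := funext F.g_eq_gLocal
  rw [this]
  exact (F.contDiff_gLocal.comp (contDiff_chartPt e)).add (contDiff_id.inner ℝ contDiff_const)

/-- Fenchel's inequality g ≥ ⟨·, ξ⟩ - U(ξ) is an equality at ∇U(ξ), so g - ⟨ξ, ·⟩ has a minimum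
there. -/
theorem gradient_g_gradU {ξ : EV n} (hξ : ξ ∈ Δ.openBody) : gradient Δ.g (Δ.gradU ξ) = ξ := by
  set x := Δ.gradU ξ with hx
  have h1 : HasFDerivAt (fun y => Δ.g y - inner ℝ ξ y) (fderiv ℝ Δ.g x - innerSL ℝ ξ) x :=
    ((Δ.contDiff_g.differentiable (by simp)) x).hasFDerivAt.sub (innerSL ℝ ξ).hasFDerivAt
  have h2 : IsLocalMin (fun y => Δ.g y - inner ℝ ξ y) x := by
    refine Filter.Eventually.of_forall fun y => ?_
    have h3 := Δ.inner_sub_guilleminU_le_g y (Δ.openBody_subset hξ)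
    have h4 := Δ.g_gradU hξ
    rw [← hx] at h4
    rw [real_inner_comm] at h3 h4
    simp only
    linarith
  have h3 := h2.hasFDerivAt_eq_zero h1
  refine ext_inner_right ℝ fun v => ?_
  rw [← fderiv_eq_inner_gradient]
  have := congrArg (fun L => L v) h3
  simp only [sub_apply, innerSL_apply_apply, zero_apply] at this
  linarith

theorem gradient_g_mem (x : EV n) : gradient Δ.g x ∈ Δ.openBody := by
  obtain ⟨ξ, hξ, rfl⟩ := Δ.exists_gradU_eq x
  rwa [Δ.gradient_g_gradU hξ]

theorem gradU_gradient_g (x : EV n) : Δ.gradU (gradient Δ.g x) = x := by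
  obtain ⟨ξ, hξ, rfl⟩ := Δ.exists_gradU_eq x
  rw [Δ.gradient_g_gradU hξ]

theorem pd_l (k : Fin Δ.d) (a : Fin n) (ξ : EV n) : pd a (Δ.l k) ξ = Δ.nu k a := by
  have : Δ.l k = fun ξ => inner ℝ (Δ.nu k) ξ + Δ.c k := funext (Δ.l_eq_inner k)
  rw [this, pd, fderiv_add_const]
  have h : fderiv ℝ (fun ξ => inner ℝ (Δ.nu k) ξ) ξ = innerSL ℝ (Δ.nu k) :=
    (innerSL ℝ (Δ.nu k)).hasFDerivAt.fderiv
  rw [h, innerSL_apply_apply, inner_single_right]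

/-- This is the derivative of the identity ∇U ∘ ∇g = id, read off coordinate by coordinate. -/
theorem hess_g_mul_hessU (x : EV n) : hess Δ.g x * Δ.hessU (gradient Δ.g x) = 1 := by
  ext i a
  have hpos := Δ.gradient_g_mem x
  have h1 : (fun y : EV n => y a) = fun y => ∑ k, (log (Δ.l k (gradient Δ.g y)) + 1) * Δ.nu k a := by
    funext y
    conv_lhs => rw [← Δ.gradU_gradient_g y]
    simp [gradU]
  have hd : ∀ k, HasFDerivAt (fun ξ => log (Δ.l k ξ))
      ((Δ.l k (gradient Δ.g x))⁻¹ • fderiv ℝ (Δ.l k) (gradient Δ.g x)) (gradient Δ.g x) := fun k =>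
    (((Δ.contDiff_l k).differentiable (by simp)) _).hasFDerivAt.log (hpos k).ne'
  have h2 : pd i (fun y : EV n => y a) x = if i = a then 1 else 0 := by
    have : fderiv ℝ (fun y : EV n => y a) x = EuclideanSpace.proj a :=
      (EuclideanSpace.proj a : EV n →L[ℝ] ℝ).hasFDerivAt.fderiv
    rw [pd, this]
    simp [PiLp.single_apply, eq_comm]
  rw [Matrix.mul_apply, Matrix.one_apply, ← h2, h1]
  have hG : HasFDerivAt (fun ξ : EV n => ∑ k, (log (Δ.l k ξ) + 1) * Δ.nu k a)
      (∑ k, Δ.nu k a • ((Δ.l k (gradient Δ.g x))⁻¹ • fderiv ℝ (Δ.l k) (gradient Δ.g x)))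
      (gradient Δ.g x) :=
    HasFDerivAt.fun_sum fun k _ => ((hd k).add_const 1).mul_const (Δ.nu k a)
  rw [pd_comp_gradient (G := fun ξ => ∑ k, (log (Δ.l k ξ) + 1) * Δ.nu k a) Δ.contDiff_g
    hG.differentiableAt]
  refine Finset.sum_congr rfl fun c _ => ?_
  congr 1
  rw [pd, hG.fderiv, hessU, Matrix.of_apply]
  simp only [FunLike.coe_sum, Finset.sum_apply, FunLike.coe_smul,
    Pi.smul_apply, smul_eq_mul]
  refine Finset.sum_congr rfl fun k _ => ?_
  have := Δ.pd_l k c (gradient Δ.g x)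
  rw [pd] at this
  rw [this]; ring

theorem hess_g_eq (x : EV n) : hess Δ.g x = (Δ.hessU (gradient Δ.g x))⁻¹ :=
  (Matrix.inv_eq_left_inv (Δ.hess_g_mul_hessU x)).symm

end DelzantPolytope

/-! ### Jacobi's formula for determinants. -/

section LogDet

variable {m : ℕ}

theorem hasDerivAt_det {M : ℝ → Matrix (Fin m) (Fin m) ℝ} {M' : Matrix (Fin m) (Fin m) ℝ} {t : ℝ}
    (h : ∀ a c, HasDerivAt (fun s => M s a c) (M' a c) t) :
    HasDerivAt (fun s => (M s).det) (((M t).adjugate * M').trace) t := by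
  simp only [Matrix.det_apply]
  have h1 : ∀ σ : Equiv.Perm (Fin m), HasDerivAt (fun s => ∏ i, M s (σ i) i)
      (∑ i, (∏ j ∈ Finset.univ.erase i, M t (σ j) j) • M' (σ i) i) t := fun σ =>
    HasDerivAt.fun_finsetProd fun i _ => h (σ i) i
  have h2 := HasDerivAt.fun_sum (u := Finset.univ) fun σ _ =>
    (h1 σ).const_smul (Equiv.Perm.sign σ)
  refine h2.congr_deriv ?_
  rw [Matrix.trace]
  simp only [Finset.smul_sum]
  rw [Finset.sum_comm]
  refine Finset.sum_congr rfl fun i _ => ?_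
  -- Cramer's rule: this entry is the determinant with column i replaced by its derivative, which is
  -- also what the product rule yields.
  have h3 : ((M t).adjugate * M').diag i = ((M t).updateCol i fun a => M' a i).det := by
    rw [← Matrix.cramer_apply, Matrix.cramer_eq_adjugate_mulVec]
    rfl
  rw [h3, Matrix.det_apply]
  refine Finset.sum_congr rfl fun σ _ => ?_
  congr 1
  rw [← Finset.mul_prod_erase Finset.univ _ (Finset.mem_univ i), Matrix.updateCol_self, smul_eq_mul,
    mul_comm]
  congr 1
  refine Finset.prod_congr rfl fun j hj => ?_
  rw [Matrix.updateCol_ne (Finset.ne_of_mem_erase hj)]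

variable {E : Type*} [NormedAddCommGroup E] [NormedSpace ℝ E]

theorem contDiffAt_det {M : E → Matrix (Fin m) (Fin m) ℝ} {x : E}
    (h : ∀ a c, ContDiffAt ℝ ∞ (fun y => M y a c) x) : ContDiffAt ℝ ∞ (fun y => (M y).det) x := by
  simp only [Matrix.det_apply]
  refine ContDiffAt.sum fun σ _ => ?_
  exact (contDiffAt_prod fun i _ => h (σ i) i).const_smul (Equiv.Perm.sign σ)

/-- Jacobi's formula for the derivative of `log det`. -/
theorem fderiv_log_det {M : E → Matrix (Fin m) (Fin m) ℝ} {x : E}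
    (h : ∀ a c, ContDiffAt ℝ ∞ (fun y => M y a c) x) (hdet : (M x).det ≠ 0) (v : E) :
    fderiv ℝ (fun y => log (M y).det) x v
      = ∑ a, ∑ c, (M x)⁻¹ a c * fderiv ℝ (fun y => M y c a) x v := by
  have hline : HasDerivAt (fun s : ℝ => x + s • v) v 0 := by
    simpa using ((hasDerivAt_id (0 : ℝ)).smul_const v).const_add x
  have hcurve : ∀ G : E → ℝ, DifferentiableAt ℝ G x →
      HasDerivAt (fun s : ℝ => G (x + s • v)) (fderiv ℝ G x v) 0 := by
    intro G hG
    have hG' : HasFDerivAt G (fderiv ℝ G x) ((fun s : ℝ => x + s • v) 0) := by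
      simpa using hG.hasFDerivAt
    exact hG'.comp_hasDerivAt 0 hline
  have h1 := hcurve (fun y => log (M y).det)
    (((contDiffAt_det h).log hdet).differentiableAt (by simp))
  have h2 := hasDerivAt_det (M := fun s : ℝ => M (x + s • v))
    (M' := Matrix.of fun a c => fderiv ℝ (fun y => M y a c) x v) (t := 0)
    fun a c => hcurve (fun y => M y a c) ((h a c).differentiableAt (by simp))
  have h3 := (h2.log (by simpa using hdet)).unique h1
  rw [← h3]
  simp only [zero_smul, add_zero, Matrix.trace, Matrix.diag_apply, Matrix.mul_apply,
    Finset.sum_div, Matrix.of_apply, Matrix.inv_def, Matrix.smul_apply, smul_eq_mul,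
    Ring.inverse_eq_inv']
  exact Finset.sum_congr rfl fun a _ => Finset.sum_congr rfl fun c _ => by ring

end LogDet

/-! ### The quantity defining R_g, expressed on the polytope. -/

namespace DelzantPolytope

variable {n : ℕ} (Δ : DelzantPolytope n)

theorem contDiffAt_hessU {ξ : EV n} (hξ : ξ ∈ Δ.openBody) (i j : Fin n) :
    ContDiffAt ℝ ∞ (fun ξ => Δ.hessU ξ i j) ξ := by
  simp only [hessU, Matrix.of_apply]
  exact ContDiffAt.sum fun k _ => contDiffAt_const.div (Δ.contDiff_l k).contDiffAt (hξ k).ne'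

theorem det_hess_g_mul (x : EV n) : (hess Δ.g x).det * (Δ.hessU (gradient Δ.g x)).det = 1 := by
  rw [← Matrix.det_mul, hess_g_mul_hessU, Matrix.det_one]

theorem det_hessU_ne_zero {ξ : EV n} (hξ : ξ ∈ Δ.openBody) : (Δ.hessU ξ).det ≠ 0 := by
  have := Δ.det_hess_g_mul (Δ.gradU ξ)
  rw [Δ.gradient_g_gradU hξ] at this
  exact right_ne_zero_of_mul_eq_one this

theorem det_hess_g_ne_zero (x : EV n) : (hess Δ.g x).det ≠ 0 :=
  left_ne_zero_of_mul_eq_one (Δ.det_hess_g_mul x)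

/-- `log det (g_{ij})` as a function on the open polytope. -/
def rU (ξ : EV n) : ℝ := -log (Δ.hessU ξ).det

/-- `log 𝔽_g` as a function on the open polytope. -/
def qU (D : EV n → ℝ) (ξ : EV n) : ℝ := log (D ξ) + Δ.rU ξ

theorem contDiffAt_rU {ξ : EV n} (hξ : ξ ∈ Δ.openBody) : ContDiffAt ℝ ∞ Δ.rU ξ :=
  ((contDiffAt_det fun i j => Δ.contDiffAt_hessU hξ i j).log (Δ.det_hessU_ne_zero hξ)).neg

theorem log_det_hess_g (x : EV n) : log (hess Δ.g x).det = Δ.rU (gradient Δ.g x) := by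
  rw [rU, ← Real.log_inv, eq_inv_of_mul_eq_one_left (Δ.det_hess_g_mul x)]

variable {Δ} {D : EV n → ℝ}

theorem contDiffAt_log_D (hD : ContDiffOn ℝ ∞ D Δ.body) (hD0 : ∀ ξ ∈ Δ.body, 0 < D ξ) {ξ : EV n}
    (hξ : ξ ∈ Δ.openBody) : ContDiffAt ℝ ∞ (fun ξ => log (D ξ)) ξ :=
  (hD.contDiffAt (Δ.body_mem_nhds hξ)).log (hD0 ξ (Δ.openBody_subset hξ)).ne'

theorem contDiffAt_qU (hD : ContDiffOn ℝ ∞ D Δ.body) (hD0 : ∀ ξ ∈ Δ.body, 0 < D ξ) {ξ : EV n}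
    (hξ : ξ ∈ Δ.openBody) : ContDiffAt ℝ ∞ (Δ.qU D) ξ :=
  (contDiffAt_log_D hD hD0 hξ).add (Δ.contDiffAt_rU hξ)

theorem logF_g (hD0 : ∀ ξ ∈ Δ.body, 0 < D ξ) :
    logF D Δ.g = fun x => Δ.qU D (gradient Δ.g x) := by
  funext x
  rw [logF, Real.log_mul (hD0 _ (Δ.openBody_subset (Δ.gradient_g_mem x))).ne'
    (Δ.det_hess_g_ne_zero x), log_det_hess_g, qU]

theorem pd_logF_g (hD : ContDiffOn ℝ ∞ D Δ.body) (hD0 : ∀ ξ ∈ Δ.body, 0 < D ξ) (x : EV n)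
    (i : Fin n) :
    pd i (logF D Δ.g) x = ∑ a, hess Δ.g x i a * pd a (Δ.qU D) (gradient Δ.g x) := by
  rw [logF_g hD0]
  exact pd_comp_gradient Δ.contDiff_g
    ((contDiffAt_qU hD hD0 (Δ.gradient_g_mem x)).differentiableAt (by simp)) i

theorem pd_log_det_hess_g (x : EV n) (a : Fin n) :
    ∑ i, ∑ j, (hess Δ.g x)⁻¹ i j * pd a (fun y => hess Δ.g y j i) x
      = ∑ c, hess Δ.g x a c * pd c Δ.rU (gradient Δ.g x) := by
  rw [← pd_comp_gradient Δ.contDiff_g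
    ((Δ.contDiffAt_rU (Δ.gradient_g_mem x)).differentiableAt (by simp)) a]
  have h : (fun y => Δ.rU (gradient Δ.g y)) = fun y => log (hess Δ.g y).det :=
    funext fun y => (Δ.log_det_hess_g y).symm
  rw [h, pd, fderiv_log_det (M := hess Δ.g) (fun i j =>
    (contDiff_pd (contDiff_pd Δ.contDiff_g j) i).contDiffAt) (Δ.det_hess_g_ne_zero x)]
  rfl

/-- Since log F_g = q ∘ ∇g, second derivatives of it involve third derivatives of g. Their symmetry
turns the contraction g^{ij} g_{ija} into ∂_a log det(g_ij), hence into first derivatives of `rU`;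
the other contraction collapses through g⁻¹g = 1. -/
theorem trace_hess_logF_g (hD : ContDiffOn ℝ ∞ D Δ.body) (hD0 : ∀ ξ ∈ Δ.body, 0 < D ξ) (x : EV n) :
    ∑ i, ∑ j, (hess Δ.g x)⁻¹ i j * pd i (pd j (logF D Δ.g)) x
      = ∑ a, ∑ c, hess Δ.g x a c * (pd c (pd a (Δ.qU D)) (gradient Δ.g x)
        + pd a (Δ.qU D) (gradient Δ.g x) * pd c Δ.rU (gradient Δ.g x)) := by
  set ξ := gradient Δ.g x with hξdef
  have hξ : ξ ∈ Δ.openBody := Δ.gradient_g_mem x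
  set G := hess Δ.g x with hG
  have hq := contDiffAt_qU hD hD0 hξ
  have hsm : ∀ i j, ContDiff ℝ ∞ (fun y => hess Δ.g y i j) := fun i j =>
    contDiff_pd (contDiff_pd Δ.contDiff_g j) i
  have h1 : ∀ i j, pd i (pd j (logF D Δ.g)) x
      = ∑ a, (pd i (fun y => hess Δ.g y j a) x * pd a (Δ.qU D) ξ
        + G j a * ∑ c, G i c * pd c (pd a (Δ.qU D)) ξ) := by
    intro i j
    have e : pd j (logF D Δ.g)
        = fun y => ∑ a, hess Δ.g y j a * pd a (Δ.qU D) (gradient Δ.g y) :=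
      funext fun y => pd_logF_g hD hD0 y j
    have hdq : ∀ a, DifferentiableAt ℝ (fun y => pd a (Δ.qU D) (gradient Δ.g y)) x := by
      intro a
      have h2 : DifferentiableAt ℝ (pd a (Δ.qU D)) (gradient Δ.g x) :=
        (contDiffAt_pd hq a).differentiableAt (by simp)
      exact h2.comp x ((contDiff_gradient Δ.contDiff_g).differentiable (by simp) x)
    have hdg : ∀ a, DifferentiableAt ℝ (fun y => hess Δ.g y j a) x := fun a =>
      (hsm j a).differentiable (by simp) x
    rw [e, pd, fderiv_fun_sum fun a _ => (hdg a).fun_mul (hdq a)]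
    rw [FunLike.coe_sum, Finset.sum_apply]
    refine Finset.sum_congr rfl fun a _ => ?_
    rw [fderiv_fun_mul (hdg a) (hdq a)]
    have h2 := pd_comp_gradient (G := pd a (Δ.qU D)) Δ.contDiff_g (x := x)
      ((contDiffAt_pd hq a).differentiableAt (by simp)) i
    rw [pd] at h2
    simp only [add_apply, FunLike.coe_smul, Pi.smul_apply, smul_eq_mul, h2]
    simp only [pd]
    ring
  have hinv : ∀ j c, ∑ i, G⁻¹ i j * G i c = if j = c then 1 else 0 := by
    intro j c
    have h2 : G⁻¹ * G = 1 := Matrix.nonsing_inv_mul _ (Ne.isUnit (Δ.det_hess_g_ne_zero x))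
    have hsymm : G.transpose = G := by
      ext i j; exact hess_symm Δ.contDiff_g.contDiffAt j i
    have h3 : G⁻¹.transpose = G⁻¹ := by rw [Matrix.transpose_nonsing_inv, hsymm]
    have h4 := congrFun (congrFun h2 j) c
    rw [Matrix.mul_apply, Matrix.one_apply] at h4
    rw [← h4]
    refine Finset.sum_congr rfl fun i _ => ?_
    conv_lhs => rw [← h3, Matrix.transpose_apply]
  have h3 : ∀ i j a, pd i (fun y => hess Δ.g y j a) x = pd a (fun y => hess Δ.g y j i) x := by
    intro i j a
    have e1 : ∀ c, (fun y => hess Δ.g y j c) = pd c (pd j Δ.g) := by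
      intro c; funext y; exact hess_symm Δ.contDiff_g.contDiffAt j c
    rw [e1, e1]
    exact pd_comm (contDiff_pd Δ.contDiff_g j).contDiffAt i a
  calc ∑ i, ∑ j, G⁻¹ i j * pd i (pd j (logF D Δ.g)) x
      = ∑ i, ∑ j, ∑ a, (G⁻¹ i j * pd a (fun y => hess Δ.g y j i) x * pd a (Δ.qU D) ξ)
        + ∑ i, ∑ j, ∑ a, ∑ c, (G⁻¹ i j * G i c) * (G j a * pd c (pd a (Δ.qU D)) ξ) := by
        rw [← Finset.sum_add_distrib]
        refine Finset.sum_congr rfl fun i _ => ?_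
        rw [← Finset.sum_add_distrib]
        refine Finset.sum_congr rfl fun j _ => ?_
        rw [h1, ← Finset.sum_add_distrib, Finset.mul_sum]
        refine Finset.sum_congr rfl fun a _ => ?_
        rw [h3 i j a, mul_add, Finset.mul_sum, Finset.mul_sum]
        congr 1
        · ring
        · exact Finset.sum_congr rfl fun c _ => by ring
    _ = ∑ a, (∑ i, ∑ j, G⁻¹ i j * pd a (fun y => hess Δ.g y j i) x) * pd a (Δ.qU D) ξ
        + ∑ j, ∑ a, ∑ c, (∑ i, G⁻¹ i j * G i c) * (G j a * pd c (pd a (Δ.qU D)) ξ) := by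
        congr 1
        · simp only [Finset.sum_mul]
          conv_rhs => rw [Finset.sum_comm]
          refine Finset.sum_congr rfl fun i _ => ?_
          rw [Finset.sum_comm]
        · rw [Finset.sum_comm]
          refine Finset.sum_congr rfl fun j _ => ?_
          rw [Finset.sum_comm]
          refine Finset.sum_congr rfl fun a _ => ?_
          rw [Finset.sum_comm]
          refine Finset.sum_congr rfl fun c _ => ?_
          rw [Finset.sum_mul]
    _ = _ := by
        simp only [hinv, ite_mul, one_mul, zero_mul, Finset.sum_ite_eq, Finset.mem_univ, if_true]
        have hJ : ∀ a, ∑ i, ∑ j, G⁻¹ i j * pd a (fun y => hess Δ.g y j i) x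
            = ∑ c, G a c * pd c Δ.rU ξ := pd_log_det_hess_g x
        simp only [hJ, mul_add, Finset.sum_add_distrib]
        rw [add_comm]
        congr 1
        · rw [Finset.sum_comm]
          refine Finset.sum_congr rfl fun a _ => Finset.sum_congr rfl fun c _ => ?_
          rw [show G c a = G a c from hess_symm Δ.contDiff_g.contDiffAt c a]
        · refine Finset.sum_congr rfl fun a _ => ?_
          rw [Finset.sum_mul]
          exact Finset.sum_congr rfl fun c _ => by ring

theorem RgFun_gradU (hD : ContDiffOn ℝ ∞ D Δ.body) (hD0 : ∀ ξ ∈ Δ.body, 0 < D ξ) {ξ : EV n}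
    (hξ : ξ ∈ Δ.openBody) :
    Δ.RgFun D (Δ.gradU ξ) = |∑ a, ∑ c, (Δ.hessU ξ)⁻¹ a c * (pd c (pd a (Δ.qU D)) ξ
        + pd a (Δ.qU D) ξ * pd c Δ.rU ξ)|
      + ∑ i, (∑ a, (Δ.hessU ξ)⁻¹ i a * pd a (Δ.qU D) ξ) ^ 2 := by
  rw [RgFun, trace_hess_logF_g hD hD0]
  simp only [pd_logF_g hD hD0, hess_g_eq, Δ.gradient_g_gradU hξ]

end DelzantPolytope

/-! ### Passage to the limit at a vertex, abstractly. -/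

section LimitAlgebra

open Matrix

variable {n : ℕ}

theorem tendsto_inv_one_add_smul {H : ℝ → Matrix (Fin n) (Fin n) ℝ} {H0 : Matrix (Fin n) (Fin n) ℝ}
    (hH : ∀ i j, Filter.Tendsto (fun s => H s i j) (𝓝[>] 0) (𝓝 (H0 i j))) :
    (∀ i j, Filter.Tendsto (fun s => (1 + s • H s)⁻¹ i j) (𝓝[>] 0)
      (𝓝 ((1 : Matrix (Fin n) (Fin n) ℝ) i j))) ∧
    ∀ᶠ s in 𝓝[>] (0 : ℝ), (1 + s • H s).det ≠ 0 := by
  have h0 : Filter.Tendsto (fun s : ℝ => s) (𝓝[>] 0) (𝓝 0) := nhdsWithin_le_nhds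
  have h1 : Filter.Tendsto (fun s => 1 + s • H s) (𝓝[>] (0 : ℝ))
      (𝓝 (1 : Matrix (Fin n) (Fin n) ℝ)) := by
    refine tendsto_pi_nhds.2 fun i => tendsto_pi_nhds.2 fun j => ?_
    have := (tendsto_const_nhds (x := (1 : Matrix (Fin n) (Fin n) ℝ) i j)).add (h0.mul (hH i j))
    simpa using this
  constructor
  · have hc : ContinuousAt (Inv.inv : Matrix (Fin n) (Fin n) ℝ → _) 1 := by
      refine continuousAt_matrix_inv _ ?_
      rw [det_one, Ring.inverse_eq_inv']
      exact continuousAt_inv₀ one_ne_zero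
    have h2 := hc.tendsto.comp h1
    rw [inv_one] at h2
    intro i j
    exact (tendsto_pi_nhds.1 ((tendsto_pi_nhds.1 h2) i)) j
  · have hdet : Continuous fun M : Matrix (Fin n) (Fin n) ℝ => M.det := Continuous.matrix_det continuous_id
    have h3 := (hdet.tendsto 1).comp h1
    exact h3.eventually_ne (by simp)

/-- The algebraic cancellation of the singular terms at a vertex. -/
theorem vertex_trace_identity {H N K2 E2 : Matrix (Fin n) (Fin n) ℝ} {K1 E1 : Fin n → ℝ} {s : ℝ}
    (hs : s ≠ 0) (hN : N = 1 - s • (H * N)) :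
    ∑ i, ∑ j, s * N i j * ((-(if j = i then 1 / s ^ 2 else 0) + K2 j i + E2 j i)
        + (1 / s + K1 i + E1 i) * (1 / s + K1 j))
      = (H * N).trace - ∑ i, ∑ j, (H * N) i j + ∑ i, ∑ j, N i j * (E1 i + K1 i + K1 j)
        + s * ∑ i, ∑ j, N i j * (K2 j i + E2 j i + (K1 i + E1 i) * K1 j) := by
  have h1 : ∀ i j, s * N i j * ((-(if j = i then 1 / s ^ 2 else 0) + K2 j i + E2 j i)
        + (1 / s + K1 i + E1 i) * (1 / s + K1 j))
      = ((if j = i then (H * N) i j else 0) - (H * N) i j) + N i j * (E1 i + K1 i + K1 j)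
        + s * (N i j * (K2 j i + E2 j i + (K1 i + E1 i) * K1 j)) := by
    intro i j
    -- On the diagonal the 1/s² terms cancel outright. Off the diagonal N equals -s(HN), which
    -- absorbs the remaining 1/s.
    have h2 : N i j = (if i = j then 1 else 0) - s * (H * N) i j := by
      conv_lhs => rw [hN]
      simp [Matrix.one_apply]
    by_cases hij : i = j
    · subst hij
      simp only [if_true] at h2 ⊢
      field_simp
      ring_nf
    · have hji : ¬ j = i := fun h => hij h.symm
      simp only [if_neg hij, if_neg hji] at h2 ⊢
      have h3 : (H * N) i j = - N i j / s := by rw [h2]; field_simp; ring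
      rw [h3]
      field_simp
      ring
  simp only [h1, Finset.sum_add_distrib, Finset.sum_sub_distrib, Finset.mul_sum]
  congr 3
  simp [Matrix.trace]

/-- H and K come from functions smooth at the vertex and converge; E comes from log D and is only
known to be bounded. Every E-term except ∑ E1 carries a factor s or N - 1 and disappears, so only
the one-sided bound on ∑ E1 matters. As K1 tends to -H_ii, the limit of the K1-terms is -2 tr H,
which turns tr H - ∑ H_ij into -(tr H + ∑ H_ij). -/
theorem vertex_limit {e : Fin n → EV n} {H K2 E2 : ℝ → Matrix (Fin n) (Fin n) ℝ}
    {H0 K20 : Matrix (Fin n) (Fin n) ℝ} {K1 E1 : ℝ → Fin n → ℝ} {K10 : Fin n → ℝ}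
    {V : ℝ → EV n} {T : ℝ → ℝ} {r ρ C : ℝ}
    (hH : ∀ i j, Filter.Tendsto (fun s => H s i j) (𝓝[>] 0) (𝓝 (H0 i j)))
    (hK1 : ∀ i, Filter.Tendsto (fun s => K1 s i) (𝓝[>] 0) (𝓝 (K10 i)))
    (hK2 : ∀ i j, Filter.Tendsto (fun s => K2 s i j) (𝓝[>] 0) (𝓝 (K20 i j)))
    (hK10 : ∀ i, K10 i = - H0 i i)
    (hE1 : ∀ᶠ s in 𝓝[>] (0 : ℝ), ∀ i, |E1 s i| ≤ C)
    (hE2 : ∀ᶠ s in 𝓝[>] (0 : ℝ), ∀ i j, |E2 s i j| ≤ C)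
    (hE : ∀ᶠ s in 𝓝[>] (0 : ℝ), ∑ i, E1 s i ≤ ρ)
    (hT : ∀ᶠ s in 𝓝[>] (0 : ℝ), T s = ∑ i, ∑ j, s * (1 + s • H s)⁻¹ i j *
        ((-(if j = i then 1 / s ^ 2 else 0) + K2 s j i + E2 s j i)
        + (1 / s + K1 s i + E1 s i) * (1 / s + K1 s j)))
    (hV : ∀ᶠ s in 𝓝[>] (0 : ℝ), V s = ∑ i, (∑ j, s * (1 + s • H s)⁻¹ i j *
        (1 / s + K1 s j + E1 s j)) • e i)
    (hr : ∀ᶠ s in 𝓝[>] (0 : ℝ), |T s| + ‖V s‖ ^ 2 ≤ r) :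
    H0.trace + ∑ i, ∑ j, H0 i j + ‖∑ i, e i‖ ^ 2 ≤ r + ρ := by
  obtain ⟨hN, hdet⟩ := tendsto_inv_one_add_smul hH
  have h0 : Filter.Tendsto (fun s : ℝ => s) (𝓝[>] 0) (𝓝 0) := nhdsWithin_le_nhds
  set N : ℝ → Matrix (Fin n) (Fin n) ℝ := fun s => (1 + s • H s)⁻¹ with hNdef
  have hne : ∀ᶠ s in 𝓝[>] (0 : ℝ), s ≠ 0 := by
    filter_upwards [self_mem_nhdsWithin] with s hs
    exact ne_of_gt hs
  have hNid : ∀ᶠ s in 𝓝[>] (0 : ℝ), N s = 1 - s • (H s * N s) := by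
    filter_upwards [hdet] with s hs
    have h1 : (1 + s • H s) * N s = 1 := Matrix.mul_nonsing_inv _ (Ne.isUnit hs)
    rw [add_mul, one_mul, smul_mul_assoc] at h1
    exact eq_sub_of_add_eq h1
  have hbdd : ∀ {u : ℝ → ℝ}, (∀ᶠ s in 𝓝[>] (0 : ℝ), |u s| ≤ C) →
      Filter.IsBoundedUnder (· ≤ ·) (𝓝[>] (0 : ℝ)) (norm ∘ u) := by
    intro u hu
    exact ⟨C, Filter.eventually_map.2 hu⟩
  have hE1b : ∀ i, Filter.IsBoundedUnder (· ≤ ·) (𝓝[>] (0 : ℝ)) (norm ∘ fun s => E1 s i) :=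
    fun i => hbdd (hE1.mono fun s h => h i)
  have hE2b : ∀ i j, Filter.IsBoundedUnder (· ≤ ·) (𝓝[>] (0 : ℝ)) (norm ∘ fun s => E2 s i j) :=
    fun i j => hbdd (hE2.mono fun s h => h i j)
  have hHN : ∀ i j, Filter.Tendsto (fun s => (H s * N s) i j) (𝓝[>] 0) (𝓝 (H0 i j)) := by
    intro i j
    have h1 := tendsto_finsetSum Finset.univ fun c _ => (hH i c).mul (hN c j)
    simp only [← Matrix.mul_apply, mul_one] at h1
    exact h1
  have hsN : ∀ i j, Filter.Tendsto (fun s => s * N s i j) (𝓝[>] 0) (𝓝 0) := by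
    intro i j
    simpa using h0.mul (hN i j)
  -- the terms with a limit
  have hA : Filter.Tendsto (fun s => (H s * N s).trace - ∑ i, ∑ j, (H s * N s) i j
      + ∑ i, ∑ j, N s i j * (K1 s i + K1 s j)) (𝓝[>] 0)
      (𝓝 (H0.trace - ∑ i, ∑ j, H0 i j
        + ∑ i, ∑ j, (1 : Matrix (Fin n) (Fin n) ℝ) i j * (K10 i + K10 j))) := by
    refine Filter.Tendsto.add (Filter.Tendsto.sub ?_ ?_) ?_
    · simp only [Matrix.trace, Matrix.diag_apply]
      exact tendsto_finsetSum _ fun i _ => hHN i i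
    · exact tendsto_finsetSum _ fun i _ => tendsto_finsetSum _ fun j _ => hHN i j
    · exact tendsto_finsetSum _ fun i _ => tendsto_finsetSum _ fun j _ =>
        (hN i j).mul ((hK1 i).add (hK1 j))
  -- the small terms
  have hB : Filter.Tendsto (fun s => ∑ i, ∑ j, (N s i j - (1 : Matrix (Fin n) (Fin n) ℝ) i j) * E1 s i)
      (𝓝[>] 0) (𝓝 0) := by
    have : ∀ i j, Filter.Tendsto
        (fun s => (N s i j - (1 : Matrix (Fin n) (Fin n) ℝ) i j) * E1 s i) (𝓝[>] 0) (𝓝 0) := by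
      intro i j
      refine Filter.Tendsto.zero_mul_isBoundedUnder_le ?_ (hE1b i)
      simpa using (hN i j).sub_const ((1 : Matrix (Fin n) (Fin n) ℝ) i j)
    simpa using tendsto_finsetSum Finset.univ fun i _ =>
      tendsto_finsetSum Finset.univ fun j _ => this i j
  have hD : Filter.Tendsto (fun s => ∑ i, ∑ j, (s * N s i j * K2 s j i + s * N s i j * E2 s j i
      + s * N s i j * K1 s i * K1 s j + s * N s i j * K1 s j * E1 s i)) (𝓝[>] 0) (𝓝 0) := by
    have : ∀ i j, Filter.Tendsto (fun s => s * N s i j * K2 s j i + s * N s i j * E2 s j i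
      + s * N s i j * K1 s i * K1 s j + s * N s i j * K1 s j * E1 s i) (𝓝[>] 0) (𝓝 0) := by
      intro i j
      have t1 := (hsN i j).mul (hK2 j i)
      have t2 := (hsN i j).zero_mul_isBoundedUnder_le (hE2b j i)
      have t3 := ((hsN i j).mul (hK1 i)).mul (hK1 j)
      have t4' := (hsN i j).mul (hK1 j)
      rw [zero_mul] at t4'
      have t4 := t4'.zero_mul_isBoundedUnder_le (hE1b i)
      have := ((t1.add t2).add t3).add t4
      simpa using this
    simpa using tendsto_finsetSum Finset.univ fun i _ =>
      tendsto_finsetSum Finset.univ fun j _ => this i j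
  have hVt : Filter.Tendsto V (𝓝[>] 0) (𝓝 (∑ i, e i)) := by
    have h1 : ∀ i, Filter.Tendsto (fun s => ∑ j, (N s i j + s * N s i j * K1 s j
        + s * N s i j * E1 s j)) (𝓝[>] 0) (𝓝 1) := by
      intro i
      have h2 : ∀ j, Filter.Tendsto (fun s => N s i j + s * N s i j * K1 s j
        + s * N s i j * E1 s j) (𝓝[>] 0) (𝓝 ((1 : Matrix (Fin n) (Fin n) ℝ) i j)) := by
        intro j
        have := ((hN i j).add ((hsN i j).mul (hK1 j))).add
          ((hsN i j).zero_mul_isBoundedUnder_le (hE1b j))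
        simpa using this
      have := tendsto_finsetSum Finset.univ fun j _ => h2 j
      simpa [Matrix.one_apply] using this
    have h3 := tendsto_finsetSum Finset.univ fun i _ => (h1 i).smul_const (e i)
    simp only [one_smul] at h3
    refine h3.congr' ?_
    filter_upwards [hV, hne] with s h4 h5
    rw [h4]
    refine Finset.sum_congr rfl fun i _ => ?_
    congr 1
    refine Finset.sum_congr rfl fun j _ => ?_
    simp only [hNdef]
    field_simp
  have hlim := ((hA.add hB).add hD).neg.add (hVt.norm.pow 2)
  have hle := le_of_tendsto (b := r + ρ) hlim (by
    filter_upwards [hT, hr, hE, hne, hNid] with s h1 h2 h3 h4 h5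
    rw [vertex_trace_identity h4 h5] at h1
    have h6 : - T s ≤ |T s| := neg_le_abs _
    have h7 : ∑ i, ∑ j, N s i j * (E1 s i + K1 s i + K1 s j)
        = ∑ i, ∑ j, N s i j * (K1 s i + K1 s j)
          + ∑ i, ∑ j, (N s i j - (1 : Matrix (Fin n) (Fin n) ℝ) i j) * E1 s i + ∑ i, E1 s i := by
      have : ∑ i, E1 s i = ∑ i, ∑ j, (1 : Matrix (Fin n) (Fin n) ℝ) i j * E1 s i := by
        simp [Matrix.one_apply]
      rw [this]
      simp only [← Finset.sum_add_distrib]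
      exact Finset.sum_congr rfl fun i _ => Finset.sum_congr rfl fun j _ => by ring
    have h8 : s * ∑ i, ∑ j, N s i j * (K2 s j i + E2 s j i + (K1 s i + E1 s i) * K1 s j)
        = ∑ i, ∑ j, (s * N s i j * K2 s j i + s * N s i j * E2 s j i
          + s * N s i j * K1 s i * K1 s j + s * N s i j * K1 s j * E1 s i) := by
      simp only [Finset.mul_sum]
      exact Finset.sum_congr rfl fun i _ => Finset.sum_congr rfl fun j _ => by ring
    rw [h7, h8] at h1
    linarith)
  have h9 : ∑ i, ∑ j, (1 : Matrix (Fin n) (Fin n) ℝ) i j * (K10 i + K10 j) = -2 * H0.trace := by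
    simp only [Matrix.one_apply, ite_mul, one_mul, zero_mul, Finset.sum_ite_eq, Finset.mem_univ,
      if_true, hK10, Matrix.trace, Matrix.diag_apply, Finset.mul_sum]
    exact Finset.sum_congr rfl fun i _ => by ring
  rw [h9] at hle
  linarith

end LimitAlgebra

/-! ### Consequences of the definition of R, and the symplectic Hessian near a vertex. -/

namespace DelzantPolytope

open Matrix

variable {n : ℕ} {Δ : DelzantPolytope n} {D : EV n → ℝ} {R : ℝ}

/-! ### Consequences of the definition of `𝓡` -/

namespace IsCurlyR

variable (hR : Δ.IsCurlyR D R)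
include hR

theorem RgFun_le (x : EV n) : Δ.RgFun D x ≤ R := by
  obtain ⟨Rg, Dm, h1, -, rfl⟩ := hR
  exact (h1.1 ⟨x, rfl⟩).trans (le_max_left _ _)

theorem diam_sq_le : Metric.diam Δ.body ^ 2 ≤ R := by
  obtain ⟨Rg, Dm, -, -, rfl⟩ := hR
  exact (le_max_right _ _).trans (le_max_right _ _)

theorem nonneg : 0 ≤ R := (sq_nonneg _).trans hR.diam_sq_le

theorem norm_sub_le {ξ η : EV n} (hξ : ξ ∈ Δ.body) (hη : η ∈ Δ.body) : ‖ξ - η‖ ≤ √R := by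
  rw [← dist_eq_norm]
  exact (Metric.dist_le_diam_of_mem Δ.isBounded_body hξ hη).trans (Real.le_sqrt_of_sq_le hR.diam_sq_le)

theorem norm_gradient_le {ξ : EV n} (hξ : ξ ∈ Δ.openBody) :
    ‖gradient (fun η => log (D η)) ξ‖ ≤ √R := by
  obtain ⟨Rg, Dm, -, h2, rfl⟩ := hR
  have h3 : gradientWithin (fun η => log (D η)) Δ.body ξ = gradient (fun η => log (D η)) ξ := by
    rw [gradientWithin, gradient, fderivWithin_of_mem_nhds (Δ.body_mem_nhds hξ)]
  have h4 : ‖gradient (fun η => log (D η)) ξ‖ ≤ Dm := by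
    rw [← h3]
    exact h2.2 ⟨ξ, Δ.openBody_subset hξ, rfl⟩
  exact h4.trans (Real.le_sqrt_of_sq_le ((le_max_left _ _).trans (le_max_right _ _)))

theorem abs_fderiv_le {ξ : EV n} (hξ : ξ ∈ Δ.openBody) (v : EV n) :
    |fderiv ℝ (fun η => log (D η)) ξ v| ≤ √R * ‖v‖ := by
  rw [fderiv_eq_inner_gradient]
  exact (abs_real_inner_le_norm _ _).trans
    (mul_le_mul_of_nonneg_right (hR.norm_gradient_le hξ) (norm_nonneg _))

end IsCurlyR

theorem interior_body_nonempty : (interior Δ.body).Nonempty := by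
  obtain ⟨ξ, h⟩ := Δ.interior_nonempty
  exact ⟨ξ, mem_interior_iff_mem_nhds.2 (Δ.body_mem_nhds h)⟩

/-- The function log D is smooth up to the boundary of a compact set. The bound is not uniform in
the data, but it only multiplies quantities that tend to 0 at the vertex. -/
theorem exists_abs_fderiv_fderiv_le (hD : ContDiffOn ℝ ∞ D Δ.body) (hD0 : ∀ ξ ∈ Δ.body, 0 < D ξ)
    (v w : EV n) : ∃ C, ∀ ξ ∈ Δ.openBody,
      |fderiv ℝ (fun ζ => fderiv ℝ (fun η => log (D η)) ζ v) ξ w| ≤ C := by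
  have hu : UniqueDiffOn ℝ Δ.body := uniqueDiffOn_convex Δ.convex_body interior_body_nonempty
  have h1 : ContDiffOn ℝ ∞ (fun η => log (D η)) Δ.body := hD.log fun ξ hξ => (hD0 ξ hξ).ne'
  have h2 : ContDiffOn ℝ ∞ (fun ζ => fderivWithin ℝ (fun η => log (D η)) Δ.body ζ v) Δ.body :=
    (h1.fderivWithin hu le_rfl).clm_apply contDiffOn_const
  have h3 : ContDiffOn ℝ ∞ (fun ξ => fderivWithin ℝ
      (fun ζ => fderivWithin ℝ (fun η => log (D η)) Δ.body ζ v) Δ.body ξ w) Δ.body :=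
    (h2.fderivWithin hu le_rfl).clm_apply contDiffOn_const
  obtain ⟨C, hC⟩ := Δ.isCompact_body.exists_bound_of_continuousOn h3.continuousOn
  refine ⟨C, fun ξ hξ => ?_⟩
  have h4 : (fun ζ => fderivWithin ℝ (fun η => log (D η)) Δ.body ζ v) =ᶠ[𝓝 ξ]
      fun ζ => fderiv ℝ (fun η => log (D η)) ζ v := by
    filter_upwards [Δ.isOpen_openBody.mem_nhds hξ] with η hη
    rw [fderivWithin_of_mem_nhds (Δ.body_mem_nhds hη)]
  rw [← h4.fderiv_eq, ← fderivWithin_of_mem_nhds (Δ.body_mem_nhds hξ)]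
  simpa using hC ξ (Δ.openBody_subset hξ)

/-! ### The Hessian of the symplectic potential in a frame -/

variable (Δ)

/-- The part of the Hessian of the symplectic potential, in the frame `e`, which comes from the
facets not listed in `b`. -/
def hOut (b : Fin n → Fin Δ.d) (e : Fin n → EV n) (ξ : EV n) : Matrix (Fin n) (Fin n) ℝ :=
  Matrix.of fun i j =>
    ∑ k ∈ Δ.out b, inner ℝ (Δ.nu k) (e i) * inner ℝ (Δ.nu k) (e j) / Δ.l k ξ

/-- The diagonal matrix of affine coordinates. -/
def diagL (b : Fin n → Fin Δ.d) (ξ : EV n) : Matrix (Fin n) (Fin n) ℝ :=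
  Matrix.diagonal fun i => Δ.l (b i) ξ

/-- The smooth part of `log det (g_{ij})` at a vertex. -/
def kap (b : Fin n → Fin Δ.d) (e : Fin n → EV n) (ξ : EV n) : ℝ :=
  -log (1 + Δ.hOut b e ξ * Δ.diagL b ξ).det

variable {Δ}

namespace Frame

variable {b : Fin n → Fin Δ.d} {p : EV n} {e : Fin n → EV n} (F : Δ.Frame b p e)
include F

theorem transpose_mul_hessU_mul (ξ : EV n) :
    (Matrix.of fun a j => e j a)ᵀ * Δ.hessU ξ * (Matrix.of fun a j => e j a)
      = Matrix.diagonal (fun i => (Δ.l (b i) ξ)⁻¹) + Δ.hOut b e ξ := by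
  ext i j
  have h1 : ((Matrix.of fun a j => e j a)ᵀ * Δ.hessU ξ * (Matrix.of fun a j => e j a)) i j
      = ∑ k, inner ℝ (Δ.nu k) (e i) * inner ℝ (Δ.nu k) (e j) / Δ.l k ξ := by
    simp only [Matrix.mul_apply, Matrix.transpose_apply, Matrix.of_apply, hessU, inner_eq_sum,
      Finset.sum_mul, Finset.mul_sum, Finset.sum_div]
    rw [Finset.sum_congr rfl fun c _ => Finset.sum_comm]
    rw [Finset.sum_comm]
    refine Finset.sum_congr rfl fun k _ => ?_
    refine Finset.sum_congr rfl fun c _ => Finset.sum_congr rfl fun a _ => ?_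
    ring
  rw [h1, Δ.sum_eq_sum_add_sum_out F.inj]
  simp only [F.dual, Matrix.add_apply, hOut, Matrix.of_apply, Matrix.diagonal_apply]
  congr 1
  by_cases hij : i = j
  · subst hij; simp [ite_div]
  · rw [if_neg hij]
    refine Finset.sum_eq_zero fun k _ => ?_
    by_cases h : k = i
    · subst h; simp [hij]
    · simp [h]

theorem hessU_eq (ξ : EV n) : Δ.hessU ξ = (Matrix.of fun i a => Δ.nu (b i) a)ᵀ
    * (Matrix.diagonal (fun i => (Δ.l (b i) ξ)⁻¹) + Δ.hOut b e ξ)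
    * (Matrix.of fun i a => Δ.nu (b i) a) := by
  rw [← F.transpose_mul_hessU_mul]
  have h1 := F.mul_eq_one'
  have h2 : (Matrix.of fun i a => Δ.nu (b i) a)ᵀ * (Matrix.of fun a j => e j a)ᵀ = 1 := by
    rw [← Matrix.transpose_mul, h1, Matrix.transpose_one]
  calc Δ.hessU ξ = ((Matrix.of fun i a => Δ.nu (b i) a)ᵀ * (Matrix.of fun a j => e j a)ᵀ) * Δ.hessU ξ
        * ((Matrix.of fun a j => e j a) * (Matrix.of fun i a => Δ.nu (b i) a)) := by
        rw [h1, h2]; simp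
    _ = _ := by simp only [Matrix.mul_assoc]

theorem hessU_inv_eq {ξ : EV n} {X : Matrix (Fin n) (Fin n) ℝ}
    (hX : (Matrix.diagonal (fun i => (Δ.l (b i) ξ)⁻¹) + Δ.hOut b e ξ) * X = 1) :
    (Δ.hessU ξ)⁻¹ = (Matrix.of fun a j => e j a) * X * (Matrix.of fun a j => e j a)ᵀ := by
  refine Matrix.inv_eq_right_inv ?_
  rw [F.hessU_eq]
  set B := Matrix.of fun i a => Δ.nu (b i) a
  set A : Matrix (Fin n) (Fin n) ℝ := Matrix.of fun a j => e j a
  have h1 : B * A = 1 := F.mul_eq_one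
  have h2 : Bᵀ * Aᵀ = 1 := by rw [← Matrix.transpose_mul, F.mul_eq_one', Matrix.transpose_one]
  calc Bᵀ * (Matrix.diagonal (fun i => (Δ.l (b i) ξ)⁻¹) + Δ.hOut b e ξ) * B * (A * X * Aᵀ)
      = Bᵀ * ((Matrix.diagonal (fun i => (Δ.l (b i) ξ)⁻¹) + Δ.hOut b e ξ) * ((B * A) * X)) * Aᵀ := by
        simp only [Matrix.mul_assoc]
    _ = 1 := by rw [h1, one_mul, hX, mul_one, h2]

theorem det_hessU (ξ : EV n) :
    (Δ.hessU ξ).det = (Matrix.diagonal (fun i => (Δ.l (b i) ξ)⁻¹) + Δ.hOut b e ξ).det := by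
  rw [F.hessU_eq, Matrix.det_mul, Matrix.det_mul, Matrix.det_transpose]
  linear_combination (Matrix.diagonal (fun i => (Δ.l (b i) ξ)⁻¹) + Δ.hOut b e ξ).det * F.det_mul_self

/-- The product of the facet functions through the vertex cancels the poles of the Hessian. What
remains is smooth at the vertex and equals 1 there, so its logarithm `kap` is the smooth part of log
det(g_ij), up to sign. -/
theorem det_hessU_mul_prod {ξ : EV n} (hξ : ∀ i, 0 < Δ.l (b i) ξ) :
    (Δ.hessU ξ).det * ∏ i, Δ.l (b i) ξ = (1 + Δ.hOut b e ξ * Δ.diagL b ξ).det := by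
  rw [F.det_hessU, ← Matrix.det_diagonal, ← Matrix.det_mul, add_mul, Matrix.diagonal_mul_diagonal]
  congr 2
  rw [← Matrix.diagonal_one]
  congr 1
  funext i
  exact inv_mul_cancel₀ (hξ i).ne'

theorem det_one_add_ne_zero {ξ : EV n} (hξ : ξ ∈ Δ.openBody) :
    (1 + Δ.hOut b e ξ * Δ.diagL b ξ).det ≠ 0 := by
  rw [← F.det_hessU_mul_prod fun i => hξ (b i)]
  exact mul_ne_zero (Δ.det_hessU_ne_zero hξ) (Finset.prod_ne_zero_iff.2 fun i _ => (hξ (b i)).ne')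

theorem rU_eq {ξ : EV n} (hξ : ξ ∈ Δ.openBody) :
    Δ.rU ξ = ∑ i, log (Δ.l (b i) ξ) + Δ.kap b e ξ := by
  rw [kap, ← F.det_hessU_mul_prod fun i => hξ (b i), Real.log_mul (Δ.det_hessU_ne_zero hξ)
    (Finset.prod_ne_zero_iff.2 fun i _ => (hξ (b i)).ne'), Real.log_prod fun i _ => (hξ (b i)).ne',
    rU]
  ring

omit F in
theorem contDiffAt_hOut {ξ : EV n} (hξ : ∀ k ∈ Δ.out b, 0 < Δ.l k ξ) (i j : Fin n) :
    ContDiffAt ℝ ∞ (fun ξ => Δ.hOut b e ξ i j) ξ := by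
  simp only [hOut, Matrix.of_apply]
  exact ContDiffAt.sum fun k hk => contDiffAt_const.div (Δ.contDiff_l k).contDiffAt (hξ k hk).ne'

omit F in
theorem contDiffAt_one_add {ξ : EV n} (hξ : ∀ k ∈ Δ.out b, 0 < Δ.l k ξ) (i j : Fin n) :
    ContDiffAt ℝ ∞ (fun ξ => (1 + Δ.hOut b e ξ * Δ.diagL b ξ) i j) ξ := by
  simp only [Matrix.add_apply, diagL, Matrix.mul_diagonal]
  exact contDiffAt_const.add ((contDiffAt_hOut hξ i j).mul (Δ.contDiff_l (b j)).contDiffAt)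

omit F in
theorem contDiffAt_kap {ξ : EV n} (hξ : ∀ k ∈ Δ.out b, 0 < Δ.l k ξ)
    (h : (1 + Δ.hOut b e ξ * Δ.diagL b ξ).det ≠ 0) : ContDiffAt ℝ ∞ (Δ.kap b e) ξ :=
  ((contDiffAt_det fun i j => contDiffAt_one_add hξ i j).log h).neg

theorem one_add_at_vertex : 1 + Δ.hOut b e p * Δ.diagL b p = 1 := by
  have : Δ.diagL b p = 0 := by
    ext i j; simp [diagL, Matrix.diagonal_apply, F.zero]
  rw [this, mul_zero, add_zero]

theorem contDiffAt_kap_vertex : ContDiffAt ℝ ∞ (Δ.kap b e) p :=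
  contDiffAt_kap (fun _ hk => F.pos_of_mem_out hk) (by rw [F.one_add_at_vertex]; simp)

theorem fderiv_l_b (i j : Fin n) (ξ : EV n) :
    fderiv ℝ (Δ.l (b i)) ξ (e j) = if i = j then 1 else 0 := by
  rw [fderiv_eq_sum_pd, ← F.dual, inner_eq_sum]
  exact Finset.sum_congr rfl fun a _ => by rw [pd_l]; ring

/-- At the vertex the matrix is the identity, so the derivative of log det is a trace; all l_{b j}
vanish there, and along e_i only l_{b i} varies. -/
theorem fderiv_kap_vertex (i : Fin n) : fderiv ℝ (Δ.kap b e) p (e i) = - Δ.hOut b e p i i := by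
  have hp : ∀ k ∈ Δ.out b, 0 < Δ.l k p := fun _ hk => F.pos_of_mem_out hk
  have h1 : fderiv ℝ (Δ.kap b e) p (e i)
      = - fderiv ℝ (fun ξ => log (1 + Δ.hOut b e ξ * Δ.diagL b ξ).det) p (e i) := by
    unfold kap
    rw [fderiv_fun_neg]; rfl
  rw [h1, fderiv_log_det (fun a c => contDiffAt_one_add hp a c)
    (by rw [F.one_add_at_vertex]; simp), F.one_add_at_vertex, inv_one]
  congr 1
  have h2 : ∀ a, fderiv ℝ (fun ξ => (1 + Δ.hOut b e ξ * Δ.diagL b ξ) a a) p (e i)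
      = if a = i then Δ.hOut b e p a a else 0 := by
    intro a
    simp only [Matrix.add_apply, diagL, Matrix.mul_diagonal]
    rw [fderiv_const_add, fderiv_fun_mul ((contDiffAt_hOut hp a a).differentiableAt (by simp))
      ((Δ.contDiff_l (b a)).differentiable (by simp) _)]
    simp [F.fderiv_l_b, F.zero]
  simp only [Matrix.one_apply, ite_mul, one_mul, zero_mul, Finset.sum_ite_eq, Finset.mem_univ,
    if_true, h2, Finset.sum_ite_eq']

theorem fderiv_rU {ξ : EV n} (hξ : ξ ∈ Δ.openBody) (j : Fin n) :
    fderiv ℝ Δ.rU ξ (e j) = 1 / Δ.l (b j) ξ + fderiv ℝ (Δ.kap b e) ξ (e j) := by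
  have h1 : Δ.rU =ᶠ[𝓝 ξ] fun ξ => ∑ i, log (Δ.l (b i) ξ) + Δ.kap b e ξ := by
    filter_upwards [Δ.isOpen_openBody.mem_nhds hξ] with η hη using F.rU_eq hη
  have h2 : ∀ i, HasFDerivAt (fun ξ => log (Δ.l (b i) ξ))
      ((Δ.l (b i) ξ)⁻¹ • fderiv ℝ (Δ.l (b i)) ξ) ξ := fun i =>
    (((Δ.contDiff_l (b i)).differentiable (by simp)) _).hasFDerivAt.log (hξ (b i)).ne'
  have h3 := ((contDiffAt_kap (b := b) (e := e) (fun k _ => hξ k)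
    (F.det_one_add_ne_zero hξ)).differentiableAt (by simp)).hasFDerivAt
  have h4 := (HasFDerivAt.fun_sum (u := Finset.univ) fun i _ => h2 i).add h3
  have h5 : HasFDerivAt (fun ξ => ∑ i, log (Δ.l (b i) ξ) + Δ.kap b e ξ) _ ξ := h4
  rw [h1.fderiv_eq, h5.fderiv]
  simp [F.fderiv_l_b]

theorem fderiv_fderiv_rU {ξ : EV n} (hξ : ξ ∈ Δ.openBody) (i j : Fin n) :
    fderiv ℝ (fun ζ => fderiv ℝ Δ.rU ζ (e j)) ξ (e i)
      = -(if i = j then 1 / Δ.l (b j) ξ ^ 2 else 0)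
        + fderiv ℝ (fun ζ => fderiv ℝ (Δ.kap b e) ζ (e j)) ξ (e i) := by
  have h1 : (fun ζ => fderiv ℝ Δ.rU ζ (e j)) =ᶠ[𝓝 ξ]
      fun ζ => (Δ.l (b j) ζ)⁻¹ + fderiv ℝ (Δ.kap b e) ζ (e j) := by
    filter_upwards [Δ.isOpen_openBody.mem_nhds hξ] with η hη
    rw [F.fderiv_rU hη, one_div]
  have h2 : HasFDerivAt (fun ζ => (Δ.l (b j) ζ)⁻¹)
      ((-(Δ.l (b j) ξ ^ 2)⁻¹) • fderiv ℝ (Δ.l (b j)) ξ) ξ :=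
    (hasDerivAt_inv (hξ (b j)).ne').comp_hasFDerivAt ξ
      (((Δ.contDiff_l (b j)).differentiable (by simp)) _).hasFDerivAt
  have h3 := ((((contDiffAt_kap (b := b) (e := e) (fun k _ => hξ k)
    (F.det_one_add_ne_zero hξ)).fderiv_right (m := ∞) le_rfl).clm_apply
      (contDiffAt_const (c := e j))).differentiableAt (by simp)).hasFDerivAt
  have h5 : HasFDerivAt (fun ζ => (Δ.l (b j) ζ)⁻¹ + fderiv ℝ (Δ.kap b e) ζ (e j)) _ ξ := h2.add h3
  rw [h1.fderiv_eq, h5.fderiv]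
  simp only [_root_.add_apply, FunLike.coe_smul, Pi.smul_apply, smul_eq_mul, F.fderiv_l_b]
  congr 1
  by_cases hij : i = j
  · subst hij; simp
  · simp [hij, Ne.symm hij]

end Frame

theorem sum_conj_mul (e : Fin n → EV n) (X : Matrix (Fin n) (Fin n) ℝ) (Q : Fin n → Fin n → ℝ)
    (u w : Fin n → ℝ) :
    ∑ a, ∑ c, ((Matrix.of fun a j => e j a) * X * (Matrix.of fun a j => e j a)ᵀ) a c
        * (Q c a + u a * w c)
      = ∑ i, ∑ j, X i j * (∑ c, ∑ a, e j c * e i a * Q c a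
        + (∑ a, e i a * u a) * ∑ c, e j c * w c) := by
  have hL : ∀ a c, ((Matrix.of fun a j => e j a) * X * (Matrix.of fun a j => e j a)ᵀ) a c
      = ∑ i, ∑ j, e i a * X i j * e j c := by
    intro a c
    simp only [Matrix.mul_apply, Matrix.transpose_apply, Matrix.of_apply, Finset.sum_mul]
    rw [Finset.sum_comm]
  calc _ = ∑ a, ∑ c, ∑ i, ∑ j, e i a * X i j * e j c * (Q c a + u a * w c) := by
        simp only [hL, Finset.sum_mul]
    _ = ∑ i, ∑ j, ∑ c, ∑ a, e i a * X i j * e j c * (Q c a + u a * w c) := by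
        rw [Finset.sum_congr rfl fun a _ => Finset.sum_comm, Finset.sum_comm]
        refine Finset.sum_congr rfl fun i _ => ?_
        rw [Finset.sum_congr rfl fun a _ => Finset.sum_comm, Finset.sum_comm]
        exact Finset.sum_congr rfl fun j _ => Finset.sum_comm
    _ = _ := by
        refine Finset.sum_congr rfl fun i _ => Finset.sum_congr rfl fun j _ => ?_
        rw [Finset.sum_mul_sum, Finset.sum_comm (f := fun a c => e i a * u a * (e j c * w c)),
          ← Finset.sum_add_distrib, Finset.mul_sum]
        refine Finset.sum_congr rfl fun c _ => ?_
        rw [← Finset.sum_add_distrib, Finset.mul_sum]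
        exact Finset.sum_congr rfl fun a _ => by ring

end DelzantPolytope

theorem fderiv_fderiv_apply_eq_sum {n : ℕ} {F : EV n → ℝ} {x : EV n} (h : ContDiffAt ℝ ∞ F x)
    (v w : EV n) : fderiv ℝ (fun y => fderiv ℝ F y w) x v
      = ∑ i, ∑ j, v i * w j * pd i (pd j F) x := by
  rw [← fderiv_fderiv_eq_sum h, fderiv_clm_apply
    ((h.fderiv_right (m := ∞) le_rfl).differentiableAt (by simp)) (differentiableAt_const _)]
  simp

/-! ### Uniform bounds on the polytope in terms of n and R. -/

namespace DelzantPolytope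

open Matrix

variable {n : ℕ} {Δ : DelzantPolytope n} {D : EV n → ℝ} {R : ℝ}

namespace Frame

variable {b : Fin n → Fin Δ.d} {p : EV n} {e : Fin n → EV n} (F : Δ.Frame b p e)
include F

/-- The restriction that `𝓡` imposes on the polytope at a vertex: the limit of the quantity
defining `R_g`. -/
theorem vertex_bound_aux (hD : ContDiffOn ℝ ∞ D Δ.body) (hD0 : ∀ ξ ∈ Δ.body, 0 < D ξ)
    (hR : Δ.IsCurlyR D R) :
    (Δ.hOut b e p).trace + ∑ i, ∑ j, Δ.hOut b e p i j + ‖∑ i, e i‖ ^ 2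
      ≤ R + √R * ‖∑ i, e i‖ := by
  -- Approaching p along the diagonal makes all facet functions through p equal to s, so the Hessian
  -- in the frame is s⁻¹(1 + sH), with inverse s(1 + sH)⁻¹.
  let ξ : ℝ → EV n := fun s => pt p e fun _ => s
  have hξc : Continuous ξ := (continuous_pt p e).comp (by fun_prop)
  have hξ0 : ξ 0 = p := by simp [ξ, pt]
  have hξt : Filter.Tendsto ξ (𝓝[>] 0) (𝓝 p) := by
    have := hξc.tendsto 0
    rw [hξ0] at this
    exact this.mono_left nhdsWithin_le_nhds
  have hpos : ∀ᶠ s in 𝓝[>] (0 : ℝ), 0 < s := self_mem_nhdsWithin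
  have hlb : ∀ s i, Δ.l (b i) (ξ s) = s := fun s i => F.l_b_pt i _
  have hopen : ∀ᶠ s in 𝓝[>] (0 : ℝ), ξ s ∈ Δ.openBody := by
    have h1 : ∀ᶠ s in 𝓝[>] (0 : ℝ), ∀ k ∈ Δ.out b, 0 < Δ.l k (ξ s) := by
      rw [Filter.eventually_all_finset]
      intro k hk
      exact ((Δ.continuous_l k).continuousAt.tendsto.comp hξt).eventually
        (lt_mem_nhds (F.pos_of_mem_out hk))
    filter_upwards [h1, hpos] with s h2 h3 k
    by_cases hk : k ∈ Set.range b
    · obtain ⟨i, rfl⟩ := hk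
      rw [hlb]; exact h3
    · exact h2 k (Δ.mem_out.2 hk)
  have hp : ∀ k ∈ Δ.out b, 0 < Δ.l k p := fun _ hk => F.pos_of_mem_out hk
  have hkap := F.contDiffAt_kap_vertex
  choose C hC using fun i j => exists_abs_fderiv_fderiv_le hD hD0 (e i) (e j)
  have hdet := (tendsto_inv_one_add_smul (H := fun s => Δ.hOut b e (ξ s)) (H0 := Δ.hOut b e p)
    fun i j => ((contDiffAt_hOut hp i j).continuousAt.tendsto.comp hξt)).2
  have hX : ∀ᶠ s in 𝓝[>] (0 : ℝ), (Δ.hessU (ξ s))⁻¹ = (Matrix.of fun a j => e j a)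
      * (s • (1 + s • Δ.hOut b e (ξ s))⁻¹) * (Matrix.of fun a j => e j a)ᵀ := by
    filter_upwards [hdet, hpos] with s h1 h2
    refine F.hessU_inv_eq ?_
    simp only [hlb]
    rw [show (Matrix.diagonal fun _ : Fin n => s⁻¹) = s⁻¹ • (1 : Matrix (Fin n) (Fin n) ℝ) by
      rw [Matrix.smul_one_eq_diagonal]]
    have h3 : (s⁻¹ • (1 : Matrix (Fin n) (Fin n) ℝ) + Δ.hOut b e (ξ s))
        * (s • (1 + s • Δ.hOut b e (ξ s))⁻¹)
        = (1 + s • Δ.hOut b e (ξ s)) * (1 + s • Δ.hOut b e (ξ s))⁻¹ := by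
      rw [mul_smul_comm, ← smul_mul_assoc, smul_add, smul_smul, mul_inv_cancel₀ h2.ne', one_smul]
    rw [h3]
    exact Matrix.mul_nonsing_inv _ (Ne.isUnit h1)
  have hq1 : ∀ η ∈ Δ.openBody, ∀ i, fderiv ℝ (Δ.qU D) η (e i)
      = fderiv ℝ (fun η => log (D η)) η (e i) + fderiv ℝ Δ.rU η (e i) := by
    intro η hη i
    unfold qU
    rw [fderiv_fun_add ((contDiffAt_log_D hD hD0 hη).differentiableAt (by simp))
      ((Δ.contDiffAt_rU hη).differentiableAt (by simp))]
    rfl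
  have hq2 : ∀ η ∈ Δ.openBody, ∀ i j, fderiv ℝ (fun ζ => fderiv ℝ (Δ.qU D) ζ (e j)) η (e i)
      = fderiv ℝ (fun ζ => fderiv ℝ (fun η => log (D η)) ζ (e j)) η (e i)
        + fderiv ℝ (fun ζ => fderiv ℝ Δ.rU ζ (e j)) η (e i) := by
    intro η hη i j
    have h1 : (fun ζ => fderiv ℝ (Δ.qU D) ζ (e j)) =ᶠ[𝓝 η] fun ζ =>
        fderiv ℝ (fun η => log (D η)) ζ (e j) + fderiv ℝ Δ.rU ζ (e j) := by
      filter_upwards [Δ.isOpen_openBody.mem_nhds hη] with ζ hζ using hq1 ζ hζ j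
    rw [h1.fderiv_eq, fderiv_fun_add]
    · rfl
    · exact (((contDiffAt_log_D hD hD0 hη).fderiv_right (m := ∞) le_rfl).clm_apply
        contDiffAt_const).differentiableAt (by simp)
    · exact (((Δ.contDiffAt_rU hη).fderiv_right (m := ∞) le_rfl).clm_apply
        contDiffAt_const).differentiableAt (by simp)
  refine vertex_limit (e := e) (H := fun s => Δ.hOut b e (ξ s)) (H0 := Δ.hOut b e p)
    (K1 := fun s i => fderiv ℝ (Δ.kap b e) (ξ s) (e i))
    (K10 := fun i => fderiv ℝ (Δ.kap b e) p (e i))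
    (K2 := fun s => Matrix.of fun i j =>
      fderiv ℝ (fun ζ => fderiv ℝ (Δ.kap b e) ζ (e j)) (ξ s) (e i))
    (K20 := Matrix.of fun i j => fderiv ℝ (fun ζ => fderiv ℝ (Δ.kap b e) ζ (e j)) p (e i))
    (E1 := fun s i => fderiv ℝ (fun η => log (D η)) (ξ s) (e i))
    (E2 := fun s => Matrix.of fun i j =>
      fderiv ℝ (fun ζ => fderiv ℝ (fun η => log (D η)) ζ (e j)) (ξ s) (e i))
    (V := fun s => WithLp.toLp 2 fun i => ∑ a, (Δ.hessU (ξ s))⁻¹ i a * pd a (Δ.qU D) (ξ s))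
    (T := fun s => ∑ a, ∑ c, (Δ.hessU (ξ s))⁻¹ a c * (pd c (pd a (Δ.qU D)) (ξ s)
        + pd a (Δ.qU D) (ξ s) * pd c Δ.rU (ξ s)))
    (C := ∑ i, √R * ‖e i‖ + ∑ i, ∑ j, |C i j|)
    ?_ ?_ ?_ F.fderiv_kap_vertex ?_ ?_ ?_ ?_ ?_ ?_
  · exact fun i j => (contDiffAt_hOut hp i j).continuousAt.tendsto.comp hξt
  · intro i
    have h1 : ContDiffAt ℝ ∞ (fun ζ => fderiv ℝ (Δ.kap b e) ζ (e i)) p :=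
      (hkap.fderiv_right (m := ∞) le_rfl).clm_apply contDiffAt_const
    exact h1.continuousAt.tendsto.comp hξt
  · intro i j
    have h1 : ContDiffAt ℝ ∞ (fun ζ => fderiv ℝ (Δ.kap b e) ζ (e j)) p :=
      (hkap.fderiv_right (m := ∞) le_rfl).clm_apply contDiffAt_const
    have h2 : ContDiffAt ℝ ∞ (fun η => fderiv ℝ (fun ζ => fderiv ℝ (Δ.kap b e) ζ (e j)) η (e i)) p :=
      (h1.fderiv_right (m := ∞) le_rfl).clm_apply contDiffAt_const
    exact h2.continuousAt.tendsto.comp hξt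
  · filter_upwards [hopen] with s hs i
    have h1 := hR.abs_fderiv_le hs (e i)
    have h2 := Finset.single_le_sum (f := fun i => √R * ‖e i‖) (fun i _ => by positivity)
      (Finset.mem_univ i)
    have h3 : 0 ≤ ∑ i, ∑ j, |C i j| := by positivity
    linarith
  · filter_upwards [hopen] with s hs i j
    have h1 := (hC j i _ hs).trans (le_abs_self _)
    have h2 := Finset.single_le_sum (f := fun j => ∑ i, |C j i|) (fun i _ => by positivity)
      (Finset.mem_univ j)
    have h3 := Finset.single_le_sum (f := fun i => |C j i|) (fun i _ => by positivity)
      (Finset.mem_univ i)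
    have h4 : 0 ≤ ∑ i, √R * ‖e i‖ := by positivity
    simp only [Matrix.of_apply] at h2 h3 ⊢
    linarith
  · filter_upwards [hopen] with s hs
    have h1 := (le_abs_self _).trans (hR.abs_fderiv_le hs (∑ i, e i))
    simpa using h1
  · filter_upwards [hopen, hX] with s hs h1
    rw [h1, sum_conj_mul e _ (fun c a => pd c (pd a (Δ.qU D)) (ξ s)) (fun a => pd a (Δ.qU D) (ξ s))
      fun c => pd c Δ.rU (ξ s)]
    refine Finset.sum_congr rfl fun i _ => Finset.sum_congr rfl fun j _ => ?_
    rw [← fderiv_fderiv_apply_eq_sum (contDiffAt_qU hD hD0 hs), ← fderiv_eq_sum_pd,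
      ← fderiv_eq_sum_pd, hq2 _ hs, hq1 _ hs, F.fderiv_fderiv_rU hs, F.fderiv_rU hs, F.fderiv_rU hs,
      hlb, hlb]
    simp only [Matrix.smul_apply, smul_eq_mul, Matrix.of_apply]
    ring
  · filter_upwards [hopen, hX] with s hs h1
    ext a
    simp only [h1, WithLp.ofLp_sum, Finset.sum_apply, PiLp.smul_apply, smul_eq_mul]
    have h2 : ∀ i, ∑ j, s * (1 + s • Δ.hOut b e (ξ s))⁻¹ i j
        * (1 / s + fderiv ℝ (Δ.kap b e) (ξ s) (e j) + fderiv ℝ (fun η => log (D η)) (ξ s) (e j))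
        = ∑ j, s * (1 + s • Δ.hOut b e (ξ s))⁻¹ i j * ∑ c, e j c * pd c (Δ.qU D) (ξ s) := by
      intro i
      refine Finset.sum_congr rfl fun j _ => ?_
      rw [← fderiv_eq_sum_pd, hq1 _ hs, F.fderiv_rU hs, hlb]
      ring
    simp only [h2]
    simp only [Matrix.mul_apply, Matrix.smul_apply, smul_eq_mul, Matrix.of_apply,
      Matrix.transpose_apply, Finset.sum_mul, Finset.mul_sum]
    rw [Finset.sum_congr rfl fun c _ => Finset.sum_comm, Finset.sum_comm]
    refine Finset.sum_congr rfl fun i _ => ?_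
    rw [Finset.sum_comm]
    exact Finset.sum_congr rfl fun j _ => Finset.sum_congr rfl fun c _ => by ring
  · filter_upwards [hopen] with s hs
    have h1 := hR.RgFun_le (Δ.gradU (ξ s))
    rw [RgFun_gradU hD hD0 hs] at h1
    refine le_trans (le_of_eq ?_) h1
    congr 1
    rw [EuclideanSpace.norm_sq_eq]
    simp

/-- With t = ‖∑ e_i‖, the limit inequality has √R t - t² to spare, and this is at most R/4. This is
the origin of the factor 5/4. -/
theorem vertex_bound (hD : ContDiffOn ℝ ∞ D Δ.body) (hD0 : ∀ ξ ∈ Δ.body, 0 < D ξ)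
    (hR : Δ.IsCurlyR D R) :
    ∑ k ∈ Δ.out b, (∑ i, inner ℝ (Δ.nu k) (e i) ^ 2 + (∑ i, inner ℝ (Δ.nu k) (e i)) ^ 2) / Δ.l k p
      ≤ 5 / 4 * R := by
  have h1 := F.vertex_bound_aux hD hD0 hR
  have h2 : (Δ.hOut b e p).trace + ∑ i, ∑ j, Δ.hOut b e p i j
      = ∑ k ∈ Δ.out b, (∑ i, inner ℝ (Δ.nu k) (e i) ^ 2 + (∑ i, inner ℝ (Δ.nu k) (e i)) ^ 2)
        / Δ.l k p := by
    have e1 : (Δ.hOut b e p).trace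
        = ∑ k ∈ Δ.out b, (∑ i, inner ℝ (Δ.nu k) (e i) ^ 2) / Δ.l k p := by
      simp only [Matrix.trace, Matrix.diag_apply, hOut, Matrix.of_apply, Finset.sum_div]
      rw [Finset.sum_comm]
      exact Finset.sum_congr rfl fun k _ => Finset.sum_congr rfl fun i _ => by rw [sq]
    have e2 : ∑ i, ∑ j, Δ.hOut b e p i j
        = ∑ k ∈ Δ.out b, (∑ i, inner ℝ (Δ.nu k) (e i)) ^ 2 / Δ.l k p := by
      simp only [hOut, Matrix.of_apply, sq, Finset.sum_mul_sum, Finset.sum_div]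
      rw [Finset.sum_congr rfl fun i _ => Finset.sum_comm, Finset.sum_comm]
    rw [e1, e2, ← Finset.sum_add_distrib]
    exact Finset.sum_congr rfl fun k _ => by rw [add_div]
  rw [h2] at h1
  have h3 := Real.sq_sqrt hR.nonneg
  nlinarith [sq_nonneg (‖∑ i, e i‖ - √R / 2)]

/-- Dropping the nonnegative Hessian terms leaves t² ≤ R + √R t for t = ‖∑ e_i‖. -/
theorem norm_sum_e_le (hD : ContDiffOn ℝ ∞ D Δ.body) (hD0 : ∀ ξ ∈ Δ.body, 0 < D ξ)
    (hR : Δ.IsCurlyR D R) : ‖∑ i, e i‖ ≤ 2 * √R := by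
  have h1 := F.vertex_bound_aux hD hD0 hR
  have h2 : 0 ≤ (Δ.hOut b e p).trace := by
    simp only [Matrix.trace, Matrix.diag_apply, hOut, Matrix.of_apply]
    exact Finset.sum_nonneg fun i _ => Finset.sum_nonneg fun k hk =>
      div_nonneg (mul_self_nonneg _) (F.pos_of_mem_out hk).le
  have h4 : 0 ≤ ∑ i, ∑ j, Δ.hOut b e p i j := by
    have e2 : ∑ i, ∑ j, Δ.hOut b e p i j
        = ∑ k ∈ Δ.out b, (∑ i, inner ℝ (Δ.nu k) (e i)) ^ 2 / Δ.l k p := by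
      simp only [hOut, Matrix.of_apply, sq, Finset.sum_mul_sum, Finset.sum_div]
      rw [Finset.sum_congr rfl fun i _ => Finset.sum_comm, Finset.sum_comm]
    rw [e2]
    exact Finset.sum_nonneg fun k hk => div_nonneg (sq_nonneg _) (F.pos_of_mem_out hk).le
  have h3 := Real.sq_sqrt hR.nonneg
  have h5 := Real.sqrt_nonneg R
  by_contra! h
  nlinarith [norm_nonneg (∑ i, e i)]

theorem facet_bound (hD : ContDiffOn ℝ ∞ D Δ.body) (hD0 : ∀ ξ ∈ Δ.body, 0 < D ξ)
    (hR : Δ.IsCurlyR D R) {k : Fin Δ.d} (hk : k ∈ Δ.out b) :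
    ∑ i, inner ℝ (Δ.nu k) (e i) ^ 2 + (∑ i, inner ℝ (Δ.nu k) (e i)) ^ 2 ≤ 5 / 4 * R * Δ.l k p := by
  have h1 := F.vertex_bound hD hD0 hR
  have h2 := Finset.single_le_sum (f := fun k => (∑ i, inner ℝ (Δ.nu k) (e i) ^ 2
    + (∑ i, inner ℝ (Δ.nu k) (e i)) ^ 2) / Δ.l k p)
    (fun k hk => div_nonneg (by positivity) (F.pos_of_mem_out hk).le) hk
  have h3 := h2.trans h1
  rwa [div_le_iff₀ (F.pos_of_mem_out hk)] at h3

/-- A nonzero normal pairs with the lattice basis e in integers that are not all zero. -/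
theorem one_le_sum_sq (k : Fin Δ.d) : 1 ≤ ∑ i, (inner ℝ (Δ.nu k) (e i) : ℝ) ^ 2 := by
  choose m hm using F.inner_e_int k
  simp only [hm]
  have h1 : ∑ i, (m i : ℝ) ^ 2 = ((∑ i, m i ^ 2 : ℤ) : ℝ) := by push_cast; rfl
  rw [h1]
  have h2 : 0 < ∑ i, m i ^ 2 := by
    refine lt_of_le_of_ne (Finset.sum_nonneg fun i _ => sq_nonneg _) fun h => Δ.nu_ne_zero k ?_
    have h3 := (Finset.sum_eq_zero_iff_of_nonneg fun i _ => sq_nonneg (m i)).1 h.symm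
    rw [← F.sum_inner_smul_nu (Δ.nu k)]
    refine Finset.sum_eq_zero fun i hi => ?_
    have : m i = 0 := by simpa using h3 i hi
    rw [real_inner_comm, hm, this]; simp
  exact_mod_cast h2

/-- A facet that misses a vertex stays at least 1/((5/4)R) away from it, as measured by its facet
function. -/
theorem one_le_mul_l (hD : ContDiffOn ℝ ∞ D Δ.body) (hD0 : ∀ ξ ∈ Δ.body, 0 < D ξ)
    (hR : Δ.IsCurlyR D R) {k : Fin Δ.d} (hk : k ∈ Δ.out b) : 1 ≤ 5 / 4 * R * Δ.l k p := by
  have h1 := F.facet_bound hD hD0 hR hk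
  have h2 := F.one_le_sum_sq k
  nlinarith [sq_nonneg (∑ i, (inner ℝ (Δ.nu k) (e i) : ℝ))]

/-- The polytope `5/4 𝓡 Δ` lies inside the shape of the anticanonical polytope at each vertex. -/
theorem one_le_nef (hD : ContDiffOn ℝ ∞ D Δ.body) (hD0 : ∀ ξ ∈ Δ.body, 0 < D ξ)
    (hR : Δ.IsCurlyR D R) (k : Fin Δ.d) :
    1 ≤ 5 / 4 * R * Δ.l k p + inner ℝ (Δ.nu k) (∑ i, e i) := by
  by_cases hk : k ∈ Set.range b
  · obtain ⟨i, rfl⟩ := hk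
    rw [F.zero, inner_sum]
    simp [F.dual]
  · have h1 := F.facet_bound hD hD0 hR (Δ.mem_out.2 hk)
    have h2 := F.one_le_sum_sq k
    rw [inner_sum]
    choose m hm using F.inner_e_int k
    simp only [hm] at h1 h2 ⊢
    have h3 : ∑ i, (m i : ℝ) = ((∑ i, m i : ℤ) : ℝ) := by push_cast; rfl
    rw [h3] at h1 ⊢
    -- For an integer t one has t ≥ -t². Hence 1 ≤ ∑ m_i² ≤ (5/4)R l_k(p) - t² ≤ (5/4)R l_k(p) + t.
    have h4 : 0 ≤ (∑ i, m i) ^ 2 + ∑ i, m i := by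
      rcases le_or_gt 0 (∑ i, m i) with h | h
      · positivity
      · nlinarith
    have h5 : (0 : ℝ) ≤ ((∑ i, m i : ℤ) : ℝ) ^ 2 + ((∑ i, m i : ℤ) : ℝ) := by exact_mod_cast h4
    linarith

/-- Equality at the facets through p is what makes the comparison with log det(g_ij) two-sided near
p. -/
theorem nef_b (i : Fin n) : 5 / 4 * R * Δ.l (b i) p + inner ℝ (Δ.nu (b i)) (∑ j, e j) = 1 := by
  rw [F.zero, inner_sum]
  simp [F.dual]

theorem e_ne_zero (i : Fin n) : e i ≠ 0 := by
  intro h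
  have := F.dual i i
  rw [h] at this
  simp at this

/-- Along e_i the function l_k decreases at rate -m ≤ m² ≤ (5/4)R l_k(p), with m an integer, so it
cannot reach zero before s = 1/((5/4)R). Edges therefore have a definite lattice length, and the
diameter bound controls ‖e_i‖. -/
theorem add_smul_mem_body (hD : ContDiffOn ℝ ∞ D Δ.body) (hD0 : ∀ ξ ∈ Δ.body, 0 < D ξ)
    (hR : Δ.IsCurlyR D R) {s : ℝ} (hs : 0 ≤ s) (hsR : s * (5 / 4 * R) ≤ 1) (i : Fin n) :
    p + s • e i ∈ Δ.body := by
  intro k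
  rw [l_lineMap]
  by_cases hk : k ∈ Set.range b
  · obtain ⟨j, rfl⟩ := hk
    rw [F.zero, F.dual]
    split_ifs <;> simp [hs]
  · have h1 := F.facet_bound hD hD0 hR (Δ.mem_out.2 hk)
    have h0 := F.pos k hk
    obtain ⟨m, hm⟩ := F.inner_e_int k i
    have h2 := Finset.single_le_sum (f := fun i => (inner ℝ (Δ.nu k) (e i) : ℝ) ^ 2)
      (fun i _ => sq_nonneg _) (Finset.mem_univ i)
    rw [hm] at h2 ⊢
    have h3 : -(m : ℝ) ≤ (m : ℝ) ^ 2 := by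
      have : 0 ≤ m ^ 2 + m := by
        rcases le_or_gt 0 m with h | h
        · positivity
        · nlinarith
      have h5 : (0 : ℝ) ≤ (m : ℝ) ^ 2 + m := by exact_mod_cast this
      linarith
    have h4 : -(m : ℝ) ≤ 5 / 4 * R * Δ.l k p := by
      nlinarith [sq_nonneg (∑ i, (inner ℝ (Δ.nu k) (e i) : ℝ))]
    nlinarith [mul_le_mul_of_nonneg_left h4 hs, mul_le_mul_of_nonneg_right hsR h0.le]

theorem R_pos (hD : ContDiffOn ℝ ∞ D Δ.body) (hD0 : ∀ ξ ∈ Δ.body, 0 < D ξ)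
    (hR : Δ.IsCurlyR D R) (i : Fin n) : 0 < R := by
  refine lt_of_le_of_ne hR.nonneg fun h => ?_
  subst h
  have h1 := F.add_smul_mem_body hD hD0 hR zero_le_one (by simp) i
  have h2 := hR.norm_sub_le h1 F.mem
  simp only [one_smul, add_sub_cancel_left, Real.sqrt_zero] at h2
  exact F.e_ne_zero i (norm_le_zero_iff.1 h2)

theorem norm_e_le (hD : ContDiffOn ℝ ∞ D Δ.body) (hD0 : ∀ ξ ∈ Δ.body, 0 < D ξ)
    (hR : Δ.IsCurlyR D R) (i : Fin n) : ‖e i‖ ≤ 5 / 4 * R * √R := by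
  have h0 := F.R_pos hD hD0 hR i
  have h1 := F.add_smul_mem_body hD hD0 hR (s := (5 / 4 * R)⁻¹) (by positivity)
    (by rw [inv_mul_cancel₀ (by positivity)]) i
  have h2 := hR.norm_sub_le h1 F.mem
  rw [add_sub_cancel_left, norm_smul, Real.norm_of_nonneg (by positivity)] at h2
  rwa [inv_mul_le_iff₀ (by positivity)] at h2

end Frame

/-- A bound for the entries of the normals. -/
def normalBound (n : ℕ) (R : ℝ) : ℝ := n.factorial * (1 + 5 / 4 * R * √R) ^ n

/-- The normal matrix inverts the edge matrix, whose determinant is ±1, so its entries are cofactors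
of edge vectors up to sign; the Leibniz expansion bounds them. -/
theorem Frame.abs_nu_le {b : Fin n → Fin Δ.d} {p : EV n} {e : Fin n → EV n} (F : Δ.Frame b p e)
    (hD : ContDiffOn ℝ ∞ D Δ.body) (hD0 : ∀ ξ ∈ Δ.body, 0 < D ξ)
    (hR : Δ.IsCurlyR D R) (i a : Fin n) : |Δ.nu (b i) a| ≤ normalBound n R := by
  set A : Matrix (Fin n) (Fin n) ℝ := Matrix.of fun a j => e j a with hA
  set B : Matrix (Fin n) (Fin n) ℝ := Matrix.of fun i a => Δ.nu (b i) a with hB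
  have hBA : B * A = 1 := F.mul_eq_one
  have hdet : B.det ^ 2 = 1 := F.det_mul_self
  have h1 : B = B.det • A.adjugate := by
    have h2 : B.det * A.det = 1 := by rw [← Matrix.det_mul, hBA, Matrix.det_one]
    have h3 : A.adjugate = A.det • B := by
      calc A.adjugate = B * A * A.adjugate := by rw [hBA, one_mul]
        _ = A.det • B := by rw [Matrix.mul_assoc, Matrix.mul_adjugate, mul_smul_comm, mul_one]
    rw [h3, smul_smul, h2, one_smul]
  have h2 : Δ.nu (b i) a = B.det * A.adjugate i a := by
    have := congrFun (congrFun h1 i) a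
    rwa [Matrix.smul_apply, smul_eq_mul] at this
  have h3 : |B.det| = 1 := by
    rw [← sq_abs] at hdet
    nlinarith [abs_nonneg B.det]
  rw [h2, abs_mul, h3, one_mul, Matrix.adjugate_apply]
  have h5 : 0 ≤ 5 / 4 * R * √R := by have := hR.nonneg; positivity
  have h4 := Matrix.det_le (A := A.updateRow a (Pi.single i 1)) (abv := AbsoluteValue.abs)
    (x := 1 + 5 / 4 * R * √R) fun c d => by
      rw [Matrix.updateRow_apply]
      split_ifs
      · rw [Pi.single_apply]
        split_ifs <;> simp <;> linarith
      · have h6 := (PiLp.norm_apply_le (e d) c).trans (F.norm_e_le hD hD0 hR d)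
        rw [Real.norm_eq_abs] at h6
        simp only [AbsoluteValue.abs_apply, A, Matrix.of_apply]
        linarith
  simpa [normalBound] using h4

/-- A bound for the facet functions on the polytope. -/
def facetBound (n : ℕ) (R : ℝ) : ℝ := 1 + n * (normalBound n R * √R)

theorem one_le_facetBound (hR : 0 ≤ R) : 1 ≤ facetBound n R := by
  unfold facetBound normalBound
  have : 0 ≤ (n : ℝ) * (n.factorial * (1 + 5 / 4 * R * √R) ^ n * √R) := by positivity
  linarith

/-- Each facet contains a vertex, where `l k` vanishes, and the slope of `l k` is bounded through
the frame at that vertex. -/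
theorem l_le_facetBound (hD : ContDiffOn ℝ ∞ D Δ.body) (hD0 : ∀ ξ ∈ Δ.body, 0 < D ξ)
    (hR : Δ.IsCurlyR D R) (k : Fin Δ.d) {ξ : EV n} (hξ : ξ ∈ Δ.body) :
    Δ.l k ξ ≤ facetBound n R := by
  obtain ⟨b, p, e, F, i, rfl⟩ := Δ.exists_frame_facet k
  have h1 := Δ.l_sub_l (b i) ξ p
  rw [F.zero, sub_zero, inner_eq_sum] at h1
  have h2 : ∀ a, Δ.nu (b i) a * (ξ - p) a ≤ normalBound n R * √R := by
    intro a
    refine (le_abs_self _).trans ?_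
    rw [abs_mul]
    refine mul_le_mul (F.abs_nu_le hD hD0 hR i a) ?_ (abs_nonneg _)
      ((abs_nonneg _).trans (F.abs_nu_le hD hD0 hR i a))
    exact (PiLp.norm_apply_le (ξ - p) a).trans (hR.norm_sub_le hξ F.mem)
  have h3 := Finset.sum_le_sum fun a (_ : a ∈ Finset.univ) => h2 a
  simp only [Finset.sum_const, Finset.card_univ, Fintype.card_fin, nsmul_eq_mul] at h3
  rw [h1, facetBound]
  linarith

/-- Each facet missing the vertex contributes at least the reciprocal of `facetBound n R` to the sum
in `vertex_bound`. -/
theorem Frame.card_out_le {b : Fin n → Fin Δ.d} {p : EV n} {e : Fin n → EV n} (F : Δ.Frame b p e)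
    (hD : ContDiffOn ℝ ∞ D Δ.body) (hD0 : ∀ ξ ∈ Δ.body, 0 < D ξ) (hR : Δ.IsCurlyR D R) :
    ((Δ.out b).card : ℝ) ≤ 5 / 4 * R * facetBound n R := by
  have h1 := F.vertex_bound hD hD0 hR
  have h0 : 0 < facetBound n R := by linarith [one_le_facetBound (n := n) hR.nonneg]
  have h2 : ∑ k ∈ Δ.out b, (facetBound n R)⁻¹ ≤ ∑ k ∈ Δ.out b,
      (∑ i, inner ℝ (Δ.nu k) (e i) ^ 2 + (∑ i, inner ℝ (Δ.nu k) (e i)) ^ 2) / Δ.l k p := by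
    refine Finset.sum_le_sum fun k hk => ?_
    rw [inv_eq_one_div]
    have h3 := F.one_le_sum_sq k
    exact div_le_div₀ (by positivity)
      (by nlinarith [sq_nonneg (∑ i, (inner ℝ (Δ.nu k) (e i) : ℝ))]) (F.pos_of_mem_out hk)
      (l_le_facetBound hD hD0 hR k F.mem)
  rw [Finset.sum_const, nsmul_eq_mul, ← div_eq_mul_inv] at h2
  exact (div_le_iff₀ h0).1 (h2.trans h1)

end DelzantPolytope

/-! ### Determinants and traces of positive semidefinite matrices. -/

namespace Matrix

variable {ι : Type*} [Fintype ι] [DecidableEq ι]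

/-- This is the characteristic polynomial evaluated at -1. -/
theorem IsHermitian.det_one_add {S : Matrix ι ι ℝ} (hS : S.IsHermitian) :
    (1 + S).det = ∏ i, (1 + hS.eigenvalues i) := by
  have h1 := congrArg (Polynomial.eval (-1)) hS.charpoly_eq
  rw [eval_charpoly, Polynomial.eval_prod] at h1
  simp only [Polynomial.eval_sub, Polynomial.eval_X, Polynomial.eval_C] at h1
  have h2 : Matrix.scalar ι (-1 : ℝ) - S = -(1 + S) := by
    rw [map_neg, map_one, neg_add]; rfl
  rw [h2, det_neg] at h1
  have h3 : ∏ i, (-1 - hS.eigenvalues i) = (-1) ^ Fintype.card ι * ∏ i, (1 + hS.eigenvalues i) := by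
    rw [← Finset.card_univ, ← Finset.prod_const, ← Finset.prod_mul_distrib]
    exact Finset.prod_congr rfl fun i _ => by ring
  have h4 : ((-1 : ℝ) ^ Fintype.card ι) ≠ 0 := pow_ne_zero _ (by norm_num)
  refine mul_left_cancel₀ h4 (h1.trans ?_)
  exact h3

theorem PosSemidef.eigenvalues_le_trace {S : Matrix ι ι ℝ} (hS : S.PosSemidef) (i : ι) :
    hS.isHermitian.eigenvalues i ≤ S.trace := by
  have h := hS.isHermitian.trace_eq_sum_eigenvalues
  rw [h]
  exact Finset.single_le_sum (f := hS.isHermitian.eigenvalues)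
    (fun i _ => hS.eigenvalues_nonneg i) (Finset.mem_univ i)

theorem PosSemidef.one_le_det_one_add {S : Matrix ι ι ℝ} (hS : S.PosSemidef) :
    1 ≤ (1 + S).det := by
  rw [hS.isHermitian.det_one_add]
  exact Finset.one_le_prod fun i _ => by linarith [hS.eigenvalues_nonneg i]

theorem PosSemidef.det_one_add_le {S : Matrix ι ι ℝ} (hS : S.PosSemidef) :
    (1 + S).det ≤ (1 + S.trace) ^ Fintype.card ι := by
  rw [hS.isHermitian.det_one_add, ← Finset.card_univ, ← Finset.prod_const]
  exact Finset.prod_le_prod (fun i _ => by linarith [hS.eigenvalues_nonneg i])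
    fun i _ => by linarith [hS.eigenvalues_le_trace i]

theorem PosSemidef.det_le_trace_pow {S : Matrix ι ι ℝ} (hS : S.PosSemidef) :
    S.det ≤ S.trace ^ Fintype.card ι := by
  rw [hS.isHermitian.det_eq_prod_eigenvalues, ← Finset.card_univ, ← Finset.prod_const]
  exact Finset.prod_le_prod (fun i _ => hS.eigenvalues_nonneg i)
    fun i _ => hS.eigenvalues_le_trace i

open scoped MatrixOrder Matrix.Norms.L2Operator in
theorem PosSemidef.exists_mul_conjTranspose_self {S : Matrix ι ι ℝ} (hS : S.PosSemidef) :
    ∃ C : Matrix ι ι ℝ, S = C * Cᴴ := by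
  obtain ⟨C, rfl⟩ := CStarAlgebra.nonneg_iff_eq_star_mul_self.mp hS.nonneg
  exact ⟨star C, by rw [star_eq_conjTranspose, conjTranspose_conjTranspose]⟩

/-- The arithmetic-geometric inequality for a pair of positive semidefinite forms. -/
theorem PosSemidef.det_mul_le_trace_pow {S T : Matrix ι ι ℝ} (hS : S.PosSemidef)
    (hT : T.PosSemidef) : (S * T).det ≤ (S * T).trace ^ Fintype.card ι := by
  obtain ⟨C, rfl⟩ := hS.exists_mul_conjTranspose_self
  have h1 := (hT.conjTranspose_mul_mul_same C).det_le_trace_pow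
  rwa [det_mul_comm, trace_mul_comm, ← mul_assoc] at h1

/-- The trace of the product of two positive semidefinite matrices is nonnegative. -/
theorem PosSemidef.trace_mul_nonneg {S T : Matrix ι ι ℝ} (hS : S.PosSemidef)
    (hT : T.PosSemidef) : 0 ≤ (S * T).trace := by
  obtain ⟨C, rfl⟩ := hS.exists_mul_conjTranspose_self
  have h1 := (hT.conjTranspose_mul_mul_same C).trace_nonneg
  rwa [trace_mul_comm, ← mul_assoc] at h1

/-- The matrix `H * diagonal y` is not symmetric; Sylvester's identity det(1 + AB) = det(1 + BA)
moves one factor √y to the left. -/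
theorem PosSemidef.exists_posSemidef_det_one_add {H : Matrix ι ι ℝ} (hH : H.PosSemidef) {y : ι → ℝ}
    (hy : ∀ i, 0 ≤ y i) : ∃ S : Matrix ι ι ℝ, S.PosSemidef ∧
      (1 + H * diagonal y).det = (1 + S).det ∧ S.trace = ∑ i, H i i * y i := by
  have hyy : diagonal y = diagonal (fun i => √(y i)) * diagonal (fun i => √(y i)) := by
    rw [diagonal_mul_diagonal]
    congr 1
    funext i
    exact (Real.mul_self_sqrt (hy i)).symm
  have hd : (diagonal fun i => √(y i))ᴴ = diagonal fun i => √(y i) := by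
    simp
  refine ⟨diagonal (fun i => √(y i)) * H * (diagonal fun i => √(y i))ᴴ,
    hH.mul_mul_conjTranspose_same _, ?_, ?_⟩
  · rw [hd, hyy, ← mul_assoc, det_one_add_mul_comm, mul_assoc]
  · rw [hd, mul_assoc, trace_mul_comm, mul_assoc, ← hyy]
    simp [trace, mul_diagonal]

end Matrix

/-! ### Comparison of log det(g_ij) with linear functions. -/

namespace DelzantPolytope

open Matrix

variable {n : ℕ} {Δ : DelzantPolytope n} {D : EV n → ℝ} {R : ℝ}

theorem posSemidef_hOut (b : Fin n → Fin Δ.d) (e : Fin n → EV n) {ξ : EV n} (hξ : ξ ∈ Δ.body) :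
    (Δ.hOut b e ξ).PosSemidef := by
  have h : Δ.hOut b e ξ = ∑ k ∈ Δ.out b, (Δ.l k ξ)⁻¹ •
      vecMulVec (fun i => (inner ℝ (Δ.nu k) (e i) : ℝ)) (star fun i => (inner ℝ (Δ.nu k) (e i) : ℝ)) := by
    ext i j
    simp only [hOut, Matrix.of_apply, Matrix.sum_apply, Matrix.smul_apply, vecMulVec_apply,
      smul_eq_mul, star_trivial]
    exact Finset.sum_congr rfl fun k _ => by ring
  rw [h]
  exact posSemidef_sum _ fun k _ => (posSemidef_vecMulVec_self_star _).smul (inv_nonneg.2 (hξ k))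

/-- A bound for the determinant of the Hessian of the symplectic potential, relative to a
nearby vertex. -/
def detBound (n : ℕ) (R : ℝ) : ℝ := (1 + facetBound n R * ((n + 1) * (5 / 4 * R))) ^ n

namespace Frame

variable {b : Fin n → Fin Δ.d} {p : EV n} {e : Fin n → EV n} (F : Δ.Frame b p e)
include F

theorem one_le_det_hessU_mul_prod {ξ : EV n} (hξ : ξ ∈ Δ.openBody) :
    1 ≤ (Δ.hessU ξ).det * ∏ i, Δ.l (b i) ξ := by
  rw [F.det_hessU_mul_prod fun i => hξ (b i)]
  obtain ⟨S, hS, h1, -⟩ := (posSemidef_hOut b e (Δ.openBody_subset hξ)).exists_posSemidef_det_one_add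
    (y := fun i => Δ.l (b i) ξ) fun i => (hξ (b i)).le
  exact hS.one_le_det_one_add.trans_eq h1.symm

/-- The determinant is controlled by a trace of the contributions of the facets missing p. By `hp`
those contributions at ξ are at most n + 1 times the ones at p, which `vertex_bound` estimates. -/
theorem det_hessU_mul_prod_le (hD : ContDiffOn ℝ ∞ D Δ.body) (hD0 : ∀ ξ ∈ Δ.body, 0 < D ξ)
    (hR : Δ.IsCurlyR D R) {ξ : EV n} (hξ : ξ ∈ Δ.openBody)
    (hp : ∀ k, Δ.l k p ≤ (n + 1) * Δ.l k ξ) :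
    (Δ.hessU ξ).det * ∏ i, Δ.l (b i) ξ ≤ detBound n R := by
  rw [F.det_hessU_mul_prod fun i => hξ (b i)]
  have hH := posSemidef_hOut b e (Δ.openBody_subset hξ)
  obtain ⟨S, hS, h1, h2⟩ := hH.exists_posSemidef_det_one_add
    (y := fun i => Δ.l (b i) ξ) fun i => (hξ (b i)).le
  have h3 : S.trace ≤ facetBound n R * ((n + 1) * (5 / 4 * R)) := by
    rw [h2]
    have h4 : ∑ i, Δ.hOut b e ξ i i * Δ.l (b i) ξ ≤ ∑ i, Δ.hOut b e ξ i i * facetBound n R :=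
      Finset.sum_le_sum fun i _ => mul_le_mul_of_nonneg_left
        (l_le_facetBound hD hD0 hR _ (Δ.openBody_subset hξ)) (hH.diag_nonneg)
    rw [← Finset.sum_mul] at h4
    have h5 : ∑ i, Δ.hOut b e ξ i i ≤ (n + 1) * (5 / 4 * R) := by
      have h6 := F.vertex_bound hD hD0 hR
      refine le_trans ?_ (mul_le_mul_of_nonneg_left h6 (by positivity))
      simp only [hOut, Matrix.of_apply]
      rw [Finset.sum_comm, Finset.mul_sum]
      refine Finset.sum_le_sum fun k hk => ?_
      rw [← Finset.sum_div, ← mul_div_assoc, div_le_div_iff₀ (hξ k) (F.pos_of_mem_out hk)]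
      have h7 : ∑ i, (inner ℝ (Δ.nu k) (e i) : ℝ) * inner ℝ (Δ.nu k) (e i)
          = ∑ i, (inner ℝ (Δ.nu k) (e i) : ℝ) ^ 2 := Finset.sum_congr rfl fun i _ => (sq _).symm
      have h8 : 0 ≤ ∑ i, (inner ℝ (Δ.nu k) (e i) : ℝ) ^ 2 := Finset.sum_nonneg fun i _ => sq_nonneg _
      have h9 := mul_le_mul_of_nonneg_left (hp k) h8
      have h10 : 0 ≤ (n + 1) * (∑ i, (inner ℝ (Δ.nu k) (e i) : ℝ)) ^ 2 * Δ.l k ξ :=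
        mul_nonneg (by positivity) (hξ k).le
      rw [h7]
      linarith
    have h0 := one_le_facetBound (n := n) hR.nonneg
    nlinarith
  have hn : 0 ≤ S.trace := hS.trace_nonneg
  have h4 := hS.det_one_add_le
  rw [Fintype.card_fin] at h4
  show (1 + Δ.hOut b e ξ * diagonal fun i => Δ.l (b i) ξ).det ≤ _
  rw [h1]
  exact h4.trans (pow_le_pow_left₀ (by linarith) (by linarith) n)

theorem nef_le (hD : ContDiffOn ℝ ∞ D Δ.body) (hD0 : ∀ ξ ∈ Δ.body, 0 < D ξ)
    (hR : Δ.IsCurlyR D R) (k : Fin Δ.d) :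
    5 / 4 * R * Δ.l k p + inner ℝ (Δ.nu k) (∑ i, e i) ≤ 1 + 2 * (5 / 4 * R * facetBound n R) := by
  have h0 := one_le_facetBound (n := n) hR.nonneg
  have hR0 := hR.nonneg
  by_cases hk : k ∈ Set.range b
  · obtain ⟨i, rfl⟩ := hk
    rw [F.nef_b]
    have : 0 ≤ 5 / 4 * R * facetBound n R := by positivity
    linarith
  · have h1 := F.facet_bound hD hD0 hR (Δ.mem_out.2 hk)
    have h2 := l_le_facetBound hD hD0 hR k F.mem
    have h3 : 0 ≤ ∑ i, (inner ℝ (Δ.nu k) (e i) : ℝ) ^ 2 := Finset.sum_nonneg fun i _ => sq_nonneg _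
    rw [inner_sum]
    have h4 := mul_le_mul_of_nonneg_left h2 (show 0 ≤ 5 / 4 * R by positivity)
    nlinarith [sq_nonneg (∑ i, (inner ℝ (Δ.nu k) (e i) : ℝ) - 1)]

omit F in
/-- The linear function with slope `5/4 𝓡 p + ∑ e_i`, compared with the Guillemin potential. -/
theorem inner_sub_g_eq {ξ : EV n} (hξ : ξ ∈ Δ.openBody) :
    inner ℝ ((5 / 4 * R) • p + ∑ i, e i) (Δ.gradU ξ) - 5 / 4 * R * Δ.g (Δ.gradU ξ)
      = ∑ k, (5 / 4 * R * Δ.l k p + inner ℝ (Δ.nu k) (∑ i, e i)) * (log (Δ.l k ξ) + 1)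
        - 5 / 4 * R * ∑ k, Δ.l k ξ := by
  rw [Δ.g_gradU hξ, guilleminU]
  have h1 : ∀ v : EV n, inner ℝ v (Δ.gradU ξ) = ∑ k, (log (Δ.l k ξ) + 1) * inner ℝ (Δ.nu k) v := by
    intro v
    rw [gradU, inner_sum]
    exact Finset.sum_congr rfl fun k _ => by rw [inner_smul_right, real_inner_comm]
  rw [real_inner_comm ξ, h1, h1, Finset.mul_sum, ← Finset.sum_sub_distrib, Finset.mul_sum,
    ← Finset.sum_sub_distrib, ← Finset.sum_sub_distrib]
  refine Finset.sum_congr rfl fun k _ => ?_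
  have h2 := Δ.l_sub_l k p ξ
  rw [inner_sub_right] at h2
  rw [inner_add_right, inner_smul_right]
  linear_combination (-(5 / 4 * R) * (log (Δ.l k ξ) + 1)) * h2

theorem card_facets_le (hD : ContDiffOn ℝ ∞ D Δ.body) (hD0 : ∀ ξ ∈ Δ.body, 0 < D ξ)
    (hR : Δ.IsCurlyR D R) : (Δ.d : ℝ) ≤ n + 5 / 4 * R * facetBound n R := by
  have h1 := Δ.sum_eq_sum_add_sum_out F.inj (fun _ => (1 : ℝ))
  simp only [Finset.sum_const, Finset.card_univ, Fintype.card_fin, nsmul_eq_mul, mul_one] at h1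
  rw [h1]
  linarith [F.card_out_le hD hD0 hR]

end Frame

/-- A bound for the coefficients of the logarithms in `Frame.inner_sub_g_eq`. -/
def nefBound (n : ℕ) (R : ℝ) : ℝ := 1 + 2 * (5 / 4 * R * facetBound n R)

/-- A bound for the number of facets. -/
def cardBound (n : ℕ) (R : ℝ) : ℝ := n + 5 / 4 * R * facetBound n R

/-- The frame here is arbitrary, unrelated to x. Up to a bounded error log det(g_ij) is the sum of
log l_{c i} over the facets of an auxiliary vertex near ∇g(x). Since every B_k ≥ 1, subtracting
these leaves nonnegative coefficients in front of logarithms that are bounded above. -/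
theorem log_det_hess_g_ge (hD : ContDiffOn ℝ ∞ D Δ.body) (hD0 : ∀ ξ ∈ Δ.body, 0 < D ξ)
    (hR : Δ.IsCurlyR D R) {b : Fin n → Fin Δ.d} {p : EV n} {e : Fin n → EV n} (F : Δ.Frame b p e)
    (x : EV n) :
    inner ℝ ((5 / 4 * R) • p + ∑ i, e i) x - 5 / 4 * R * Δ.g x - log (hess Δ.g x).det
      ≤ (facetBound n R + 1) * (cardBound n R * nefBound n R) + log (detBound n R) := by
  obtain ⟨ξ, hξ, rfl⟩ := Δ.exists_gradU_eq x
  obtain ⟨c, q, e', G, hq⟩ := Δ.exists_frame_l_ge (Δ.openBody_subset hξ)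
  have hΛ := one_le_facetBound (n := n) hR.nonneg
  rw [Frame.inner_sub_g_eq hξ, log_det_hess_g, Δ.gradient_g_gradU hξ, rU]
  set B : Fin Δ.d → ℝ := fun k => 5 / 4 * R * Δ.l k p + inner ℝ (Δ.nu k) (∑ i, e i) with hB
  have hB1 : ∀ k, 1 ≤ B k := F.one_le_nef hD hD0 hR
  have hB2 : ∀ k, B k ≤ nefBound n R := F.nef_le hD hD0 hR
  have h1 := G.det_hessU_mul_prod_le hD hD0 hR hξ hq
  have h2 := G.one_le_det_hessU_mul_prod hξ
  have h3 : log (Δ.hessU ξ).det + ∑ i, log (Δ.l (c i) ξ) ≤ log (detBound n R) := by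
    rw [← Real.log_prod fun i _ => (hξ (c i)).ne', ← Real.log_mul (Δ.det_hessU_ne_zero hξ)
      (Finset.prod_ne_zero_iff.2 fun i _ => (hξ (c i)).ne')]
    exact Real.log_le_log (by linarith) h1
  have hlog : ∀ k, log (Δ.l k ξ) ≤ facetBound n R := fun k =>
    (Real.log_le_sub_one_of_pos (hξ k)).trans
      (by linarith [l_le_facetBound hD hD0 hR k (Δ.openBody_subset hξ)])
  have h4 : 0 ≤ 5 / 4 * R * ∑ k, Δ.l k ξ :=
    mul_nonneg (by have := hR.nonneg; positivity) (Finset.sum_nonneg fun k _ => (hξ k).le)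
  have h5 : ∑ k, B k * (log (Δ.l k ξ) + 1) - ∑ i, log (Δ.l (c i) ξ)
      ≤ ∑ k, B k * (facetBound n R + 1) := by
    rw [Δ.sum_eq_sum_add_sum_out G.inj (fun k => B k * (log (Δ.l k ξ) + 1)),
      Δ.sum_eq_sum_add_sum_out G.inj (fun k => B k * (facetBound n R + 1))]
    have e1 : ∑ i, B (c i) * (log (Δ.l (c i) ξ) + 1) - ∑ i, log (Δ.l (c i) ξ)
        ≤ ∑ i, B (c i) * (facetBound n R + 1) := by
      rw [← Finset.sum_sub_distrib]
      refine Finset.sum_le_sum fun i _ => ?_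
      nlinarith [hB1 (c i), hlog (c i)]
    have e2 : ∑ k ∈ Δ.out c, B k * (log (Δ.l k ξ) + 1)
        ≤ ∑ k ∈ Δ.out c, B k * (facetBound n R + 1) := by
      refine Finset.sum_le_sum fun i _ => ?_
      nlinarith [hB1 i, hlog i]
    linarith
  have h6 : ∑ k, B k * (facetBound n R + 1)
      ≤ (facetBound n R + 1) * (cardBound n R * nefBound n R) := by
    rw [← Finset.sum_mul, mul_comm]
    refine mul_le_mul_of_nonneg_left ?_ (by linarith)
    have h7 := Finset.sum_le_sum fun k (_ : k ∈ Finset.univ) => hB2 k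
    rw [Finset.sum_const, Finset.card_univ, Fintype.card_fin, nsmul_eq_mul] at h7
    refine h7.trans (mul_le_mul_of_nonneg_right (G.card_facets_le hD hD0 hR) ?_)
    have := hR.nonneg
    unfold nefBound
    positivity
  linarith

/-- For the vertex near ∇g(x) the coefficients at its facets are exactly 1, so the logarithms that
may tend to -∞ cancel. The remaining facet functions are bounded below there. -/
theorem exists_log_det_hess_g_le (hD : ContDiffOn ℝ ∞ D Δ.body) (hD0 : ∀ ξ ∈ Δ.body, 0 < D ξ)
    (hR : Δ.IsCurlyR D R) (x : EV n) :
    ∃ (b : Fin n → Fin Δ.d) (p : EV n) (e : Fin n → EV n), Δ.Frame b p e ∧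
      log (hess Δ.g x).det - (inner ℝ ((5 / 4 * R) • p + ∑ i, e i) x - 5 / 4 * R * Δ.g x)
        ≤ cardBound n R * (nefBound n R * ((n + 1) * (5 / 4 * R)) + 5 / 4 * R * facetBound n R) := by
  obtain ⟨ξ, hξ, rfl⟩ := Δ.exists_gradU_eq x
  obtain ⟨c, q, e, G, hq⟩ := Δ.exists_frame_l_ge (Δ.openBody_subset hξ)
  refine ⟨c, q, e, G, ?_⟩
  have hR0 := hR.nonneg
  have hΛ := one_le_facetBound (n := n) hR0
  rw [Frame.inner_sub_g_eq hξ, log_det_hess_g, Δ.gradient_g_gradU hξ, rU]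
  set B : Fin Δ.d → ℝ := fun k => 5 / 4 * R * Δ.l k q + inner ℝ (Δ.nu k) (∑ i, e i) with hB
  have hB1 : ∀ k, 1 ≤ B k := G.one_le_nef hD hD0 hR
  have hB2 : ∀ k, B k ≤ nefBound n R := G.nef_le hD hD0 hR
  have hBc : ∀ i, B (c i) = 1 := G.nef_b
  have h2 := G.one_le_det_hessU_mul_prod hξ
  have h3 : 0 ≤ log (Δ.hessU ξ).det + ∑ i, log (Δ.l (c i) ξ) := by
    rw [← Real.log_prod fun i _ => (hξ (c i)).ne', ← Real.log_mul (Δ.det_hessU_ne_zero hξ)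
      (Finset.prod_ne_zero_iff.2 fun i _ => (hξ (c i)).ne')]
    exact Real.log_nonneg h2
  have hnB : 0 ≤ nefBound n R := by unfold nefBound; positivity
  have hd := G.card_facets_le hD hD0 hR
  have h4 : ∑ k, Δ.l k ξ ≤ cardBound n R * facetBound n R := by
    have h7 := Finset.sum_le_sum fun k (_ : k ∈ Finset.univ) =>
      l_le_facetBound hD hD0 hR k (Δ.openBody_subset hξ)
    rw [Finset.sum_const, Finset.card_univ, Fintype.card_fin, nsmul_eq_mul] at h7
    exact h7.trans (mul_le_mul_of_nonneg_right hd (by linarith))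
  have h5 : ∑ i, log (Δ.l (c i) ξ) - ∑ k, B k * (log (Δ.l k ξ) + 1)
      ≤ ∑ k ∈ Δ.out c, nefBound n R * ((n + 1) * (5 / 4 * R)) := by
    rw [Δ.sum_eq_sum_add_sum_out G.inj (fun k => B k * (log (Δ.l k ξ) + 1))]
    have e1 : ∑ i, B (c i) * (log (Δ.l (c i) ξ) + 1) = ∑ i, log (Δ.l (c i) ξ) + n := by
      simp [hBc, Finset.sum_add_distrib]
    have e2 : ∑ k ∈ Δ.out c, -(nefBound n R * ((n + 1) * (5 / 4 * R)))
        ≤ ∑ k ∈ Δ.out c, B k * (log (Δ.l k ξ) + 1) := by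
      refine Finset.sum_le_sum fun k hk => ?_
      have e3 := G.one_le_mul_l hD hD0 hR hk
      have e4 := hq k
      -- Facet `k` misses the vertex, so `l k q` is at least 1/((5/4)R), and closeness costs a
      -- factor n + 1.
      have e5 : (Δ.l k ξ)⁻¹ ≤ (n + 1) * (5 / 4 * R) := by
        rw [inv_le_iff_one_le_mul₀ (hξ k)]
        nlinarith
      have e6 := Real.one_sub_inv_le_log_of_pos (hξ k)
      have e7 : 0 ≤ (n + 1 : ℝ) * (5 / 4 * R) := by positivity
      nlinarith [hB1 k, hB2 k, mul_le_mul_of_nonneg_right (hB2 k) e7,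
        mul_le_mul_of_nonneg_left (show -((n + 1) * (5 / 4 * R)) ≤ log (Δ.l k ξ) + 1 by linarith)
          (show 0 ≤ B k by linarith [hB1 k])]
    rw [Finset.sum_neg_distrib] at e2
    have : (0 : ℝ) ≤ n := by positivity
    linarith
  have h6 : ∑ k ∈ Δ.out c, nefBound n R * ((n + 1) * (5 / 4 * R))
      ≤ cardBound n R * (nefBound n R * ((n + 1) * (5 / 4 * R))) := by
    rw [Finset.sum_const, nsmul_eq_mul]
    refine mul_le_mul_of_nonneg_right ?_ (by positivity)
    have := G.card_out_le hD hD0 hR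
    unfold cardBound
    have : (0 : ℝ) ≤ n := by positivity
    linarith
  have h8 := mul_le_mul_of_nonneg_left h4 (show 0 ≤ 5 / 4 * R by positivity)
  linarith

end DelzantPolytope

/-! ### Complex Hessians of torus-invariant functions. -/

section LogNorm

variable {n : ℕ}

/-- The derivative of `z ↦ log |z_i|²`. -/
def logNormDeriv (z : Fin n → ℂ) (i : Fin n) : (Fin n → ℂ) →L[ℝ] ℝ :=
  (2 : ℝ) • Complex.reCLM.comp ((ContinuousLinearMap.mul ℝ ℂ (z i)⁻¹).comp
    (ContinuousLinearMap.proj i))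

theorem logNormDeriv_apply (z : Fin n → ℂ) (i : Fin n) (v : Fin n → ℂ) :
    logNormDeriv z i v = 2 * ((z i)⁻¹ * v i).re := rfl

theorem hasFDerivAt_log_norm_sq {z : Fin n → ℂ} {i : Fin n} (hz : z i ≠ 0) :
    HasFDerivAt (fun z : Fin n → ℂ => log (‖z i‖ ^ 2)) (logNormDeriv z i) z := by
  have h0 : HasFDerivAt (fun z : Fin n → ℂ => z i)
      (ContinuousLinearMap.proj i : (Fin n → ℂ) →L[ℝ] ℂ) z :=
    (ContinuousLinearMap.proj (R := ℝ) (φ := fun _ : Fin n => ℂ) i).hasFDerivAt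
  have h1 := h0.norm_sq.log (pow_ne_zero 2 (norm_ne_zero_iff.2 hz))
  refine h1.congr_fderiv ?_
  ext v
  have h2 : ((‖z i‖ ^ 2)⁻¹ • (2 : ℕ) • (innerSL ℝ (z i)).comp
      (ContinuousLinearMap.proj i : (Fin n → ℂ) →L[ℝ] ℂ)) v
      = (‖z i‖ ^ 2)⁻¹ * (2 * inner ℝ (z i) (v i)) := by
    simp only [two_mul, inner]
    simp
    left
    ring
  rw [logNormDeriv_apply, Complex.inv_def, ← Complex.sq_norm, h2, Complex.inner, mul_right_comm,
    Complex.re_mul_ofReal]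
  ring_nf

theorem hasFDerivAt_inv_mul_re {z : Fin n → ℂ} {i : Fin n} (hz : z i ≠ 0) (w : ℂ) :
    HasFDerivAt (fun z : Fin n → ℂ => 2 * ((z i)⁻¹ * w).re)
      ((2 : ℝ) • Complex.reCLM.comp ((ContinuousLinearMap.mul ℝ ℂ (-((z i)⁻¹ ^ 2) * w)).comp
        (ContinuousLinearMap.proj i))) z := by
  have h0 : HasFDerivAt (fun z : Fin n → ℂ => z i)
      (ContinuousLinearMap.proj i : (Fin n → ℂ) →L[ℝ] ℂ) z :=
    (ContinuousLinearMap.proj (R := ℝ) (φ := fun _ : Fin n => ℂ) i).hasFDerivAt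
  have h1 := ((hasDerivAt_inv hz).mul_const w).hasFDerivAt.restrictScalars ℝ
  have h2 := (Complex.reCLM.hasFDerivAt.comp z (h1.comp z h0)).const_smul (2 : ℝ)
  refine h2.congr_fderiv ?_
  ext v
  simp [mul_comm, mul_left_comm]
  ring

end LogNorm

namespace DelzantPolytope

variable {n : ℕ} {Δ : DelzantPolytope n}

variable (Δ) in
/-- The log-affine coordinates of the point of the open orbit with coordinates `z` in the chart at
a vertex. -/
def logAffine (b : Fin n → Fin Δ.d) (z : Fin n → ℂ) : EV n :=
  ∑ i, log (‖z i‖ ^ 2) • Δ.nu (b i)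

theorem hasFDerivAt_logAffine {b : Fin n → Fin Δ.d} {z : Fin n → ℂ} (hz : ∀ i, z i ≠ 0) :
    HasFDerivAt (Δ.logAffine b) (∑ i, (logNormDeriv z i).smulRight (Δ.nu (b i))) z :=
  HasFDerivAt.fun_sum fun i _ => (hasFDerivAt_log_norm_sq (hz i)).smul_const (Δ.nu (b i))

theorem eventually_forall_ne_zero {z : Fin n → ℂ} (hz : ∀ i, z i ≠ 0) :
    ∀ᶠ w in 𝓝 z, ∀ i, w i ≠ 0 :=
  Filter.eventually_all.2 fun i => (continuous_apply i).continuousAt.eventually_ne (hz i)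

theorem fderiv_of_eq_comp_logAffine {b : Fin n → Fin Δ.d} {h : (Fin n → ℂ) → ℝ} {u : EV n → ℝ}
    (hu : ContDiff ℝ ∞ u) (hhu : ∀ z, (∀ i, z i ≠ 0) → h z = u (Δ.logAffine b z))
    {z : Fin n → ℂ} (hz : ∀ i, z i ≠ 0) (w : Fin n → ℂ) :
    fderiv ℝ h z w = ∑ i, fderiv ℝ u (Δ.logAffine b z) (Δ.nu (b i)) * (2 * ((z i)⁻¹ * w i).re) := by
  have h1 : h =ᶠ[𝓝 z] fun z => u (Δ.logAffine b z) := by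
    filter_upwards [eventually_forall_ne_zero hz] with w hw using hhu w hw
  have h2 : HasFDerivAt (fun z => u (Δ.logAffine b z)) _ z :=
    ((hu.differentiable (by simp)) (Δ.logAffine b z)).hasFDerivAt.comp z (hasFDerivAt_logAffine hz)
  rw [h1.fderiv_eq, h2.fderiv]
  simp only [ContinuousLinearMap.comp_apply, FunLike.coe_sum, Finset.sum_apply,
    ContinuousLinearMap.smulRight_apply, map_sum, map_smul, smul_eq_mul, logNormDeriv_apply]
  exact Finset.sum_congr rfl fun i _ => mul_comm _ _

theorem fderiv_fderiv_of_eq_comp_logAffine {b : Fin n → Fin Δ.d} {h : (Fin n → ℂ) → ℝ}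
    {u : EV n → ℝ} (hh : ContDiff ℝ ∞ h) (hu : ContDiff ℝ ∞ u)
    (hhu : ∀ z, (∀ i, z i ≠ 0) → h z = u (Δ.logAffine b z))
    {z : Fin n → ℂ} (hz : ∀ i, z i ≠ 0) (v w : Fin n → ℂ) :
    fderiv ℝ (fderiv ℝ h) z v w
      = ∑ i, (∑ j, (2 * ((z j)⁻¹ * v j).re)
            * fderiv ℝ (fderiv ℝ u) (Δ.logAffine b z) (Δ.nu (b j)) (Δ.nu (b i)))
          * (2 * ((z i)⁻¹ * w i).re)
        + ∑ i, fderiv ℝ u (Δ.logAffine b z) (Δ.nu (b i)) * (2 * (-((z i)⁻¹ ^ 2) * w i * v i).re) := by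
  have h0 : fderiv ℝ (fderiv ℝ h) z v w = fderiv ℝ (fun z => fderiv ℝ h z w) z v := by
    rw [fderiv_clm_apply
      ((hh.fderiv_right (m := ∞) le_rfl).differentiable (by simp) z) (differentiableAt_const _)]
    simp
  have h1 : (fun z => fderiv ℝ h z w) =ᶠ[𝓝 z] fun z => ∑ i,
      fderiv ℝ u (Δ.logAffine b z) (Δ.nu (b i)) * (2 * ((z i)⁻¹ * w i).re) := by
    filter_upwards [eventually_forall_ne_zero hz] with z' hz' using
      fderiv_of_eq_comp_logAffine hu hhu hz' w
  have hu2 : Differentiable ℝ (fderiv ℝ u) :=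
    (hu.fderiv_right (m := ∞) le_rfl).differentiable (by simp)
  have h2 : ∀ i, HasFDerivAt (fun z => fderiv ℝ u (Δ.logAffine b z) (Δ.nu (b i))) _ z := fun i =>
    ((hu2 (Δ.logAffine b z)).hasFDerivAt.comp z (hasFDerivAt_logAffine hz)).clm_apply
      (hasFDerivAt_const (Δ.nu (b i)) z)
  have h3 : HasFDerivAt (fun z => ∑ i,
      fderiv ℝ u (Δ.logAffine b z) (Δ.nu (b i)) * (2 * ((z i)⁻¹ * w i).re)) _ z :=
    HasFDerivAt.fun_sum fun i (_ : i ∈ Finset.univ) =>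
      (h2 i).mul (hasFDerivAt_inv_mul_re (hz i) (w i))
  rw [h0, h1.fderiv_eq, h3.fderiv, ← Finset.sum_add_distrib]
  simp only [FunLike.coe_sum, Finset.sum_apply, _root_.add_apply, FunLike.coe_smul, Pi.smul_apply,
    smul_eq_mul, ContinuousLinearMap.comp_apply, ContinuousLinearMap.proj_apply,
    ContinuousLinearMap.mul_apply', Complex.reCLM_apply, ContinuousLinearMap.flip_apply,
    ContinuousLinearMap.smulRight_apply, map_sum, map_smul, logNormDeriv_apply,
    _root_.zero_apply, map_zero, zero_add]
  refine Finset.sum_congr rfl fun i _ => ?_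
  simp
  ring

/-- The complex Hessian of a torus-invariant function, in terms of the log-affine coordinates. -/
theorem complexHessian_of_eq_comp_logAffine {b : Fin n → Fin Δ.d} {h : (Fin n → ℂ) → ℝ}
    {u : EV n → ℝ} (hh : ContDiff ℝ ∞ h) (hu : ContDiff ℝ ∞ u)
    (hhu : ∀ z, (∀ i, z i ≠ 0) → h z = u (Δ.logAffine b z))
    {z : Fin n → ℂ} (hz : ∀ i, z i ≠ 0) (i j : Fin n) :
    complexHessian h z i j = (z i)⁻¹
      * ((fderiv ℝ (fderiv ℝ u) (Δ.logAffine b z) (Δ.nu (b i)) (Δ.nu (b j)) : ℝ) : ℂ)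
      * star (z j)⁻¹ := by
  have hs : ∀ (a c : ℂ) (k l m : Fin n) (r : ℝ),
      (2 * ((z m)⁻¹ * (Pi.single k a : Fin n → ℂ) m).re) * r
      = if m = k then 2 * ((z k)⁻¹ * a).re * r else 0 := by
    intro a c k l m r
    by_cases hm : m = k
    · subst hm; simp
    · simp [hm]
  have key : ∀ a c : ℂ, fderiv ℝ (fderiv ℝ h) z (Pi.single i a) (Pi.single j c)
      = 4 * ((z i)⁻¹ * a).re * ((z j)⁻¹ * c).re
          * fderiv ℝ (fderiv ℝ u) (Δ.logAffine b z) (Δ.nu (b i)) (Δ.nu (b j))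
        + if i = j then fderiv ℝ u (Δ.logAffine b z) (Δ.nu (b i)) * (2 * (-((z i)⁻¹ ^ 2) * c * a).re)
          else 0 := by
    intro a c
    rw [fderiv_fderiv_of_eq_comp_logAffine hh hu hhu hz]
    congr 1
    · rw [Finset.sum_eq_single j]
      · rw [Finset.sum_eq_single i]
        · simp only [Pi.single_eq_same]; ring
        · intro k _ hk; simp [hk]
        · simp
      · intro k _ hk; simp [hk]
      · simp
    · rw [Finset.sum_eq_single j]
      · by_cases hij : i = j
        · subst hij; simp
        · simp [hij, Ne.symm hij]
      · intro k _ hk; simp [hk]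
      · simp
  -- The diagonal term of `key`, coming from second derivatives of log|z_i|², drops out of the
  -- complex Hessian because log|z_i|² is harmonic away from 0.
  simp only [complexHessian, Matrix.of_apply, key]
  set G := fderiv ℝ (fderiv ℝ u) (Δ.logAffine b z) (Δ.nu (b i)) (Δ.nu (b j))
  set A := (z i)⁻¹
  set B := (z j)⁻¹
  apply Complex.ext
  · split_ifs <;> simp <;> ring
  · split_ifs <;> simp <;> ring

end DelzantPolytope

/-! ### Potentials and the ratio H in log-affine coordinates. -/

namespace DelzantPolytope

open Matrix

variable {n : ℕ} {Δ : DelzantPolytope n} {φ : Δ.ToricVariety → ℝ}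

/-- Two real exponential lifts of one x differ by t_k = exp((w_k - y_k)/2), and ∑ (w_k - y_k) ν_k =
0 places t in the kernel torus. Thus `expPoint` does not depend on the lift chosen in `expLift`. -/
theorem toM_exp_eq {y w : Fin Δ.d → ℝ} (h : ∀ i, ∑ k, y k * (Δ.normal k i : ℝ)
    = ∑ k, w k * (Δ.normal k i : ℝ)) {Z W : Fin Δ.d → ℂ} (hZ : Z ∈ Δ.coxSet) (hW : W ∈ Δ.coxSet)
    (hy : ∀ k, Z k = (exp (y k / 2) : ℝ)) (hw : ∀ k, W k = (exp (w k / 2) : ℝ)) :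
    Δ.toM Z hZ = Δ.toM W hW := by
  refine Quotient.sound ⟨fun k => Units.mk0 ((exp ((w k - y k) / 2) : ℝ) : ℂ)
    (by exact_mod_cast (exp_pos _).ne'), fun i => ?_, fun k => ?_⟩
  · apply Units.ext
    have h1 : ∀ k, ((exp ((w k - y k) / 2) : ℝ) : ℂ) ^ Δ.normal k i
        = ((exp ((w k - y k) / 2 * Δ.normal k i) : ℝ) : ℂ) := by
      intro k
      rw [Real.exp_mul, Real.rpow_intCast]
      push_cast; rfl
    simp only [Units.coe_prod, Units.val_zpow_eq_zpow_val, Units.val_mk0, Units.val_one, h1]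
    rw [← Complex.ofReal_prod, ← Real.exp_sum]
    have h2 : ∑ k, (w k - y k) / 2 * (Δ.normal k i : ℝ) = 0 := by
      have h3 := h i
      have : ∑ k, (w k - y k) / 2 * (Δ.normal k i : ℝ)
          = (∑ k, w k * (Δ.normal k i : ℝ) - ∑ k, y k * (Δ.normal k i : ℝ)) / 2 := by
        rw [← Finset.sum_sub_distrib, Finset.sum_div]
        exact Finset.sum_congr rfl fun k _ => by ring
      rw [this, h3, sub_self, zero_div]
    rw [h2]; simp
  · simp only [Units.val_mk0, hy, hw]
    rw [← Complex.ofReal_mul, ← Real.exp_add]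
    congr 2; ring

theorem Frame.chart_chartPt {b : Fin n → Fin Δ.d} {p : EV n} {e : Fin n → EV n}
    (F : Δ.Frame b p e) (hb : Δ.IsFrame b) (x : EV n) :
    Δ.chart hb (chartPt e x) = Δ.expPoint x := by
  have hc := (Δ.exists_sum_normal x).choose_spec
  refine (toM_exp_eq (y := (Δ.exists_sum_normal x).choose)
    (w := Function.extend b (fun i => inner ℝ (e i) x) 0) (fun i => ?_) (Δ.expLift_mem x)
    (Δ.lift_mem hb (chartPt e x)) (fun k => rfl) fun k => ?_).symm
  · rw [hc, Δ.sum_eq_sum_add_sum_out F.inj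
      (fun k => Function.extend b (fun i => inner ℝ (e i) x) 0 k * (Δ.normal k i : ℝ))]
    have h1 : ∑ k ∈ Δ.out b, Function.extend b (fun i => inner ℝ (e i) x) 0 k * (Δ.normal k i : ℝ)
        = 0 := by
      refine Finset.sum_eq_zero fun k hk => ?_
      rw [Function.extend_apply' _ _ _ (by simpa using Δ.mem_out.1 hk)]; simp
    rw [h1, add_zero]
    have h2 := congrArg (fun v : EV n => v i) (F.sum_inner_smul_nu x)
    simp only [WithLp.ofLp_sum, Finset.sum_apply, PiLp.smul_apply, smul_eq_mul] at h2
    rw [← h2]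
    exact Finset.sum_congr rfl fun j _ => by rw [F.inj.extend_apply]; rfl
  · by_cases hk : k ∈ Set.range b
    · obtain ⟨i, rfl⟩ := hk
      rw [F.lift_b, F.inj.extend_apply]; rfl
    · rw [Frame.lift_out _ (Δ.mem_out.2 hk), Function.extend_apply' _ _ _ (by simpa using hk)]
      simp

/-- The phases of the nonzero z_i are absorbed by the compact torus, leaving the point with
coordinates |z_i|. -/
theorem IsInvariant.chart_eq (hφ : Δ.IsInvariant φ) {b : Fin n → Fin Δ.d} {p : EV n}
    {e : Fin n → EV n} (F : Δ.Frame b p e) (hb : Δ.IsFrame b) {z : Fin n → ℂ}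
    (hz : ∀ i, z i ≠ 0) : φ (Δ.chart hb z) = φ (Δ.expPoint (Δ.logAffine b z)) := by
  rw [← F.chart_chartPt hb]
  have habs : ∀ i, chartPt e (Δ.logAffine b z) i = (‖z i‖ : ℂ) := by
    intro i
    have h1 : inner ℝ (e i) (Δ.logAffine b z) = log (‖z i‖ ^ 2) := by
      rw [logAffine, inner_sum, Finset.sum_eq_single i]
      · rw [inner_smul_right, real_inner_comm, F.dual]; simp
      · intro j _ hj
        rw [inner_smul_right, real_inner_comm, F.dual, if_neg hj, mul_zero]
      · simp
    rw [chartPt, h1, Real.log_pow]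
    push_cast
    rw [mul_div_cancel_left₀ _ (two_ne_zero), ← Complex.ofReal_exp,
      Real.exp_log (norm_pos_iff.2 (hz i))]
  have hex : ∀ i, ∃ s : Circle, (s : ℂ) = z i / ‖z i‖ := fun i =>
    ⟨⟨z i / ‖z i‖, mem_sphere_zero_iff_norm.2 (by simp [hz i])⟩, rfl⟩
  choose s hs using hex
  let c : Fin Δ.d → Circle := Function.extend b s 1
  unfold chart
  rw [← hφ c (Δ.lift b (chartPt e (Δ.logAffine b z))) (Δ.lift_mem hb _)]
  congr 1
  have : Δ.lift b z = fun k => (c k : ℂ) * Δ.lift b (chartPt e (Δ.logAffine b z)) k := by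
    funext k
    by_cases hk : k ∈ Set.range b
    · obtain ⟨i, rfl⟩ := hk
      rw [F.lift_b, F.lift_b, habs]
      simp only [c, F.inj.extend_apply, hs]
      have : (‖z i‖ : ℂ) ≠ 0 := by simpa using hz i
      exact (div_mul_cancel₀ _ this).symm
    · rw [Frame.lift_out _ (Δ.mem_out.2 hk), Frame.lift_out _ (Δ.mem_out.2 hk)]
      simp only [c]
      rw [Function.extend_apply' _ _ _ (by simpa using hk)]
      simp
  simp only [this]

theorem contDiff_comp_expPoint (hφ : Δ.IsSmooth φ) :
    ContDiff ℝ ∞ fun x => φ (Δ.expPoint x) := by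
  obtain ⟨b, p, e, F⟩ := Δ.exists_frame
  have : (fun x => φ (Δ.expPoint x)) = fun x => φ (Δ.chart F.isFrame (chartPt e x)) :=
    funext fun x => by rw [F.chart_chartPt]
  rw [this]
  exact (hφ b F.isFrame).comp (contDiff_chartPt e)

theorem contDiff_f (hφ : Δ.IsSmooth φ) : ContDiff ℝ ∞ (Δ.f φ) :=
  Δ.contDiff_g.add (contDiff_comp_expPoint hφ)

theorem contDiff_fLocal (hφ : Δ.IsSmooth φ) {b : Fin n → Fin Δ.d} (hb : Δ.IsFrame b) :
    ContDiff ℝ ∞ (Δ.fLocal φ hb) := by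
  obtain ⟨p, e, F⟩ := hb.exists_frame
  exact F.contDiff_gLocal.add (hφ b hb)

theorem Frame.fLocal_eq {b : Fin n → Fin Δ.d} {p : EV n} {e : Fin n → EV n} (F : Δ.Frame b p e)
    (hφ : Δ.IsInvariant φ) (hb : Δ.IsFrame b) {z : Fin n → ℂ} (hz : ∀ i, z i ≠ 0) :
    Δ.fLocal φ hb z = Δ.f φ (Δ.logAffine b z) - inner ℝ (Δ.logAffine b z) p := by
  rw [fLocal, F.gLocal_eq hz, hφ.chart_eq F hb hz, f, logAffine]
  ring

theorem fderiv_fderiv_sub_inner {F : EV n → ℝ} (hF : ContDiff ℝ ∞ F) (p x : EV n) :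
    fderiv ℝ (fderiv ℝ fun x => F x - inner ℝ x p) x = fderiv ℝ (fderiv ℝ F) x := by
  have h1 : (fderiv ℝ fun x => F x - inner ℝ x p) = fun x => fderiv ℝ F x - innerSL ℝ p := by
    funext y
    have h2 : HasFDerivAt (fun x : EV n => inner ℝ x p) (innerSL ℝ p) y := by
      have := (innerSL ℝ p).hasFDerivAt (x := y)
      refine this.congr_of_eventuallyEq (Filter.Eventually.of_forall fun z => ?_)
      exact real_inner_comm _ _
    exact (((hF.differentiable (by simp)) y).hasFDerivAt.sub h2).fderiv
  rw [h1, fderiv_sub_const]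

/-- The complex Hessian of the local potential, in terms of the log-affine coordinates. -/
theorem Frame.complexHessian_eq {b : Fin n → Fin Δ.d} {p : EV n} {e : Fin n → EV n}
    (_ : Δ.Frame b p e) {h : (Fin n → ℂ) → ℝ} {F : EV n → ℝ} (hh : ContDiff ℝ ∞ h)
    (hF : ContDiff ℝ ∞ F)
    (hhF : ∀ z, (∀ i, z i ≠ 0) → h z = F (Δ.logAffine b z) - inner ℝ (Δ.logAffine b z) p)
    {z : Fin n → ℂ} (hz : ∀ i, z i ≠ 0) :
    complexHessian h z = Matrix.diagonal (fun i => (z i)⁻¹)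
      * ((Matrix.of fun i a => Δ.nu (b i) a) * hess F (Δ.logAffine b z)
        * (Matrix.of fun i a => Δ.nu (b i) a)ᵀ).map (fun r : ℝ => (r : ℂ))
      * Matrix.diagonal (fun i => star (z i)⁻¹) := by
  ext i j
  have hu : ContDiff ℝ ∞ fun x : EV n => F x - inner ℝ x p :=
    hF.sub (contDiff_id.inner ℝ contDiff_const)
  rw [complexHessian_of_eq_comp_logAffine hh hu hhF hz, Matrix.mul_diagonal, Matrix.diagonal_mul,
    Matrix.map_apply, fderiv_fderiv_sub_inner hF, fderiv_fderiv_eq_sum hF.contDiffAt]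
  congr 3
  simp only [Matrix.mul_apply, Matrix.transpose_apply, Matrix.of_apply, Finset.sum_mul, hess]
  rw [Finset.sum_comm]
  exact Finset.sum_congr rfl fun a _ => Finset.sum_congr rfl fun c _ => by ring

theorem Frame.det_complexHessian_eq {b : Fin n → Fin Δ.d} {p : EV n} {e : Fin n → EV n}
    (G : Δ.Frame b p e) {h : (Fin n → ℂ) → ℝ} {F : EV n → ℝ} (hh : ContDiff ℝ ∞ h)
    (hF : ContDiff ℝ ∞ F)
    (hhF : ∀ z, (∀ i, z i ≠ 0) → h z = F (Δ.logAffine b z) - inner ℝ (Δ.logAffine b z) p)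
    {z : Fin n → ℂ} (hz : ∀ i, z i ≠ 0) :
    (complexHessian h z).det.re = (∏ i, Complex.normSq (z i)⁻¹) * (hess F (Δ.logAffine b z)).det := by
  have h1 := G.det_mul_self
  have h2 : (((Matrix.of fun i a => Δ.nu (b i) a) * hess F (Δ.logAffine b z)
        * (Matrix.of fun i a => Δ.nu (b i) a)ᵀ).map (fun r : ℝ => (r : ℂ))).det
      = ((hess F (Δ.logAffine b z)).det : ℂ) := by
    have := (Complex.ofRealHom.map_det ((Matrix.of fun i a => Δ.nu (b i) a)
      * hess F (Δ.logAffine b z) * (Matrix.of fun i a => Δ.nu (b i) a)ᵀ)).symm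
    refine this.trans ?_
    rw [Matrix.det_mul, Matrix.det_mul, Matrix.det_transpose]
    simp only [Complex.ofRealHom_eq_coe]
    congr 1
    linear_combination (hess F (Δ.logAffine b z)).det * h1
  rw [G.complexHessian_eq hh hF hhF hz, Matrix.det_mul, Matrix.det_mul, h2, Matrix.det_diagonal,
    Matrix.det_diagonal]
  have h3 : (∏ i, (z i)⁻¹) * ((hess F (Δ.logAffine b z)).det : ℂ) * ∏ i, star (z i)⁻¹
      = (((∏ i, Complex.normSq (z i)⁻¹) * (hess F (Δ.logAffine b z)).det : ℝ) : ℂ) := by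
    push_cast
    rw [mul_right_comm, ← Finset.prod_mul_distrib]
    congr 1
    exact Finset.prod_congr rfl fun i _ => by
      rw [Complex.star_def, Complex.mul_conj]
  rw [h3, Complex.ofReal_re]

end DelzantPolytope

theorem dotProduct_hess_mulVec {n : ℕ} {F : EV n → ℝ} {x : EV n} (hF : ContDiffAt ℝ ∞ F x)
    (y : Fin n → ℝ) : y ⬝ᵥ (hess F x).mulVec y
      = fderiv ℝ (fderiv ℝ F) x (WithLp.toLp 2 y) (WithLp.toLp 2 y) := by
  rw [fderiv_fderiv_eq_sum hF]
  simp only [dotProduct, Matrix.mulVec, hess, Matrix.of_apply, Finset.mul_sum]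
  exact Finset.sum_congr rfl fun i _ => Finset.sum_congr rfl fun j _ => by ring

theorem continuous_complexHessian {n : ℕ} {h : (Fin n → ℂ) → ℝ} (hh : ContDiff ℝ ∞ h) :
    Continuous (complexHessian h) := by
  have h2 : Continuous (fderiv ℝ (fderiv ℝ h)) :=
    ((hh.fderiv_right (m := ∞) le_rfl).fderiv_right (m := ∞) le_rfl).continuous
  refine continuous_matrix fun i j => ?_
  have h3 : ∀ v w : Fin n → ℂ, Continuous fun z => fderiv ℝ (fderiv ℝ h) z v w := fun v w =>
    (h2.clm_apply continuous_const).clm_apply continuous_const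
  simp only [complexHessian, Matrix.of_apply]
  exact continuous_const.mul ((Complex.continuous_ofReal.comp ((h3 _ _).add (h3 _ _))).add
    (continuous_const.mul (Complex.continuous_ofReal.comp ((h3 _ _).sub (h3 _ _)))))

namespace DelzantPolytope

open Matrix

variable {n : ℕ} {Δ : DelzantPolytope n} {φ : Δ.ToricVariety → ℝ}

namespace IsKahlerPotential

variable (hφ : Δ.IsKahlerPotential φ)
include hφ

/-- At a point with real coordinates z_i, the complex Hessian evaluated on the vector z_i⟨e_i, v⟩ is
the real Hessian of f evaluated on v. -/
theorem posDef_hess_f (x : EV n) : (hess (Δ.f φ) x).PosDef := by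
  obtain ⟨b, p, e, F⟩ := Δ.exists_frame
  have hf := contDiff_f hφ.smooth
  refine PosDef.of_dotProduct_mulVec_pos ?_ fun y hy => ?_
  · ext i j
    rw [Matrix.conjTranspose_apply, star_trivial]
    exact hess_symm hf.contDiffAt j i
  · rw [star_trivial, dotProduct_hess_mulVec hf.contDiffAt]
    set z := chartPt e x with hz
    have hz0 : ∀ i, z i ≠ 0 := chartPt_ne_zero e x
    have hx : Δ.logAffine b z = x := F.sum_log_norm_chartPt x
    set v : EV n := WithLp.toLp 2 y with hv
    have hu : ContDiff ℝ ∞ fun x : EV n => Δ.f φ x - inner ℝ x p :=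
      hf.sub (contDiff_id.inner ℝ contDiff_const)
    have hstar : ∀ i, star (z i) = z i := fun i => by
      rw [hz, chartPt, Complex.star_def, Complex.conj_ofReal]
    let c : Fin n → ℂ := fun i => z i * ((inner ℝ (e i) v : ℝ) : ℂ)
    have hc : c ≠ 0 := by
      intro h0
      apply hy
      have h1 : ∀ i, inner ℝ (e i) v = 0 := fun i => by
        have := congrFun h0 i
        simpa [c, hz0 i] using this
      have h2 := F.sum_inner_smul_nu v
      simp only [h1, zero_smul, Finset.sum_const_zero] at h2
      have h3 : v = 0 := h2.symm
      funext i
      exact congrArg (fun w : EV n => w i) h3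
    have h4 := (hφ.pos b F.isFrame z).dotProduct_mulVec_pos hc
    have h5 : star c ⬝ᵥ (complexHessian (Δ.fLocal φ F.isFrame) z *ᵥ c)
        = ((fderiv ℝ (fderiv ℝ (Δ.f φ)) x v v : ℝ) : ℂ) := by
      have h6 : ∀ i j, star (c i) * (complexHessian (Δ.fLocal φ F.isFrame) z i j * c j)
          = ((inner ℝ (e i) v * inner ℝ (e j) v
            * fderiv ℝ (fderiv ℝ (Δ.f φ)) x (Δ.nu (b i)) (Δ.nu (b j)) : ℝ) : ℂ) := by
        intro i j
        rw [complexHessian_of_eq_comp_logAffine (contDiff_fLocal hφ.smooth F.isFrame) hu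
          (fun z hz => F.fLocal_eq hφ.invariant F.isFrame hz) hz0, fderiv_fderiv_sub_inner hf, hx]
        have h7 : star (c i) = z i * ((inner ℝ (e i) v : ℝ) : ℂ) := by
          simp only [c, star_mul', hstar]
          rw [Complex.star_def, Complex.conj_ofReal]
        rw [h7, star_inv₀, hstar]
        push_cast
        simp only [c]
        have := hz0 i
        have := hz0 j
        field_simp
      simp only [dotProduct, mulVec, Pi.star_apply, Finset.mul_sum, h6]
      rw [← F.sum_inner_smul_nu v]
      simp only [map_sum, map_smul, FunLike.coe_sum, Finset.sum_apply, FunLike.coe_smul,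
        Pi.smul_apply, smul_eq_mul]
      rw [F.sum_inner_smul_nu v]
      push_cast
      simp only [Finset.mul_sum]
      rw [Finset.sum_comm]
      exact Finset.sum_congr rfl fun i _ => Finset.sum_congr rfl fun j _ => by ring
    rw [h5] at h4
    exact_mod_cast h4

end IsKahlerPotential

theorem posDef_hessU {ξ : EV n} (hξ : ξ ∈ Δ.openBody) : (Δ.hessU ξ).PosDef := by
  have h : Δ.hessU ξ = ∑ k, (Δ.l k ξ)⁻¹ •
      vecMulVec (fun i => Δ.nu k i) (star fun i => Δ.nu k i) := by
    ext i j
    simp only [hessU, Matrix.of_apply, Matrix.sum_apply, Matrix.smul_apply, vecMulVec_apply,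
      smul_eq_mul, star_trivial]
    exact Finset.sum_congr rfl fun k _ => by ring
  have h2 : (Δ.hessU ξ).PosSemidef := by
    rw [h]
    exact posSemidef_sum _ fun k _ =>
      (posSemidef_vecMulVec_self_star _).smul (inv_nonneg.2 (hξ k).le)
  exact h2.posDef_iff_det_ne_zero.2 (Δ.det_hessU_ne_zero hξ)

variable (Δ) in
theorem posDef_hess_g (x : EV n) : (hess Δ.g x).PosDef := by
  rw [Δ.hess_g_eq]
  exact (posDef_hessU (Δ.gradient_g_mem x)).inv

theorem IsKahlerPotential.det_re_pos (hφ : Δ.IsKahlerPotential φ) {b : Fin n → Fin Δ.d}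
    (hb : Δ.IsFrame b) (z : Fin n → ℂ) : 0 < (complexHessian (Δ.fLocal φ hb) z).det.re :=
  (Complex.pos_iff.1 (hφ.pos b hb z).det_pos).1

theorem IsKahlerPotential.continuous_H (hφ : Δ.IsKahlerPotential φ) {b : Fin n → Fin Δ.d}
    (hb : Δ.IsFrame b) : Continuous (Δ.H φ hb) := by
  obtain ⟨p, e, F⟩ := hb.exists_frame
  unfold H
  refine Continuous.div ?_ ?_ fun z => (hφ.det_re_pos hb z).ne'
  · exact Complex.continuous_re.comp (continuous_complexHessian F.contDiff_gLocal).matrix_det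
  · exact Complex.continuous_re.comp
      (continuous_complexHessian (contDiff_fLocal hφ.smooth hb)).matrix_det

theorem IsKahlerPotential.H_eq (hφ : Δ.IsKahlerPotential φ) {b : Fin n → Fin Δ.d}
    (hb : Δ.IsFrame b) {z : Fin n → ℂ} (hz : ∀ i, z i ≠ 0) :
    Δ.H φ hb z = (hess Δ.g (Δ.logAffine b z)).det / (hess (Δ.f φ) (Δ.logAffine b z)).det := by
  obtain ⟨p, e, F⟩ := hb.exists_frame
  rw [H, F.det_complexHessian_eq F.contDiff_gLocal Δ.contDiff_g (fun z hz => F.gLocal_eq hz) hz,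
    F.det_complexHessian_eq (contDiff_fLocal hφ.smooth hb) (contDiff_f hφ.smooth)
      (fun z hz => F.fLocal_eq hφ.invariant hb hz) hz, mul_div_mul_left]
  exact Finset.prod_ne_zero_iff.2 fun i _ => by simpa using hz i

theorem IsKahlerPotential.exists_det_le (hφ : Δ.IsKahlerPotential φ) :
    ∃ C, ∀ x, (hess Δ.g x).det / (hess (Δ.f φ) x).det ≤ C := by
  have h1 : ∀ b : Fin n → Fin Δ.d, ∃ C : ℝ, ∀ hb : Δ.IsFrame b,
      ∀ z ∈ Metric.closedBall (0 : Fin n → ℂ) 1, ‖Δ.H φ hb z‖ ≤ C := by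
    intro b
    by_cases hb : Δ.IsFrame b
    · obtain ⟨C, hC⟩ := (isCompact_closedBall (0 : Fin n → ℂ) 1).exists_bound_of_continuousOn
        (hφ.continuous_H hb).continuousOn
      exact ⟨C, fun _ => hC⟩
    · exact ⟨0, fun h => absurd h hb⟩
  choose C hC using h1
  refine ⟨∑ b, |C b|, fun x => ?_⟩
  obtain ⟨b, p, e, F, hx⟩ := Δ.exists_frame_inner_nonpos x
  have h2 := hC b F.isFrame (chartPt e x) (by
    rw [mem_closedBall_zero_iff, pi_norm_le_iff_of_nonneg zero_le_one]
    intro i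
    rw [chartPt, Complex.norm_real, Real.norm_of_nonneg (exp_pos _).le, Real.exp_le_one_iff]
    linarith [hx i])
  rw [hφ.H_eq F.isFrame (chartPt_ne_zero e x), logAffine, F.sum_log_norm_chartPt] at h2
  exact (le_abs_self _).trans (h2.trans ((le_abs_self _).trans
    (Finset.single_le_sum (f := fun b => |C b|) (fun _ _ => abs_nonneg _) (Finset.mem_univ b))))

theorem IsKahlerPotential.H_le_of_forall (hφ : Δ.IsKahlerPotential φ) {C : ℝ}
    (hC : ∀ x, (hess Δ.g x).det / (hess (Δ.f φ) x).det ≤ C) {b : Fin n → Fin Δ.d}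
    (hb : Δ.IsFrame b) (z : Fin n → ℂ) : Δ.H φ hb z ≤ C := by
  have h1 : Dense {z : Fin n → ℂ | ∀ i, z i ≠ 0} := by
    have h2 := dense_pi (s := fun _ : Fin n => ({0}ᶜ : Set ℂ)) Set.univ
      fun i _ => dense_compl_singleton (0 : ℂ)
    refine h2.mono fun z hz i => ?_
    simpa using hz i (Set.mem_univ i)
  have h3 : IsClosed {z | Δ.H φ hb z ≤ C} := isClosed_le (hφ.continuous_H hb) continuous_const
  have h4 : {z : Fin n → ℂ | ∀ i, z i ≠ 0} ⊆ {z | Δ.H φ hb z ≤ C} := fun z hz => by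
    rw [Set.mem_ofPred_eq, hφ.H_eq hb hz]
    exact hC _
  have h5 := (h1.closure_eq ▸ closure_minimal h4 h3) (Set.mem_univ z)
  exact h5

end DelzantPolytope

/-! ### Convexity and maxima through restriction to lines. -/

section Lines

variable {E : Type*} [NormedAddCommGroup E] [NormedSpace ℝ E] {F : E → ℝ}

theorem hasDerivAt_comp_line (hF : Differentiable ℝ F) (x v : E) (t : ℝ) :
    HasDerivAt (fun t : ℝ => F (x + t • v)) (fderiv ℝ F (x + t • v) v) t := by
  have h : HasDerivAt (fun t : ℝ => x + t • v) v t := by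
    simpa using ((hasDerivAt_id t).smul_const v).const_add x
  exact (hF (x + t • v)).hasFDerivAt.comp_hasDerivAt t h

theorem hasDerivAt_fderiv_comp_line (hF : ContDiff ℝ ∞ F) (x v : E) (t : ℝ) :
    HasDerivAt (fun t : ℝ => fderiv ℝ F (x + t • v) v)
      (fderiv ℝ (fderiv ℝ F) (x + t • v) v v) t := by
  have h1 : Differentiable ℝ (fderiv ℝ F) :=
    (hF.fderiv_right (m := ∞) le_rfl).differentiable (by simp)
  have h2 := hasDerivAt_comp_line (F := fun y => fderiv ℝ F y v)
    (h1.clm_apply (differentiable_const v)) x v t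
  rwa [fderiv_clm_apply (h1 _) (differentiableAt_const _), fderiv_fun_const, Pi.zero_apply,
    ContinuousLinearMap.comp_zero, zero_add, ContinuousLinearMap.flip_apply] at h2

/-- A convex function lies above its tangents. -/
theorem add_fderiv_le_of_fderiv_fderiv_nonneg (hF : ContDiff ℝ ∞ F)
    (h : ∀ x v, 0 ≤ fderiv ℝ (fderiv ℝ F) x v v) (x v : E) : F x + fderiv ℝ F x v ≤ F (x + v) := by
  have h1 := hasDerivAt_comp_line (hF.differentiable (by simp)) x v
  have h2 := hasDerivAt_fderiv_comp_line hF x v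
  have hmono : Monotone fun t : ℝ => fderiv ℝ F (x + t • v) v :=
    monotone_of_deriv_nonneg (fun t => (h2 t).differentiableAt)
      fun t => by rw [(h2 t).deriv]; exact h _ _
  obtain ⟨c, hc, hc2⟩ := exists_hasDerivAt_eq_slope _ _ zero_lt_one
    (fun t _ => (h1 t).continuousAt.continuousWithinAt) fun t _ => h1 t
  have h3 := hmono hc.1.le
  simp only [zero_smul, add_zero, one_smul, sub_zero, div_one] at h3 hc2
  linarith

/-- The second derivative is negative semidefinite at a maximum. -/
theorem fderiv_fderiv_nonpos_of_forall_le (hF : ContDiff ℝ ∞ F) {x : E} (hx : ∀ y, F y ≤ F x)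
    (v : E) : fderiv ℝ (fderiv ℝ F) x v v ≤ 0 := by
  by_contra! hlt
  have h1 := hasDerivAt_comp_line (hF.differentiable (by simp)) x v
  have h2 := hasDerivAt_fderiv_comp_line hF x v 0
  rw [zero_smul, add_zero] at h2
  have h3 : deriv (fun t : ℝ => F (x + t • v)) = fun t : ℝ => fderiv ℝ F (x + t • v) v :=
    funext fun t => (h1 t).deriv
  have hmax : IsLocalMax (fun t : ℝ => F (x + t • v)) 0 :=
    Filter.Eventually.of_forall fun t => by simpa using hx _
  -- If the second derivative were positive, the maximum would also be a local minimum, and the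
  -- function would be locally constant along the line.
  have hmin := isLocalMin_of_deriv_deriv_pos (f := fun t : ℝ => F (x + t • v)) (x₀ := 0)
    (by rw [h3, h2.deriv]; exact hlt) hmax.deriv_eq_zero (h1 0).continuousAt
  have hc : (fun t : ℝ => F (x + t • v)) =ᶠ[𝓝 0] fun _ => F (x + (0 : ℝ) • v) := by
    filter_upwards [hmax, hmin] with t h4 h5 using le_antisymm h4 h5
  have h6 := hc.deriv.deriv_eq
  rw [h3, h2.deriv] at h6
  simp at h6
  linarith

end Lines

/-! ### Growth of g and the moment map of f. -/

namespace DelzantPolytope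

open Matrix

variable {n : ℕ} {Δ : DelzantPolytope n} {φ : Δ.ToricVariety → ℝ} {D : EV n → ℝ} {R : ℝ}

variable (Δ) in
theorem exists_abs_guilleminU_le : ∃ C, ∀ ξ ∈ Δ.body, |Δ.guilleminU ξ| ≤ C :=
  Δ.isCompact_body.exists_bound_of_continuousOn Δ.continuous_guilleminU.continuousOn

variable (Δ) in
/-- The potential of the Guillemin metric grows at infinity faster than a linear function. -/
theorem exists_norm_le_g_sub : ∃ ξ ∈ Δ.openBody, ∃ δ > 0, ∃ C, ∀ x,
    δ * ‖x‖ - C ≤ Δ.g x - inner ℝ ξ x := by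
  obtain ⟨ξ, hξ⟩ := Δ.interior_nonempty
  obtain ⟨C, hC⟩ := Δ.exists_abs_guilleminU_le
  obtain ⟨r, hr, hball⟩ := Metric.mem_nhds_iff.1 (Δ.body_mem_nhds (ξ := ξ) hξ)
  refine ⟨ξ, hξ, r / 2, half_pos hr, C, fun x => ?_⟩
  -- The supremum defining g is tested at the point of a small ball around ξ that lies in the
  -- direction x; for x = 0 this is ξ itself.
  have hmem : ξ + (r / 2 / ‖x‖) • x ∈ Δ.body := by
    apply hball
    rw [Metric.mem_ball, dist_self_add_left, norm_smul, Real.norm_of_nonneg (by positivity)]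
    rcases eq_or_ne ‖x‖ 0 with h | h
    · rw [h]; simpa using hr
    · rw [div_mul_cancel₀ _ h]; linarith
  have h1 := Δ.inner_sub_guilleminU_le_g x hmem
  rw [inner_add_right, inner_smul_right, real_inner_self_eq_norm_sq] at h1
  have h2 := (abs_le.1 (hC _ hmem)).2
  have h3 : r / 2 / ‖x‖ * ‖x‖ ^ 2 = r / 2 * ‖x‖ := by
    rcases eq_or_ne ‖x‖ 0 with h | h
    · rw [h]; simp
    · field_simp
  rw [h3] at h1
  rw [real_inner_comm]
  linarith

namespace IsKahlerPotential

variable (hφ : Δ.IsKahlerPotential φ)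
include hφ

theorem fderiv_fderiv_f_pos (x : EV n) {v : EV n} (hv : v ≠ 0) :
    0 < fderiv ℝ (fderiv ℝ (Δ.f φ)) x v v := by
  have h1 := (hφ.posDef_hess_f x).dotProduct_mulVec_pos (x := fun i => v i) (by
    intro h; apply hv; ext i; exact congrFun h i)
  rw [star_trivial, dotProduct_hess_mulVec (contDiff_f hφ.smooth).contDiffAt] at h1
  exact h1

theorem fderiv_fderiv_f_nonneg (x v : EV n) : 0 ≤ fderiv ℝ (fderiv ℝ (Δ.f φ)) x v v := by
  rcases eq_or_ne v 0 with rfl | hv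
  · simp
  · exact (hφ.fderiv_fderiv_f_pos x hv).le

/-- Along x - tν_k convexity gives f ≥ f(x) - t⟨∇f(x), ν_k⟩, whereas g is at most a constant plus t
c_k, since its slopes lie in the polytope. As φ is bounded above, -t l_k(∇f(x)) stays bounded as t
grows. -/
theorem l_gradient_f_nonneg {M : ℝ} (hM : ∀ m, φ m ≤ M) (k : Fin Δ.d) (x : EV n) :
    0 ≤ Δ.l k (gradient (Δ.f φ) x) := by
  have hf := contDiff_f hφ.smooth
  obtain ⟨C, hC⟩ := Δ.exists_abs_guilleminU_le
  obtain ⟨B, hB⟩ := Δ.isBounded_body.exists_norm_le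
  by_contra! hneg
  have h1 : ∀ t : ℝ, 0 ≤ t → -t * Δ.l k (gradient (Δ.f φ) x) ≤ ‖x‖ * B + C + M - Δ.f φ x := by
    intro t ht
    have h2 := add_fderiv_le_of_fderiv_fderiv_nonneg hf hφ.fderiv_fderiv_f_nonneg x (-t • Δ.nu k)
    rw [map_smul, smul_eq_mul, fderiv_eq_inner_gradient] at h2
    obtain ⟨ξ, hξ, hξx⟩ := Δ.exists_gradU_eq (x + -t • Δ.nu k)
    have h3 : Δ.g (x + -t • Δ.nu k) = inner ℝ (x + -t • Δ.nu k) ξ - Δ.guilleminU ξ := by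
      rw [← hξx, Δ.g_gradU hξ]
    rw [inner_add_left, inner_smul_left] at h3
    have h4 := (abs_le.1 (hC ξ (Δ.openBody_subset hξ))).1
    have h5 : inner ℝ x ξ ≤ ‖x‖ * B := (real_inner_le_norm _ _).trans
      (mul_le_mul_of_nonneg_left (hB _ (Δ.openBody_subset hξ)) (norm_nonneg _))
    have h6 := hM (Δ.expPoint (x + -t • Δ.nu k))
    have h7 := Δ.l_sub_l k (gradient (Δ.f φ) x) ξ
    rw [inner_sub_right] at h7
    have h8 := hξ k
    have h9 : Δ.f φ (x + -t • Δ.nu k) = Δ.g (x + -t • Δ.nu k) + φ (Δ.expPoint (x + -t • Δ.nu k)) :=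
      rfl
    rw [real_inner_comm] at h2
    simp only [conj_trivial] at h3
    nlinarith [mul_nonneg ht h8.le]
  have h2 := h1 ((|‖x‖ * B + C + M - Δ.f φ x| + 1) / -Δ.l k (gradient (Δ.f φ) x))
    (by have : 0 < -Δ.l k (gradient (Δ.f φ) x) := by linarith
        positivity)
  have h3 : -((|‖x‖ * B + C + M - Δ.f φ x| + 1) / -Δ.l k (gradient (Δ.f φ) x))
      * Δ.l k (gradient (Δ.f φ) x) = |‖x‖ * B + C + M - Δ.f φ x| + 1 := by
    have := hneg.ne
    field_simp
  rw [h3] at h2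
  linarith [le_abs_self (‖x‖ * B + C + M - Δ.f φ x)]

/-- The moment map of `ω_f` takes values in the polytope. -/
theorem gradient_f_mem {M : ℝ} (hM : ∀ m, φ m ≤ M) (x : EV n) :
    gradient (Δ.f φ) x ∈ Δ.openBody := by
  intro k
  refine lt_of_le_of_ne (hφ.l_gradient_f_nonneg hM k x) fun h => ?_
  have h1 := hasDerivAt_fderiv_comp_line (contDiff_f hφ.smooth) x (Δ.nu k) 0
  rw [zero_smul, add_zero] at h1
  have hl : ∀ t : ℝ, Δ.l k (gradient (Δ.f φ) (x + t • Δ.nu k))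
      = fderiv ℝ (Δ.f φ) (x + t • Δ.nu k) (Δ.nu k) + Δ.c k := by
    intro t
    rw [fderiv_eq_inner_gradient, l_eq_inner, real_inner_comm]
  -- If l_k(∇f) vanished at x, it would have a minimum there along ν_k, so the second derivative of
  -- f in that direction would be zero, against strict convexity.
  have hmin : IsLocalMin (fun t : ℝ => fderiv ℝ (Δ.f φ) (x + t • Δ.nu k) (Δ.nu k)) 0 := by
    refine Filter.Eventually.of_forall fun t => ?_
    have h2 := hφ.l_gradient_f_nonneg hM k (x + t • Δ.nu k)
    have h3 := hl 0
    rw [zero_smul, add_zero, ← h] at h3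
    rw [hl] at h2
    simp only [zero_smul, add_zero]
    linarith
  have h2 := hmin.hasDerivAt_eq_zero h1
  exact (hφ.fderiv_fderiv_f_pos x (Δ.nu_ne_zero k)).ne' h2

end IsKahlerPotential

/-- Both the gradient of log D and the diameter are at most √R, so the mean value inequality gives
their product R. -/
theorem IsCurlyR.log_sub_log_le (hR : Δ.IsCurlyR D R) (hD : ContDiffOn ℝ ∞ D Δ.body)
    (hD0 : ∀ ξ ∈ Δ.body, 0 < D ξ) {ξ η : EV n} (hξ : ξ ∈ Δ.openBody) (hη : η ∈ Δ.openBody) :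
    log (D ξ) - log (D η) ≤ R := by
  have hconv : Convex ℝ Δ.openBody := by
    intro a ha c hc s t hs ht hst k
    rw [Δ.l_convexComb k _ _ _ _ hst]
    rcases hs.eq_or_lt with rfl | hs'
    · rw [zero_add] at hst
      subst hst
      simpa using hc k
    · have := mul_pos hs' (ha k)
      have := mul_nonneg ht (hc k).le
      linarith
  have h1 := hconv.norm_image_sub_le_of_norm_fderiv_le (𝕜 := ℝ) (f := fun ξ => log (D ξ)) (C := √R)
    (fun ζ hζ => (contDiffAt_log_D hD hD0 hζ).differentiableAt (by simp))
    (fun ζ hζ => ContinuousLinearMap.opNorm_le_bound _ (Real.sqrt_nonneg _)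
      fun v => hR.abs_fderiv_le hζ v) hη hξ
  have h2 := hR.norm_sub_le (Δ.openBody_subset hξ) (Δ.openBody_subset hη)
  have h3 := mul_le_mul_of_nonneg_left h2 (Real.sqrt_nonneg R)
  rw [Real.mul_self_sqrt hR.nonneg] at h3
  exact (le_abs_self _).trans (h1.trans h3)

end DelzantPolytope

/-! ### The maximum principle. -/

namespace DelzantPolytope

open Matrix

variable {n : ℕ} {Δ : DelzantPolytope n} {φ : Δ.ToricVariety → ℝ} {D : EV n → ℝ} {R : ℝ}

namespace IsKahlerPotential

variable (hφ : Δ.IsKahlerPotential φ)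
include hφ

theorem logF_f {M : ℝ} (hM : ∀ m, φ m ≤ M) (hD0 : ∀ ξ ∈ Δ.body, 0 < D ξ) (x : EV n) :
    logF D (Δ.f φ) x = log (D (gradient (Δ.f φ) x)) + log (hess (Δ.f φ) x).det :=
  Real.log_mul (hD0 _ (Δ.openBody_subset (hφ.gradient_f_mem hM x))).ne'
    (hφ.posDef_hess_f x).det_pos.ne'

theorem contDiff_logF_f {M : ℝ} (hM : ∀ m, φ m ≤ M) (hD : ContDiffOn ℝ ∞ D Δ.body)
    (hD0 : ∀ ξ ∈ Δ.body, 0 < D ξ) : ContDiff ℝ ∞ (logF D (Δ.f φ)) := by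
  rw [funext (hφ.logF_f hM hD0)]
  have hf := contDiff_f hφ.smooth
  rw [contDiff_iff_contDiffAt]
  intro x
  refine ContDiffAt.add ?_ (ContDiffAt.log (contDiffAt_det fun i j => ?_)
    (hφ.posDef_hess_f x).det_pos.ne')
  · exact (contDiffAt_log_D hD hD0 (hφ.gradient_f_mem hM x)).comp x
      (contDiff_gradient hf).contDiffAt
  · exact (contDiff_pd (contDiff_pd hf j) i).contDiffAt

/-- By the chain rule the derivative of log D_f contains a factor f_{ja}, which cancels f^{ij}. The
first order term becomes a Euclidean inner product with ∇ log D on the polytope. -/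
theorem SD_f_eq {M : ℝ} (hM : ∀ m, φ m ≤ M) (hD : ContDiffOn ℝ ∞ D Δ.body)
    (hD0 : ∀ ξ ∈ Δ.body, 0 < D ξ) (x : EV n) :
    SD D (Δ.f φ) x = -((hess (Δ.f φ) x)⁻¹ * hess (logF D (Δ.f φ)) x).trace
      - inner ℝ (gradient (logF D (Δ.f φ)) x)
        (gradient (fun η => log (D η)) (gradient (Δ.f φ) x)) := by
  have hf := contDiff_f hφ.smooth
  have hP := hφ.contDiff_logF_f hM hD hD0
  have h1 : ((hess (Δ.f φ) x)⁻¹ * hess (logF D (Δ.f φ)) x).trace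
      = ∑ i, ∑ j, (hess (Δ.f φ) x)⁻¹ i j * pd i (pd j (logF D (Δ.f φ))) x := by
    simp only [Matrix.trace, Matrix.diag_apply, Matrix.mul_apply]
    exact Finset.sum_congr rfl fun i _ => Finset.sum_congr rfl fun j _ => by
      rw [hess_symm hP.contDiffAt]; rfl
  have h2 : ∀ j, pd j (logD D (Δ.f φ)) x
      = ∑ a, hess (Δ.f φ) x j a * pd a (fun η => log (D η)) (gradient (Δ.f φ) x) := fun j =>
    pd_comp_gradient (G := fun η => log (D η)) hf
      ((contDiffAt_log_D hD hD0 (hφ.gradient_f_mem hM x)).differentiableAt (by simp)) j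
  have h3 : ∑ i, ∑ j, (hess (Δ.f φ) x)⁻¹ i j * pd i (logF D (Δ.f φ)) x * pd j (logD D (Δ.f φ)) x
      = inner ℝ (gradient (logF D (Δ.f φ)) x)
        (gradient (fun η => log (D η)) (gradient (Δ.f φ) x)) := by
    rw [inner_eq_sum]
    refine Finset.sum_congr rfl fun i _ => ?_
    rw [gradient_apply, gradient_apply]
    have h4 : ∀ a, ∑ j, (hess (Δ.f φ) x)⁻¹ i j * hess (Δ.f φ) x j a = if i = a then 1 else 0 := by
      intro a
      have := congrFun (congrFun (Matrix.nonsing_inv_mul _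
        (Ne.isUnit (hφ.posDef_hess_f x).det_pos.ne')) i) a
      rwa [Matrix.mul_apply, Matrix.one_apply] at this
    calc _ = pd i (logF D (Δ.f φ)) x * ∑ a, (∑ j, (hess (Δ.f φ) x)⁻¹ i j * hess (Δ.f φ) x j a)
          * pd a (fun η => log (D η)) (gradient (Δ.f φ) x) := by
          simp only [h2, Finset.mul_sum, Finset.sum_mul]
          rw [Finset.sum_comm]
          exact Finset.sum_congr rfl fun a _ => Finset.sum_congr rfl fun j _ => by ring
      _ = _ := by simp [h4]
  rw [SD, h1, h3]

/-- The estimate of the trace of the Guillemin metric at a maximum point of the test function. -/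
theorem trace_le_of_forall_le (hD : ContDiffOn ℝ ∞ D Δ.body) (hD0 : ∀ ξ ∈ Δ.body, 0 < D ξ)
    (hR : Δ.IsCurlyR D R) {M : ℝ} (hM : ∀ m, φ m ≤ M) {S : ℝ}
    {b : Fin n → Fin Δ.d} {p : EV n} {e : Fin n → EV n} (F : Δ.Frame b p e)
    {q : EV n} (hq : q ∈ Δ.body) {ε : ℝ} (hε : 0 ≤ ε) (hε1 : ε ≤ 1) {x : EV n}
    (hS : |SD D (Δ.f φ) x| ≤ S)
    (hx : ∀ y, inner ℝ ((5 / 4 * R) • p + ∑ i, e i + ε • q) y + (3 / 4 * R + 1) * Δ.g y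
        - (2 * R + 1 + ε) * Δ.f φ y - logF D (Δ.f φ) y
      ≤ inner ℝ ((5 / 4 * R) • p + ∑ i, e i + ε • q) x + (3 / 4 * R + 1) * Δ.g x
        - (2 * R + 1 + ε) * Δ.f φ x - logF D (Δ.f φ) x) :
    0 ≤ ((hess (Δ.f φ) x)⁻¹ * hess Δ.g x).trace ∧
    ((hess (Δ.f φ) x)⁻¹ * hess Δ.g x).trace ≤ (2 * R + 2) * n + S + (2 * R + 4) * R := by
  set w := (5 / 4 * R) • p + ∑ i, e i + ε • q with hw
  have hR0 := hR.nonneg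
  have hf := contDiff_f hφ.smooth
  have hg := Δ.contDiff_g
  have hP := hφ.contDiff_logF_f hM hD hD0
  set f := Δ.f φ with hfdef
  set P := logF D f with hPdef
  let Ψ : EV n → ℝ := fun y => inner ℝ w y + (3 / 4 * R + 1) * Δ.g y
    - (2 * R + 1 + ε) * f y - P y
  have hΨ : ContDiff ℝ ∞ Ψ := (((contDiff_const.inner ℝ contDiff_id).add (contDiff_const.mul hg)).sub
    (contDiff_const.mul hf)).sub hP
  have hpd : ∀ i, pd i Ψ = fun y => w i + (3 / 4 * R + 1) * pd i Δ.g y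
      - (2 * R + 1 + ε) * pd i f y - pd i P y := by
    intro i
    funext y
    have h1 : HasFDerivAt Ψ (innerSL ℝ w + (3 / 4 * R + 1) • fderiv ℝ Δ.g y
        - (2 * R + 1 + ε) • fderiv ℝ f y - fderiv ℝ P y) y :=
      ((((innerSL ℝ w).hasFDerivAt).add ((hg.differentiable (by simp) y).hasFDerivAt.const_mul _)).sub
        ((hf.differentiable (by simp) y).hasFDerivAt.const_mul _)).sub
        (hP.differentiable (by simp) y).hasFDerivAt
    rw [pd, h1.fderiv]
    simp [pd, inner_single_right]
  have hhess : hess Ψ x = (3 / 4 * R + 1) • hess Δ.g x - (2 * R + 1 + ε) • hess f x - hess P x := by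
    ext i j
    have h1 : HasFDerivAt (fun y => w j + (3 / 4 * R + 1) * pd j Δ.g y
      - (2 * R + 1 + ε) * pd j f y - pd j P y) ((3 / 4 * R + 1) • fderiv ℝ (pd j Δ.g) x
        - (2 * R + 1 + ε) • fderiv ℝ (pd j f) x - fderiv ℝ (pd j P) x) x :=
      (((((contDiff_pd hg j).differentiable (by simp) x).hasFDerivAt.const_mul _).const_add _).sub
        (((contDiff_pd hf j).differentiable (by simp) x).hasFDerivAt.const_mul _)).sub
        ((contDiff_pd hP j).differentiable (by simp) x).hasFDerivAt
    show pd i (pd j Ψ) x = _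
    rw [hpd, pd, h1.fderiv]
    simp [pd, hess]
  -- The coefficients balance, 5/4 R + (3/4 R + 1) + ε = 2R + 1 + ε, so apart from ∑ e_i only
  -- differences of points of the polytope appear.
  have hgrad : gradient P x = ∑ i, e i + (5 / 4 * R) • (p - gradient f x)
      + (3 / 4 * R + 1) • (gradient Δ.g x - gradient f x) + ε • (q - gradient f x) := by
    have h0 : fderiv ℝ Ψ x = 0 := IsLocalMax.fderiv_eq_zero (Filter.Eventually.of_forall hx)
    ext i
    have h1 := congrFun (hpd i) x
    rw [pd, h0] at h1
    simp only [_root_.zero_apply] at h1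
    have h2 : w i = (5 / 4 * R) * p i + (∑ j, e j) i + ε * q i := by simp [hw]
    simp only [PiLp.add_apply, PiLp.smul_apply, PiLp.sub_apply, smul_eq_mul, gradient_apply]
    rw [h2] at h1
    linarith
  have hfm := hφ.gradient_f_mem hM x
  have hfb := Δ.openBody_subset hfm
  have hgb := Δ.openBody_subset (Δ.gradient_g_mem x)
  -- The four terms contribute 2, 5/4 R, 3/4 R + 1 and 1, each times √R.
  have hnorm : ‖gradient P x‖ ≤ (2 * R + 4) * √R := by
    have a0 := F.norm_sum_e_le hD hD0 hR
    have a1 := hR.norm_sub_le F.mem hfb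
    have a2 := hR.norm_sub_le hgb hfb
    have a3 := hR.norm_sub_le hq hfb
    have b1 : ‖(5 / 4 * R) • (p - gradient f x)‖ ≤ 5 / 4 * R * √R := by
      rw [norm_smul, Real.norm_of_nonneg (by positivity)]
      exact mul_le_mul_of_nonneg_left a1 (by positivity)
    have b2 : ‖(3 / 4 * R + 1) • (gradient Δ.g x - gradient f x)‖ ≤ (3 / 4 * R + 1) * √R := by
      rw [norm_smul, Real.norm_of_nonneg (by positivity)]
      exact mul_le_mul_of_nonneg_left a2 (by positivity)
    have b3 : ‖ε • (q - gradient f x)‖ ≤ 1 * √R := by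
      rw [norm_smul, Real.norm_of_nonneg hε]
      exact mul_le_mul hε1 a3 (norm_nonneg _) zero_le_one
    rw [hgrad]
    refine (norm_add_le _ _).trans ((add_le_add ((norm_add_le _ _).trans
      (add_le_add ((norm_add_le _ _).trans (add_le_add a0 b1)) b2)) b3).trans (le_of_eq ?_))
    ring
  have hinner : -inner ℝ (gradient P x) (gradient (fun η => log (D η)) (gradient f x))
      ≤ (2 * R + 4) * R := by
    have h1 := (neg_le_abs _).trans (abs_real_inner_le_norm (gradient P x)
      (gradient (fun η => log (D η)) (gradient f x)))
    have h2 := mul_le_mul hnorm (hR.norm_gradient_le hfm) (norm_nonneg _) (by positivity)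
    rw [mul_assoc, Real.mul_self_sqrt hR0] at h2
    exact h1.trans h2
  have hfpos := (hφ.posDef_hess_f x)
  have hinv : (hess f x)⁻¹ * hess f x = 1 := Matrix.nonsing_inv_mul _ (Ne.isUnit hfpos.det_pos.ne')
  have hneg : (-hess Ψ x).PosSemidef := by
    refine PosSemidef.of_dotProduct_mulVec_nonneg ?_ fun y => ?_
    · ext i j
      rw [Matrix.conjTranspose_apply, star_trivial, Matrix.neg_apply, Matrix.neg_apply]
      exact congrArg _ (hess_symm hΨ.contDiffAt j i)
    · rw [star_trivial, Matrix.neg_mulVec, dotProduct_neg, dotProduct_hess_mulVec hΨ.contDiffAt]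
      exact neg_nonneg.2 (fderiv_fderiv_nonpos_of_forall_le hΨ hx _)
  have htr := hfpos.inv.posSemidef.trace_mul_nonneg hneg
  have ht0 := hfpos.inv.posSemidef.trace_mul_nonneg (Δ.posDef_hess_g x).posSemidef
  rw [hhess, mul_neg, Matrix.trace_neg, Matrix.mul_sub, Matrix.mul_sub, Matrix.trace_sub,
    Matrix.trace_sub, mul_smul_comm, mul_smul_comm, hinv, Matrix.trace_smul, Matrix.trace_smul,
    Matrix.trace_one, Fintype.card_fin, smul_eq_mul, smul_eq_mul] at htr
  have hSD := hφ.SD_f_eq hM hD hD0 x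
  have hS' := (abs_le.1 hS).1
  refine ⟨ht0, ?_⟩
  have hn : (0 : ℝ) ≤ n := Nat.cast_nonneg n
  have h9 : (2 * R + 1 + ε) * n ≤ (2 * R + 2) * n := mul_le_mul_of_nonneg_right (by linarith) hn
  -- The trace appears with the factor 3/4 R + 1; its nonnegative part 3/4 R is discarded and the
  -- summand 1 gives the bound.
  have h10 := mul_nonneg (show 0 ≤ 3 / 4 * R by positivity) ht0
  linarith

end IsKahlerPotential

end DelzantPolytope

namespace DelzantPolytope

open Matrix

/-- The logarithm of the constant in the estimate of the volume ratio. -/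
def logVolumeBound (n : ℕ) (S R : ℝ) : ℝ :=
  cardBound n R * (nefBound n R * ((n + 1) * (5 / 4 * R)) + 5 / 4 * R * facetBound n R)
    + ((facetBound n R + 1) * (cardBound n R * nefBound n R) + log (detBound n R))
    + log (((2 * R + 2) * n + S + (2 * R + 4) * R) ^ n) + R

variable {n : ℕ} {Δ : DelzantPolytope n} {φ : Δ.ToricVariety → ℝ} {D : EV n → ℝ} {R : ℝ}

namespace IsKahlerPotential

variable (hφ : Δ.IsKahlerPotential φ)
include hφ

/-- The vertex defining Ψ is chosen near ∇g(x), for the point x to be estimated, so the lower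
comparison holds at x. At the unknown maximum point the upper comparison suffices, and it holds for
every vertex. -/
theorem log_det_div_le (hD : ContDiffOn ℝ ∞ D Δ.body) (hD0 : ∀ ξ ∈ Δ.body, 0 < D ξ)
    (hR : Δ.IsCurlyR D R) {S : ℝ} (hS : ∀ x, |SD D (Δ.f φ) x| ≤ S)
    {M m : ℝ} (hM : ∀ y, φ y ≤ M) (hm : ∀ y, m ≤ φ y) (x : EV n) :
    log (hess Δ.g x).det - log (hess (Δ.f φ) x).det
      ≤ logVolumeBound n S R + (2 * R + 1) * (M - m) := by
  have hR0 := hR.nonneg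
  obtain ⟨b, p, e, F, hF⟩ := exists_log_det_hess_g_le hD hD0 hR x
  obtain ⟨q, hq, δ, hδ, c, hc⟩ := Δ.exists_norm_le_g_sub
  obtain ⟨C, hC⟩ := hφ.exists_det_le
  obtain ⟨B, hB⟩ := Δ.isCompact_body.exists_bound_of_continuousOn
    (f := fun ξ => log (D ξ)) (hD.continuousOn.log fun ξ hξ => (hD0 ξ hξ).ne')
  set f := Δ.f φ with hf
  have hfφ : ∀ y, f y = Δ.g y + φ (Δ.expPoint y) := fun y => rfl
  have hP := hφ.contDiff_logF_f hM hD hD0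
  have hPe : ∀ y, logF D f y = log (D (gradient f y)) + log (hess f y).det := hφ.logF_f hM hD0
  have hgpos : ∀ y, 0 < (hess Δ.g y).det := fun y => (Δ.posDef_hess_g y).det_pos
  have hfpos : ∀ y, 0 < (hess f y).det := fun y => (hφ.posDef_hess_f y).det_pos
  set v := (5 / 4 * R) • p + ∑ i, e i with hv
  have hlin : ∀ y, inner ℝ v y - 5 / 4 * R * Δ.g y - log (hess Δ.g y).det
      ≤ (facetBound n R + 1) * (cardBound n R * nefBound n R) + log (detBound n R) :=
    log_det_hess_g_ge hD hD0 hR F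
  -- For ε = 0 the test function need not attain its maximum. The estimate for ε > 0 has uniform
  -- main terms, and ε multiplies a quantity depending only on the fixed data.
  suffices key : ∀ ε : ℝ, 0 < ε → ε ≤ 1 → log (hess Δ.g x).det - log (hess f x).det
      ≤ logVolumeBound n S R + (2 * R + 1) * (M - m)
        + ε * (f x - inner ℝ q x + c - m) by
    have hlim : Filter.Tendsto (fun ε : ℝ => logVolumeBound n S R + (2 * R + 1) * (M - m)
        + ε * (f x - inner ℝ q x + c - m)) (𝓝[>] 0)
        (𝓝 (logVolumeBound n S R + (2 * R + 1) * (M - m)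
          + 0 * (f x - inner ℝ q x + c - m))) :=
      ((continuous_const.add (continuous_id.mul continuous_const)).tendsto 0).mono_left
        nhdsWithin_le_nhds
    rw [zero_mul, add_zero] at hlim
    refine ge_of_tendsto hlim ?_
    filter_upwards [Ioc_mem_nhdsGT (zero_lt_one (α := ℝ))] with ε hε using key ε hε.1 hε.2
  intro ε hε hε1
  let Ψ : EV n → ℝ := fun y => inner ℝ (v + ε • q) y + (3 / 4 * R + 1) * Δ.g y
    - (2 * R + 1 + ε) * f y - logF D f y
  have hΨc : Continuous Ψ := (((continuous_const.inner continuous_id).add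
    (continuous_const.mul Δ.contDiff_g.continuous)).sub
    (continuous_const.mul (contDiff_f hφ.smooth).continuous)).sub hP.continuous
  -- Here (2R + 1) f is split into 5/4 R g + (3/4 R + 1) g + (2R + 1) φ, and log det(g_ij) is
  -- subtracted and added.
  have hΨe : ∀ y, Ψ y = (inner ℝ v y - 5 / 4 * R * Δ.g y - log (hess Δ.g y).det)
      + (log (hess Δ.g y).det - log (hess f y).det) - log (D (gradient f y))
      - (2 * R + 1) * φ (Δ.expPoint y) - ε * (f y - inner ℝ q y) := by
    intro y
    simp only [Ψ, hPe, hfφ, inner_add_left, inner_smul_left, conj_trivial]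
    ring
  have hprop : ∀ y, δ * ‖y‖ - c + m ≤ f y - inner ℝ q y := by
    intro y
    have h1 := hc y
    have h2 := hm (Δ.expPoint y)
    rw [hfφ]
    linarith
  -- All groups of terms are bounded above except the last, which is at most a constant minus εδ‖y‖.
  -- The nonuniform bounds `C` and `B` enter only here.
  obtain ⟨x0, hx0⟩ : ∃ x0, ∀ y, Ψ y ≤ Ψ x0 := by
    refine hΨc.exists_forall_ge ?_
    have h1 : ∀ y, Ψ y ≤ ((facetBound n R + 1) * (cardBound n R * nefBound n R)
        + log (detBound n R) + log C + B - (2 * R + 1) * m + ε * (c - m)) + -(ε * δ) * ‖y‖ := by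
      intro y
      rw [hΨe]
      have h2 := hlin y
      have h3 : log (hess Δ.g y).det - log (hess f y).det ≤ log C := by
        rw [← Real.log_div (hgpos y).ne' (hfpos y).ne']
        exact Real.log_le_log (div_pos (hgpos y) (hfpos y)) (hC y)
      have h4 := (abs_le.1 (hB _ (Δ.openBody_subset (hφ.gradient_f_mem hM y)))).1
      have h5 := mul_le_mul_of_nonneg_left (hm (Δ.expPoint y)) (show 0 ≤ 2 * R + 1 by positivity)
      have h6 := mul_le_mul_of_nonneg_left (hprop y) hε.le
      linarith
    refine Filter.tendsto_atBot_mono h1 (Filter.tendsto_atBot_add_const_left _ _ ?_)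
    exact (tendsto_norm_cocompact_atTop (E := EV n)).const_mul_atTop_of_neg
      (neg_neg_of_pos (mul_pos hε hδ))
  obtain ⟨ht0, ht⟩ := hφ.trace_le_of_forall_le hD hD0 hR hM F (Δ.openBody_subset hq) hε.le hε1
    (hS x0) hx0
  have hratio : log (hess Δ.g x0).det - log (hess f x0).det
      ≤ log (((2 * R + 2) * n + S + (2 * R + 4) * R) ^ n) := by
    have h1 := (hφ.posDef_hess_f x0).inv.posSemidef.det_mul_le_trace_pow
      (Δ.posDef_hess_g x0).posSemidef
    rw [Fintype.card_fin, Matrix.det_mul, Matrix.det_nonsing_inv, Ring.inverse_eq_inv',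
      inv_mul_eq_div] at h1
    rw [← Real.log_div (hgpos x0).ne' (hfpos x0).ne']
    exact Real.log_le_log (div_pos (hgpos x0) (hfpos x0)) (h1.trans (pow_le_pow_left₀ ht0 ht n))
  -- Of the difference of Ψ at x and x0, log D accounts for R and φ for (2R + 1)(M - m); the two
  -- comparisons and the bound on the ratio at x0 give the rest.
  have h1 := hx0 x
  rw [hΨe x, hΨe x0] at h1
  have h2 := hlin x0
  have h3 := hR.log_sub_log_le hD hD0 (hφ.gradient_f_mem hM x) (hφ.gradient_f_mem hM x0)
  have h4 := mul_le_mul_of_nonneg_left (hprop x0) hε.le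
  have h5 : 0 ≤ ε * (δ * ‖x0‖) := by positivity
  have h6 := mul_le_mul_of_nonneg_left (sub_le_sub (hM (Δ.expPoint x)) (hm (Δ.expPoint x0)))
    (show 0 ≤ 2 * R + 1 by positivity)
  unfold logVolumeBound
  linarith

end IsKahlerPotential

end DelzantPolytope

end

/-! ### Conclusion on all of M. -/

theorem theorem3p1 :
    ∃ C : ℕ → ℝ → ℝ → ℝ,
      ∀ (n : ℕ) (Δ : DelzantPolytope n)
        (D : EV n → ℝ) (_ : ContDiffOn ℝ ∞ D Δ.body) (_ : ∀ ξ ∈ Δ.body, 0 < D ξ)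
        (R : ℝ) (_ : Δ.IsCurlyR D R)
        (φ : Δ.ToricVariety → ℝ) (_ : Δ.IsKahlerPotential φ)
        (maxS : ℝ) (_ : IsLUB (Set.range fun x : EV n => |SD D (Δ.f φ) x|) maxS)
        (maxφ minφ : ℝ) (_ : IsGreatest (Set.range φ) maxφ) (_ : IsLeast (Set.range φ) minφ)
        (b : Fin n → Fin Δ.d) (hb : Δ.IsFrame b) (z : Fin n → ℂ),
          Δ.H φ hb z ≤ C n maxS R * Real.exp ((2 * R + 1) * (maxφ - minφ)) := by
  refine ⟨fun n S R => exp (DelzantPolytope.logVolumeBound n S R), ?_⟩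
  intro n Δ D hD hD0 R hR φ hφ S hS M m hM hm b hb z
  refine hφ.H_le_of_forall (fun x => ?_) hb z
  have hg := (Δ.posDef_hess_g x).det_pos
  have hf := (hφ.posDef_hess_f x).det_pos
  rw [← Real.exp_add, ← Real.log_le_iff_le_exp (div_pos hg hf), Real.log_div hg.ne' hf.ne']
  exact hφ.log_det_div_le hD hD0 hR (fun x => hS.1 ⟨x, rfl⟩) (fun y => hM.2 ⟨y, rfl⟩)
    (fun y => hm.2 ⟨y, rfl⟩) x
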